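/- **Theorem (Preciseness).** The subtyping $\leqslant$ of synchronous multiparty session types is operationally precise: for all session types $T,T'$ (closed and well formed), $T\leqslant T'$ holds if and only if there are no process $P$, participant $p$ and multiparty session $M$ such that (i) $\vdash P:T$; (ii) for every process $Q$ with $\vdash Q:T'$ the session $p\triangleleft Q\mid M$ is well typed; and (iii) $p\triangleleft P\mid M$ gets stuck. The notions are as follows. Participants $p,q,r,\dots$ and labels $\ell$ range over countably infinite sets. *Expressions.* Values are integers (including the natural numbers) and booleans; expressions are $e::=x\mid v\mid \mathtt{succ}(e)\mid\mathtt{neg}(e)\mid\neg e\mid e\oplus e\mid e>e$. Evaluation $e\downarrow v$ is compositional: $\mathtt{succ}$ is defined only on natural numbers, $\mathtt{neg}$ (sign change) and $>$ only on integers, $\neg$ only on booleans, and $e_1\oplus e_2$ evaluates to any value of $e_1$ or of $e_2$. Sorts are $\mathtt{nat},\mathtt{int},\mathtt{bool}$; subsorting $\le:$ is the reflexive relation generated by $\mathtt{nat}\le:\mathtt{int}$. In $\Gamma\vdash e:S$, natural numbers have sort $\mathtt{nat}$, integers $\mathtt{int}$, booleans $\mathtt{bool}$, variables the sort in $\Gamma$;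 $\mathtt{succ}:\mathtt{nat}\to\mathtt{nat}$, $\mathtt{neg}:\mathtt{int}\to\mathtt{int}$, $\neg:\mathtt{bool}\to\mathtt{bool}$, $>:\mathtt{int}\times\mathtt{int}\to\mathtt{bool}$, $\oplus:S\times S\to S$, and sorts may be raised along $\le:$. *Processes and sessions.* $P::=p?\ell(x).P\mid p!\ell(e).P\mid P+P\mid \mathsf{if}\ e\ \mathsf{then}\ P\ \mathsf{else}\ P\mid\mu X.P\mid X\mid \mathbf 0$, where recursion is guarded (the body of $\mu X$ is not $X$, nor $X$ below further binders $\mu Y$) and $\mu X.P$ is identified with $P\{\mu X.P/X\}$. Sessions are $M::=p\triangleleft P\mid M\mid M$. Structural congruence $\equiv$ is the congruence that makes $+$ and $\mid$ commutative and associative and has $p\triangleleft\mathbf 0\mid M\equiv M$. Reduction $\to$ is closed under parallel composition and $\equiv$ and is generated by $p\triangleleft\sum_{i\in I}q?\ell_i(x).P_i\mid q\triangleleft p!\ell_j(e).Q\to p\triangleleft P_j\{v/x\}\mid q\triangleleft Q$ for $j\in I$, $e\downarrow v$, and by $p\triangleleft\mathsf{if}\ e\ \mathsf{then}\ P\ \mathsf{else}\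 Q\to p\triangleleft P$ (respectively $p\triangleleft Q$) for $e\downarrow\mathsf{true}$ (respectively $e\downarrow\mathsf{false}$). A session is stuck if it is not $\equiv p\triangleleft\mathbf 0$ for any $p$ and does not reduce; it gets stuck if it reduces in zero or more steps to a stuck session. *Types.* Session types are $T::=\bigwedge_{i\in I}p?\ell_i(S_i).T_i\mid\bigvee_{i\in I}p!\ell_i(S_i).T_i\mid\mu t.T\mid t\mid\mathtt{end}$ and global types are $G::=p\to q:\{\ell_i(S_i).G_i\}_{i\in I}\mid\mu t.G\mid t\mid\mathtt{end}$ with $p\ne q$; each $I$ is finite and nonempty and unordered, the $\ell_i$ in one choice are distinct, recursion is guarded. Session types with the same regular tree are considered equal. Subtyping $\leqslant$ is the relation on the trees defined coinductively by: $\mathtt{end}\leqslant\mathtt{end}$; $\bigwedge_{i\in I\cup J}p?\ell_i(S_i).T_i\leqslant\bigwedge_{i\in I}p?\ell_i(S_i').T_i'$ if $S_i'\le:S_i$ and $T_i\leqslant T_i'$ for all $i\in I$; $\bigvee_{i\in I}p!\ell_i(S_i).T_i\leqslant\bigvee_{i\in I\cup J}p!\ell_i(S_i').T_i'$ if $S_i\le:S_i'$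 and $T_i\leqslant T_i'$ for all $i\in I$. *Projection.* The partial operation $T\sqcap T'$ is $T$ if $T=T'$; it is $T\wedge T'$ if $T,T'$ are intersections of inputs from the same participant with no label in common; otherwise it is undefined. It is iterated over finite nonempty families in any order and bracketing. The projection $G{\upharpoonright}r$ is the partial operation with $(p\to q:\{\ell_i(S_i).G_i\}_{i\in I}){\upharpoonright}r=\bigvee_{i\in I}q!\ell_i(S_i).(G_i{\upharpoonright}r)$ if $r=p$, $=\bigwedge_{i\in I}p?\ell_i(S_i).(G_i{\upharpoonright}r)$ if $r=q$, and $=\bigsqcap_{i\in I}(G_i{\upharpoonright}r)$ otherwise; $t{\upharpoonright}r=t$; $\mathtt{end}{\upharpoonright}r=\mathtt{end}$; $(\mu t.G){\upharpoonright}r=\mathtt{end}$ if $r$ does not occur in $G$ and $\mu t.G$ is closed, and $=\mu t.(G{\upharpoonright}r)$ otherwise. *Typing.* $\Gamma\vdash P:T$ is derived by the following rules. If $\Gamma,x:S_i\vdash P_i:T_i$ for all $i\in I$ and the $\ell_i$ are distinct, then $\Gamma\vdash\sum_{i\in I}q?\ell_i(x).P_i:\bigwedge_{i\in I}q?\ell_i(S_i).T_i$.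 If $\Gamma\vdash e:S$ and $\Gamma\vdash P:T$, then $\Gamma\vdash q!\ell(e).P:q!\ell(S).T$. If $\Gamma\vdash e:\mathtt{bool}$ and $\Gamma\vdash P_k:T_k$ for $k=1,2$, then $\Gamma\vdash\mathsf{if}\ e\ \mathsf{then}\ P_1\ \mathsf{else}\ P_2:T_1\vee T_2$, where $T_1\vee T_2$ is $T_1$ if $T_1=T_2$ and the union if $T_1,T_2$ are unions of outputs to the same participant with no label in common. Moreover $\Gamma\vdash\mathbf 0:\mathtt{end}$; $\Gamma,X:T\vdash X:T$; if $\Gamma,X:T\vdash P:T$ then $\Gamma\vdash\mu X.P:T$; if $\Gamma\vdash P:T$ and $T\leqslant T'$ then $\Gamma\vdash P:T'$; and processes that are identified by unfolding recursion have the same types. A session $p_1\triangleleft P_1\mid\dots\mid p_n\triangleleft P_n$ with distinct $p_i$ is well typed if there is a closed global type $G$ whose participants are all among $p_1,\dots,p_n$ such that $G{\upharpoonright}p_i$ is defined and $\vdash P_i:G{\upharpoonright}p_i$ for every $i$. -/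

import Mathlib

namespace MPST

/-- Session participants (a countably infinite base set). -/
abbrev Participant := ℕ

/-- Message labels (a countably infinite base set). -/
abbrev Label := ℕ

/-! ### Sorts, values and expressions -/

/-- Sorts `nat`, `int`, `bool`. -/
inductive Srt where
  | nat
  | int
  | bool

/-- Subsorting: the reflexive and transitive closure of `nat ≤ int`. -/
inductive Srt.Sub : Srt → Srt → Prop where
  | refl (S : Srt) : Srt.Sub S S
  | nat_int : Srt.Sub Srt.nat Srt.int

/-- Values: integers (the natural numbers are the nonnegative ones) and booleans. -/
inductive Value where
  | num (z : ℤ)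
  | bool (b : Bool)

/-- Expressions; variables are de Bruijn indices. `choice` is the operator `⊕`, `gt` is `>`. -/
inductive Expr where
  | var (x : ℕ)
  | val (v : Value)
  | succ (e : Expr)
  | neg (e : Expr)
  | not (e : Expr)
  | choice (e₁ e₂ : Expr)
  | gt (e₁ e₂ : Expr)

/-- Evaluation `e ↓ v`. The operator `succ` is defined on natural numbers only, `neg` on integers,
`not` on booleans, `>` on integers, and `⊕` evaluates to a value of either argument. Evaluation
inside evaluation contexts is built into the rules. -/
inductive Expr.Eval : Expr → Value → Prop where
  | val (v : Value) : Expr.Eval (.val v) v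
  | succ {e : Expr} {z : ℤ} : Expr.Eval e (.num z) → 0 ≤ z → Expr.Eval (.succ e) (.num (z + 1))
  | neg {e : Expr} {z : ℤ} : Expr.Eval e (.num z) → Expr.Eval (.neg e) (.num (-z))
  | not {e : Expr} {b : Bool} : Expr.Eval e (.bool b) → Expr.Eval (.not e) (.bool (!b))
  | choice_left {e₁ e₂ : Expr} {v : Value} : Expr.Eval e₁ v → Expr.Eval (.choice e₁ e₂) v
  | choice_right {e₁ e₂ : Expr} {v : Value} : Expr.Eval e₂ v → Expr.Eval (.choice e₁ e₂) v
  | gt {e₁ e₂ : Expr} {z₁ z₂ : ℤ} : Expr.Eval e₁ (.num z₁) → Expr.Eval e₂ (.num z₂) →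
      Expr.Eval (.gt e₁ e₂) (.bool (decide (z₂ < z₁)))

/-- Increment every variable with index at least `k`. -/
def Expr.shift (k : ℕ) : Expr → Expr
  | .var x => .var (if x < k then x else x + 1)
  | .val v => .val v
  | .succ e => .succ (e.shift k)
  | .neg e => .neg (e.shift k)
  | .not e => .not (e.shift k)
  | .choice e₁ e₂ => .choice (e₁.shift k) (e₂.shift k)
  | .gt e₁ e₂ => .gt (e₁.shift k) (e₂.shift k)

/-- Replace the variable with index `k` by the value `v` and remove that index. -/
def Expr.subst (k : ℕ) (v : Value) : Expr → Expr
  | .var x => if x < k then .var x else if x = k then .val v else .var (x - 1)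
  | .val w => .val w
  | .succ e => .succ (e.subst k v)
  | .neg e => .neg (e.subst k v)
  | .not e => .not (e.subst k v)
  | .choice e₁ e₂ => .choice (e₁.subst k v) (e₂.subst k v)
  | .gt e₁ e₂ => .gt (e₁.subst k v) (e₂.subst k v)

/-- Typing of expressions, `Γ ⊢ e : S`; the context lists the sorts of the variables. -/
inductive Expr.HasSort (Γ : List Srt) : Expr → Srt → Prop where
  | nat (z : ℤ) : 0 ≤ z → Expr.HasSort Γ (.val (.num z)) .nat
  | int (z : ℤ) : Expr.HasSort Γ (.val (.num z)) .int
  | bool (b : Bool) : Expr.HasSort Γ (.val (.bool b)) .bool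
  | var (x : ℕ) (S : Srt) : Γ[x]? = some S → Expr.HasSort Γ (.var x) S
  | succ {e : Expr} : Expr.HasSort Γ e .nat → Expr.HasSort Γ (.succ e) .nat
  | neg {e : Expr} : Expr.HasSort Γ e .int → Expr.HasSort Γ (.neg e) .int
  | not {e : Expr} : Expr.HasSort Γ e .bool → Expr.HasSort Γ (.not e) .bool
  | choice {e₁ e₂ : Expr} {S : Srt} : Expr.HasSort Γ e₁ S → Expr.HasSort Γ e₂ S →
      Expr.HasSort Γ (.choice e₁ e₂) S
  | gt {e₁ e₂ : Expr} : Expr.HasSort Γ e₁ .int → Expr.HasSort Γ e₂ .int →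
      Expr.HasSort Γ (.gt e₁ e₂) .bool
  | sub {e : Expr} {S S' : Srt} : Expr.HasSort Γ e S → Srt.Sub S S' → Expr.HasSort Γ e S'

/-! ### Processes -/

/-- Raw processes. `inp p ℓ P` is `p?ℓ(x).P` and binds an expression variable, `mu P` is `μX.P`
and binds a process variable; both kinds of variables are de Bruijn indices, counted separately. -/
inductive Proc where
  | inp (p : Participant) (ℓ : Label) (P : Proc)
  | out (p : Participant) (ℓ : Label) (e : Expr) (P : Proc)
  | sum (P Q : Proc)
  | ite (e : Expr) (P Q : Proc)
  | mu (P : Proc)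
  | var (X : ℕ)
  | nil

/-- The process is the variable `X`, possibly below some binders `μY`. -/
def Proc.Unguarded (X : ℕ) : Proc → Prop
  | .var Y => Y = X
  | .mu P => P.Unguarded (X + 1)
  | _ => False

/-- Recursion is guarded everywhere. The processes of the calculus are the raw processes with this
property. -/
def Proc.Guarded : Proc → Prop
  | .inp _ _ P => P.Guarded
  | .out _ _ _ P => P.Guarded
  | .sum P Q => P.Guarded ∧ Q.Guarded
  | .ite _ P Q => P.Guarded ∧ Q.Guarded
  | .mu P => ¬ P.Unguarded 0 ∧ P.Guarded
  | .var _ => True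
  | .nil => True

/-- Increment the expression variables with index at least `k`. -/
def Proc.shiftExpr (k : ℕ) : Proc → Proc
  | .inp p ℓ P => .inp p ℓ (P.shiftExpr (k + 1))
  | .out p ℓ e P => .out p ℓ (e.shift k) (P.shiftExpr k)
  | .sum P Q => .sum (P.shiftExpr k) (Q.shiftExpr k)
  | .ite e P Q => .ite (e.shift k) (P.shiftExpr k) (Q.shiftExpr k)
  | .mu P => .mu (P.shiftExpr k)
  | .var X => .var X
  | .nil => .nil

/-- Increment the process variables with index at least `k`. -/
def Proc.shiftProc (k : ℕ) : Proc → Proc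
  | .inp p ℓ P => .inp p ℓ (P.shiftProc k)
  | .out p ℓ e P => .out p ℓ e (P.shiftProc k)
  | .sum P Q => .sum (P.shiftProc k) (Q.shiftProc k)
  | .ite e P Q => .ite e (P.shiftProc k) (Q.shiftProc k)
  | .mu P => .mu (P.shiftProc (k + 1))
  | .var X => .var (if X < k then X else X + 1)
  | .nil => .nil

/-- Replace the expression variable with index `k` by the value `v` and remove that index. -/
def Proc.substVal (k : ℕ) (v : Value) : Proc → Proc
  | .inp p ℓ P => .inp p ℓ (P.substVal (k + 1) v)
  | .out p ℓ e P => .out p ℓ (e.subst k v) (P.substVal k v)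
  | .sum P Q => .sum (P.substVal k v) (Q.substVal k v)
  | .ite e P Q => .ite (e.subst k v) (P.substVal k v) (Q.substVal k v)
  | .mu P => .mu (P.substVal k v)
  | .var X => .var X
  | .nil => .nil

/-- Capture-avoiding replacement of the process variable with index `k` by `R`, removing that
index. -/
def Proc.substProc : Proc → ℕ → Proc → Proc
  | .inp p ℓ P, k, R => .inp p ℓ (P.substProc k (R.shiftExpr 0))
  | .out p ℓ e P, k, R => .out p ℓ e (P.substProc k R)
  | .sum P Q, k, R => .sum (P.substProc k R) (Q.substProc k R)
  | .ite e P Q, k, R => .ite e (P.substProc k R) (Q.substProc k R)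
  | .mu P, k, R => .mu (P.substProc (k + 1) (R.shiftProc 0))
  | .var X, k, R => if X < k then .var X else if X = k then R else .var (X - 1)
  | .nil, _, _ => .nil

/-- The least congruence on processes that contains `B`. -/
inductive Proc.Cong (B : Proc → Proc → Prop) : Proc → Proc → Prop where
  | base {P Q : Proc} : B P Q → Proc.Cong B P Q
  | refl (P : Proc) : Proc.Cong B P P
  | symm {P Q : Proc} : Proc.Cong B P Q → Proc.Cong B Q P
  | trans {P Q R : Proc} : Proc.Cong B P Q → Proc.Cong B Q R → Proc.Cong B P R
  | inp {P P' : Proc} (p : Participant) (ℓ : Label) : Proc.Cong B P P' →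
      Proc.Cong B (.inp p ℓ P) (.inp p ℓ P')
  | out {P P' : Proc} (p : Participant) (ℓ : Label) (e : Expr) : Proc.Cong B P P' →
      Proc.Cong B (.out p ℓ e P) (.out p ℓ e P')
  | sum {P P' Q Q' : Proc} : Proc.Cong B P P' → Proc.Cong B Q Q' →
      Proc.Cong B (.sum P Q) (.sum P' Q')
  | ite {P P' Q Q' : Proc} (e : Expr) : Proc.Cong B P P' → Proc.Cong B Q Q' →
      Proc.Cong B (.ite e P Q) (.ite e P' Q')
  | mu {P P' : Proc} : Proc.Cong B P P' → Proc.Cong B (.mu P) (.mu P')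

/-- One unfolding `μX.P = P{μX.P/X}`. -/
inductive Proc.UnfoldStep : Proc → Proc → Prop where
  | unfold (P : Proc) : Proc.UnfoldStep (.mu P) (P.substProc 0 (.mu P))

/-- The axioms of structural congruence of processes. -/
inductive Proc.StructStep : Proc → Proc → Prop where
  | unfold (P : Proc) : Proc.StructStep (.mu P) (P.substProc 0 (.mu P))
  | comm (P Q : Proc) : Proc.StructStep (.sum P Q) (.sum Q P)
  | assoc (P Q R : Proc) : Proc.StructStep (.sum (.sum P Q) R) (.sum P (.sum Q R))

/-- The equi-recursive identification of processes. -/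
def Proc.UnfoldEq : Proc → Proc → Prop := Proc.Cong Proc.UnfoldStep

/-- Structural congruence `P ≡ Q` of processes. -/
def Proc.StructEq : Proc → Proc → Prop := Proc.Cong Proc.StructStep

/-- `Proc.InSum q P bs`: the process `P` is (in some bracketing) the sum of the inputs
`q?ℓ(x).P'` for the pairs `(ℓ, P')` of the list `bs`. -/
inductive Proc.InSum (q : Participant) : Proc → List (Label × Proc) → Prop where
  | inp (ℓ : Label) (P : Proc) : Proc.InSum q (.inp q ℓ P) [(ℓ, P)]
  | sum {P Q : Proc} {bs cs : List (Label × Proc)} : Proc.InSum q P bs → Proc.InSum q Q cs →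
      Proc.InSum q (.sum P Q) (bs ++ cs)

/-! ### Multiparty sessions -/

/-- Multiparty sessions: `pa p P` is `p ◁ P`, `par` is parallel composition. -/
inductive Session where
  | pa (p : Participant) (P : Proc)
  | par (M N : Session)

/-- The pairs that a session is composed of. -/
def Session.components : Session → List (Participant × Proc)
  | .pa p P => [(p, P)]
  | .par M N => M.components ++ N.components

/-- All processes of the session are guarded. -/
def Session.Guarded : Session → Prop
  | .pa _ P => P.Guarded
  | .par M N => M.Guarded ∧ N.Guarded

/-- Structural congruence `M ≡ N` of sessions. -/
inductive Session.StructEq : Session → Session → Prop where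
  | refl (M : Session) : Session.StructEq M M
  | symm {M N : Session} : Session.StructEq M N → Session.StructEq N M
  | trans {M N K : Session} : Session.StructEq M N → Session.StructEq N K → Session.StructEq M K
  | par {M M' N N' : Session} : Session.StructEq M M' → Session.StructEq N N' →
      Session.StructEq (.par M N) (.par M' N')
  | multi (p : Participant) {P Q : Proc} : Proc.StructEq P Q →
      Session.StructEq (.pa p P) (.pa p Q)
  | par_nil (p : Participant) (M : Session) : Session.StructEq (.par (.pa p .nil) M) M
  | par_comm (M N : Session) : Session.StructEq (.par M N) (.par N M)
  | par_assoc (M N K : Session) : Session.StructEq (.par (.par M N) K) (.par M (.par N K))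

/-- Reduction of sessions. -/
inductive Session.Step : Session → Session → Prop where
  | comm {p q : Participant} {P Pj Q : Proc} {bs : List (Label × Proc)} {ℓ : Label} {e : Expr}
      {v : Value} : Proc.InSum q P bs → (ℓ, Pj) ∈ bs → Expr.Eval e v →
      Session.Step (.par (.pa p P) (.pa q (.out p ℓ e Q)))
        (.par (.pa p (Pj.substVal 0 v)) (.pa q Q))
  | ite_true {p : Participant} {e : Expr} (P Q : Proc) : Expr.Eval e (.bool true) →
      Session.Step (.pa p (.ite e P Q)) (.pa p P)
  | ite_false {p : Participant} {e : Expr} (P Q : Proc) : Expr.Eval e (.bool false) →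
      Session.Step (.pa p (.ite e P Q)) (.pa p Q)
  | context {M M' : Session} (N : Session) : Session.Step M M' →
      Session.Step (.par M N) (.par M' N)
  | struct {M₁ M₁' M₂ M₂' : Session} : Session.StructEq M₁' M₁ → Session.Step M₁ M₂ →
      Session.StructEq M₂ M₂' → Session.Step M₁' M₂'

/-- A session is stuck if it is not congruent to some `p ◁ 0` and it does not reduce. -/
def Session.Stuck (M : Session) : Prop :=
  (¬ ∃ p : Participant, Session.StructEq M (.pa p .nil)) ∧ ¬ ∃ M' : Session, Session.Step M M'

/-- A session gets stuck if it reduces, in any number of steps, to a stuck session. -/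
def Session.GetsStuck (M : Session) : Prop :=
  ∃ M' : Session, Relation.ReflTransGen Session.Step M M' ∧ M'.Stuck

/-! ### Session types -/

/-- Raw session types. `inp p n ℓ S T` is the intersection `⋀ᵢ p?ℓᵢ(Sᵢ).Tᵢ` and `out p n ℓ S T` the
union `⋁ᵢ p!ℓᵢ(Sᵢ).Tᵢ` over `i < n`, `mu T` is `μt.T` (de Bruijn), and `done` is the type `end`. -/
inductive SType where
  | inp (p : Participant) (n : ℕ) (ℓ : Fin n → Label) (S : Fin n → Srt) (T : Fin n → SType)
  | out (p : Participant) (n : ℕ) (ℓ : Fin n → Label) (S : Fin n → Srt) (T : Fin n → SType)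
  | mu (T : SType)
  | var (t : ℕ)
  | done

/-- The type is the variable `t`, possibly below some binders. -/
def SType.Unguarded (t : ℕ) : SType → Prop
  | .var s => s = t
  | .mu T => T.Unguarded (t + 1)
  | _ => False

/-- All free variables have an index below `k`. -/
def SType.ClosedAt (k : ℕ) : SType → Prop
  | .inp _ _ _ _ T => ∀ i, (T i).ClosedAt k
  | .out _ _ _ _ T => ∀ i, (T i).ClosedAt k
  | .mu T => T.ClosedAt (k + 1)
  | .var t => t < k
  | .done => True

/-- Intersections and unions are nonempty and have pairwise distinct labels, and recursion is
guarded. -/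
def SType.WellFormed : SType → Prop
  | .inp _ n ℓ _ T => 0 < n ∧ Function.Injective ℓ ∧ ∀ i, (T i).WellFormed
  | .out _ n ℓ _ T => 0 < n ∧ Function.Injective ℓ ∧ ∀ i, (T i).WellFormed
  | .mu T => ¬ T.Unguarded 0 ∧ T.WellFormed
  | .var _ => True
  | .done => True

/-- The session types that processes may have: closed and well formed. -/
def SType.IsSessionType (T : SType) : Prop := T.ClosedAt 0 ∧ T.WellFormed

/-- Increment the variables with index at least `k`. -/
def SType.shift (k : ℕ) : SType → SType
  | .inp p n ℓ S T => .inp p n ℓ S (fun i => (T i).shift k)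
  | .out p n ℓ S T => .out p n ℓ S (fun i => (T i).shift k)
  | .mu T => .mu (T.shift (k + 1))
  | .var t => .var (if t < k then t else t + 1)
  | .done => .done

/-- Capture-avoiding replacement of the variable with index `k` by `U`, removing that index. -/
def SType.subst : SType → ℕ → SType → SType
  | .inp p n ℓ S T, k, U => .inp p n ℓ S (fun i => (T i).subst k U)
  | .out p n ℓ S T, k, U => .out p n ℓ S (fun i => (T i).subst k U)
  | .mu T, k, U => .mu (T.subst (k + 1) (U.shift 0))
  | .var t, k, U => if t < k then .var t else if t = k then U else .var (t - 1)
  | .done, _, _ => .done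

/-- `T.Unfolds U`: unfolding the recursions at the root of `T` gives `U`, which is not itself a
recursion. So the root of `U` is the root of the regular tree of `T`. -/
inductive SType.Unfolds : SType → SType → Prop where
  | root {T : SType} : (∀ T' : SType, T ≠ .mu T') → SType.Unfolds T T
  | mu {T U : SType} : SType.Unfolds (T.subst 0 (.mu T)) U → SType.Unfolds (.mu T) U

/-- One layer of equality of regular trees. -/
inductive SType.EqRule (R : SType → SType → Prop) (T U : SType) : Prop where
  | done : T.Unfolds .done → U.Unfolds .done → SType.EqRule R T U
  | var (t : ℕ) : T.Unfolds (.var t) → U.Unfolds (.var t) → SType.EqRule R T U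
  | inp (p : Participant) (n m : ℕ) (ℓ : Fin n → Label) (ℓ' : Fin m → Label) (S : Fin n → Srt)
      (S' : Fin m → Srt) (T' : Fin n → SType) (U' : Fin m → SType) :
      T.Unfolds (.inp p n ℓ S T') → U.Unfolds (.inp p m ℓ' S' U') →
      (∀ i, ∃ j, ℓ i = ℓ' j ∧ S i = S' j ∧ R (T' i) (U' j)) →
      (∀ j, ∃ i, ℓ i = ℓ' j ∧ S i = S' j ∧ R (T' i) (U' j)) → SType.EqRule R T U
  | out (p : Participant) (n m : ℕ) (ℓ : Fin n → Label) (ℓ' : Fin m → Label) (S : Fin n → Srt)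
      (S' : Fin m → Srt) (T' : Fin n → SType) (U' : Fin m → SType) :
      T.Unfolds (.out p n ℓ S T') → U.Unfolds (.out p m ℓ' S' U') →
      (∀ i, ∃ j, ℓ i = ℓ' j ∧ S i = S' j ∧ R (T' i) (U' j)) →
      (∀ j, ∃ i, ℓ i = ℓ' j ∧ S i = S' j ∧ R (T' i) (U' j)) → SType.EqRule R T U

/-- Equality of session types: they have the same regular tree (up to the order of the branches). -/
def SType.TreeEq (T U : SType) : Prop :=
  ∃ R : SType → SType → Prop, (∀ T' U', R T' U' → SType.EqRule R T' U') ∧ R T U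

/-- The rules of subtyping, applied to the regular trees; `R` stands for the premises between
session types. -/
inductive SType.SubRule (R : SType → SType → Prop) (T U : SType) : Prop where
  | done : T.Unfolds .done → U.Unfolds .done → SType.SubRule R T U
  | inp (p : Participant) (n m : ℕ) (ℓ : Fin n → Label) (ℓ' : Fin m → Label) (S : Fin n → Srt)
      (S' : Fin m → Srt) (T' : Fin n → SType) (U' : Fin m → SType) :
      T.Unfolds (.inp p n ℓ S T') → U.Unfolds (.inp p m ℓ' S' U') →
      (∀ j, ∃ i, ℓ i = ℓ' j ∧ Srt.Sub (S' j) (S i) ∧ R (T' i) (U' j)) → SType.SubRule R T U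
  | out (p : Participant) (n m : ℕ) (ℓ : Fin n → Label) (ℓ' : Fin m → Label) (S : Fin n → Srt)
      (S' : Fin m → Srt) (T' : Fin n → SType) (U' : Fin m → SType) :
      T.Unfolds (.out p n ℓ S T') → U.Unfolds (.out p m ℓ' S' U') →
      (∀ i, ∃ j, ℓ i = ℓ' j ∧ Srt.Sub (S i) (S' j) ∧ R (T' i) (U' j)) → SType.SubRule R T U

/-- Subtyping `T ≤ U`: the coinductive reading of the rules. -/
def SType.Subtype (T U : SType) : Prop :=
  ∃ R : SType → SType → Prop, (∀ T' U', R T' U' → SType.SubRule R T' U') ∧ R T U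

/-- The partial operator on session types that is used to project: `SType.Merge T U V` says that it
is defined at `T`, `U` and has the value `V`. -/
inductive SType.Merge : SType → SType → SType → Prop where
  | same {T U : SType} : SType.TreeEq T U → SType.Merge T U T
  | inter {T U : SType} {p : Participant} {n m : ℕ} {ℓ : Fin n → Label} {ℓ' : Fin m → Label}
      {S : Fin n → Srt} {S' : Fin m → Srt} {T' : Fin n → SType} {U' : Fin m → SType} :
      T.Unfolds (.inp p n ℓ S T') → U.Unfolds (.inp p m ℓ' S' U') → (∀ i j, ℓ i ≠ ℓ' j) →
      SType.Merge T U
        (.inp p (n + m) (Fin.append ℓ ℓ') (Fin.append S S') (Fin.append T' U'))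

/-- The value of the iterated partial operator on a nonempty finite family. The family is not
ordered, so any order and bracketing is admitted. -/
inductive SType.MergeAll : Multiset SType → SType → Prop where
  | single (T : SType) : SType.MergeAll {T} T
  | add {s t : Multiset SType} {T U V : SType} : SType.MergeAll s T → SType.MergeAll t U →
      SType.Merge T U V → SType.MergeAll (s + t) V

/-- The union `T ∨ U` of session types, where it is again a session type: either the types are equal
or they are unions of outputs to one participant with different labels. -/
inductive SType.Union : SType → SType → SType → Prop where
  | same {T U : SType} : SType.TreeEq T U → SType.Union T U T
  | union {T U : SType} {p : Participant} {n m : ℕ} {ℓ : Fin n → Label} {ℓ' : Fin m → Label}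
      {S : Fin n → Srt} {S' : Fin m → Srt} {T' : Fin n → SType} {U' : Fin m → SType} :
      T.Unfolds (.out p n ℓ S T') → U.Unfolds (.out p m ℓ' S' U') → (∀ i j, ℓ i ≠ ℓ' j) →
      SType.Union T U
        (.out p (n + m) (Fin.append ℓ ℓ') (Fin.append S S') (Fin.append T' U'))

/-! ### Global types and projection -/

/-- Raw global types; `comm p q n ℓ S G` is `p → q : {ℓᵢ(Sᵢ).Gᵢ}` over `i < n`. -/
inductive GType where
  | comm (p q : Participant) (n : ℕ) (ℓ : Fin n → Label) (S : Fin n → Srt) (G : Fin n → GType)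
  | mu (G : GType)
  | var (t : ℕ)
  | done

/-- The type is the variable `t`, possibly below some binders. -/
def GType.Unguarded (t : ℕ) : GType → Prop
  | .var s => s = t
  | .mu G => G.Unguarded (t + 1)
  | _ => False

/-- All free variables have an index below `k`. -/
def GType.ClosedAt (k : ℕ) : GType → Prop
  | .comm _ _ _ _ _ G => ∀ i, (G i).ClosedAt k
  | .mu G => G.ClosedAt (k + 1)
  | .var t => t < k
  | .done => True

/-- No self-communication, nonempty branching, pairwise distinct labels, guarded recursion. -/
def GType.WellFormed : GType → Prop
  | .comm p q n ℓ _ G => p ≠ q ∧ 0 < n ∧ Function.Injective ℓ ∧ ∀ i, (G i).WellFormed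
  | .mu G => ¬ G.Unguarded 0 ∧ G.WellFormed
  | .var _ => True
  | .done => True

/-- The global types that sessions may have: closed and well formed. -/
def GType.IsGlobalType (G : GType) : Prop := G.ClosedAt 0 ∧ G.WellFormed

/-- The set of participants of a global type. -/
def GType.participants : GType → Set Participant
  | .comm p q _ _ _ G => {p, q} ∪ ⋃ i, (G i).participants
  | .mu G => G.participants
  | .var _ => ∅
  | .done => ∅

/-- `GType.Proj r G T`: the projection of `G` onto `r` is defined and equals `T`. A recursion
projects to `end` if it is closed and `r` does not occur in it. In an open recursion without `r` the
free variables stand for enclosing recursions, in which `r` may occur, so these variables have to be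
kept. -/
inductive GType.Proj (r : Participant) : GType → SType → Prop where
  | send {q : Participant} {n : ℕ} {ℓ : Fin n → Label} {S : Fin n → Srt} {G : Fin n → GType}
      {T : Fin n → SType} : (∀ i, GType.Proj r (G i) (T i)) →
      GType.Proj r (.comm r q n ℓ S G) (.out q n ℓ S T)
  | recv {p : Participant} {n : ℕ} {ℓ : Fin n → Label} {S : Fin n → Srt} {G : Fin n → GType}
      {T : Fin n → SType} : p ≠ r → (∀ i, GType.Proj r (G i) (T i)) →
      GType.Proj r (.comm p r n ℓ S G) (.inp p n ℓ S T)
  | other {p q : Participant} {n : ℕ} {ℓ : Fin n → Label} {S : Fin n → Srt} {G : Fin n → GType}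
      {T : Fin n → SType} {U : SType} : r ≠ p → r ≠ q → (∀ i, GType.Proj r (G i) (T i)) →
      SType.MergeAll (Finset.univ.val.map T) U → GType.Proj r (.comm p q n ℓ S G) U
  | mu {G : GType} {T : SType} : (r ∈ G.participants ∨ ¬ (GType.mu G).ClosedAt 0) →
      GType.Proj r G T → GType.Proj r (.mu G) (.mu T)
  | mu_end {G : GType} : r ∉ G.participants → (GType.mu G).ClosedAt 0 →
      GType.Proj r (.mu G) .done
  | var (t : ℕ) : GType.Proj r (.var t) (.var t)
  | done : GType.Proj r .done .done

/-! ### Typing of processes and sessions -/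

/-- Typing of processes: `Γ` lists the sorts of the expression variables, `Δ` the session types of
the process variables. The rule `unfold` expresses that a recursive process is identified with its
unfolding. -/
inductive Proc.HasType : List Srt → List SType → Proc → SType → Prop where
  | in_choice {Γ : List Srt} {Δ : List SType} {q : Participant} {P : Proc} {n : ℕ}
      {ℓ : Fin n → Label} {P' : Fin n → Proc} {S : Fin n → Srt} {T : Fin n → SType} :
      Proc.InSum q P (List.ofFn fun i => (ℓ i, P' i)) → Function.Injective ℓ →
      (∀ i, Proc.HasType (S i :: Γ) Δ (P' i) (T i)) →
      Proc.HasType Γ Δ P (.inp q n ℓ S T)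
  | nil {Γ : List Srt} {Δ : List SType} : Proc.HasType Γ Δ .nil .done
  | out {Γ : List Srt} {Δ : List SType} {q : Participant} {ℓ : Label} {e : Expr} {S : Srt}
      {P : Proc} {T : SType} : Expr.HasSort Γ e S → Proc.HasType Γ Δ P T →
      Proc.HasType Γ Δ (.out q ℓ e P) (.out q 1 (fun _ => ℓ) (fun _ => S) (fun _ => T))
  | cond {Γ : List Srt} {Δ : List SType} {e : Expr} {P₁ P₂ : Proc} {T₁ T₂ T : SType} :
      Expr.HasSort Γ e .bool → Proc.HasType Γ Δ P₁ T₁ → Proc.HasType Γ Δ P₂ T₂ →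
      SType.Union T₁ T₂ T → Proc.HasType Γ Δ (.ite e P₁ P₂) T
  | recur {Γ : List Srt} {Δ : List SType} {P : Proc} {T : SType} : T.IsSessionType →
      Proc.HasType Γ (T :: Δ) P T → Proc.HasType Γ Δ (.mu P) T
  | var {Γ : List Srt} {Δ : List SType} {X : ℕ} {T : SType} : Δ[X]? = some T →
      Proc.HasType Γ Δ (.var X) T
  | sub {Γ : List Srt} {Δ : List SType} {P : Proc} {T T' : SType} : Proc.HasType Γ Δ P T →
      T'.IsSessionType → SType.Subtype T T' → Proc.HasType Γ Δ P T'
  | unfold {Γ : List Srt} {Δ : List SType} {P Q : Proc} {T : SType} : Proc.HasType Γ Δ P T →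
      Proc.UnfoldEq P Q → Proc.HasType Γ Δ Q T

/-- Typing of sessions `⊢ M : G`. The participants of `M` are pairwise distinct. -/
def Session.HasType (M : Session) (G : GType) : Prop :=
  G.IsGlobalType ∧ (M.components.map Prod.fst).Nodup ∧
    (∀ c ∈ M.components, ∃ T : SType, GType.Proj c.1 G T ∧ Proc.HasType [] [] c.2 T) ∧
    ∀ r ∈ G.participants, r ∈ M.components.map Prod.fst

/-- The session is well typed. -/
def Session.Typable (M : Session) : Prop := ∃ G : GType, M.HasType G

/-! ### Operational preciseness -/

/-- A relation on session types is operationally precise if it relates `T` to `T'` exactly when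
there are no process `P` of type `T` and no session `p ◁ [·] | M` that is well typed for every
process of type `T'` in the hole but gets stuck for `P`. -/
def OperationallyPrecise (R : SType → SType → Prop) : Prop :=
  ∀ T T' : SType, T.IsSessionType → T'.IsSessionType →
    (R T T' ↔ ¬ ∃ (P : Proc) (p : Participant) (M : Session), P.Guarded ∧ M.Guarded ∧
      Proc.HasType [] [] P T ∧
      (∀ Q : Proc, Q.Guarded → Proc.HasType [] [] Q T' →
        (Session.par (.pa p Q) M).Typable) ∧
      (Session.par (.pa p P) M).GetsStuck)

end MPST

/-!
Soundness of subtyping says that well-typed sessions do not get stuck, because the rule of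
subsumption gives a process of type `T` every supertype of `T`. Completeness needs, for types with
`¬ T ≤ T'`, a process of type `T` and a network that is safe for all processes of type `T'` but
gets stuck with this one.

*Soundness.* Process typing and projection are inductive and syntactic, whereas recursion unfolds
forever, so both are replaced by coinductive counterparts that follow the regular trees.
`Proc.Sem P V` says what a closed process of type `V` does at its head, and `GType.CoProj r G V`
says that `V` is a subtype of the behaviour of `r` in the closed global type `G`; moreover, if `V`
is not `end`, then `r` is reached on all paths of `G` within finitely many steps. That the derivable
judgements satisfy these rules is shown for closed instances, in which variables are replaced by
types or processes of the same kind (`Proc.HasType.sem`, `GType.Proj.coProj`). Guardedness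
guarantees that unfolding at the root ends. If sender and receiver are both ready, their
communication can be taken out of the global type wherever it occurs (`GType.CoProj.exists_comm`);
this is subject reduction. The root of the global type gives progress. Structural congruence is
handled by passing to multisets of participants with classes of processes (`Config`), where getting
stuck means the same (`Session.getsStuck_iff`). That classes of processes have well-defined actions
is `Proc.StructEq.head`: congruent processes have the same summands up to congruence.

*Completeness.* The characteristic process `T.char` offers every input of `T`, checks the sort of
what it receives by an expression that evaluates only for this sort, and chooses arbitrarily among
the outputs of `T`. The network for `T'` consists of the peers `T'.peer N r` for `r < N`, where the
fresh participant `N` runs the tested process. Each communication of `N` with `q` is followed by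
messages in which `q` tells all other peers the label, so the peers are the projections of the
global type `T'.globalize N`, whose projection to `N` is `T'`. Since projection turns closed
recursions without communications into `end`, the type `T'` is first normalized in the same way,
which does not change its tree. If the network does not get stuck with `T.char`, then the roots of
`T` and `T'` match as subtyping demands, and every branch leads to the network for the continuations
(`Config.subRule_of_not_getsStuck`). So the pairs of types for which the network does not get stuck
form a relation that is closed under the subtyping rules backwards, and it is contained in subtyping
by coinduction.
-/

namespace MPST

/-- The sequence `a, f 0, f 1, …`. -/
def scons {α : Type*} (a : α) (f : ℕ → α) : ℕ → α
  | 0 => a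
  | n + 1 => f n

/-- The action of a renaming below a binder. -/
def liftRen (ξ : ℕ → ℕ) : ℕ → ℕ
  | 0 => 0
  | n + 1 => ξ n + 1

theorem liftRen_comp (ζ ξ : ℕ → ℕ) : liftRen ζ ∘ liftRen ξ = liftRen (ζ ∘ ξ) := by
  funext n; cases n <;> rfl

theorem liftRen_id : liftRen id = id := by
  funext n; cases n <;> rfl

theorem liftRen_shift (k : ℕ) :
    liftRen (fun t => if t < k then t else t + 1) = fun t => if t < k + 1 then t else t + 1 := by
  funext n
  cases n with
  | zero => simp [liftRen]
  | succ n => simp only [liftRen, Nat.add_lt_add_iff_right]; split <;> rfl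

theorem Srt.Sub.trans {S₁ S₂ S₃ : Srt} (h : Srt.Sub S₁ S₂) (h' : Srt.Sub S₂ S₃) :
    Srt.Sub S₁ S₃ := by
  cases h with
  | refl => exact h'
  | nat_int => cases h'; exact .nat_int

/-! ### Simultaneous substitution in session types -/

namespace SType

/-- Rename the free variables. -/
def ren : SType → (ℕ → ℕ) → SType
  | .inp p n ℓ S T, ξ => .inp p n ℓ S (fun i => (T i).ren ξ)
  | .out p n ℓ S T, ξ => .out p n ℓ S (fun i => (T i).ren ξ)
  | .mu T, ξ => .mu (T.ren (liftRen ξ))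
  | .var t, ξ => .var (ξ t)
  | .done, _ => .done

/-- The action of a substitution below a binder. -/
def up (σ : ℕ → SType) : ℕ → SType
  | 0 => .var 0
  | n + 1 => (σ n).shift 0

/-- Simultaneous capture-avoiding substitution. -/
def inst : SType → (ℕ → SType) → SType
  | .inp p n ℓ S T, σ => .inp p n ℓ S (fun i => (T i).inst σ)
  | .out p n ℓ S T, σ => .out p n ℓ S (fun i => (T i).inst σ)
  | .mu T, σ => .mu (T.inst (up σ))
  | .var t, σ => σ t
  | .done, _ => .done

theorem shift_eq_ren (T : SType) (k : ℕ) :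
    T.shift k = T.ren (fun t => if t < k then t else t + 1) := by
  induction T generalizing k with
  | inp p n ℓ S T ih => simp only [shift, ren]; congr; funext i; exact ih i k
  | out p n ℓ S T ih => simp only [shift, ren]; congr; funext i; exact ih i k
  | mu T ih => simp only [shift, ren, ih, liftRen_shift]
  | var t => rfl
  | done => rfl

theorem shift_zero (T : SType) : T.shift 0 = T.ren Nat.succ := by
  rw [shift_eq_ren]; rfl

theorem ren_ren (T : SType) (ξ ζ : ℕ → ℕ) : (T.ren ξ).ren ζ = T.ren (ζ ∘ ξ) := by
  induction T generalizing ξ ζ with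
  | inp p n ℓ S T ih => simp only [ren]; congr; funext i; exact ih i _ _
  | out p n ℓ S T ih => simp only [ren]; congr; funext i; exact ih i _ _
  | mu T ih => simp only [ren, ih, liftRen_comp]
  | var t => rfl
  | done => rfl

theorem inst_ren (T : SType) (ξ : ℕ → ℕ) (σ : ℕ → SType) : (T.ren ξ).inst σ = T.inst (σ ∘ ξ) := by
  induction T generalizing ξ σ with
  | inp p n ℓ S T ih => simp only [ren, inst]; congr; funext i; exact ih i _ _
  | out p n ℓ S T ih => simp only [ren, inst]; congr; funext i; exact ih i _ _
  | mu T ih =>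
    have : up σ ∘ liftRen ξ = up (σ ∘ ξ) := by funext n; cases n <;> rfl
    simp only [ren, inst, ih, this]
  | var t => rfl
  | done => rfl

theorem ren_inst (T : SType) (σ : ℕ → SType) (ξ : ℕ → ℕ) :
    (T.inst σ).ren ξ = T.inst (fun t => (σ t).ren ξ) := by
  induction T generalizing ξ σ with
  | inp p n ℓ S T ih => simp only [ren, inst]; congr; funext i; exact ih i _ _
  | out p n ℓ S T ih => simp only [ren, inst]; congr; funext i; exact ih i _ _
  | mu T ih =>
    have : (fun t => (up σ t).ren (liftRen ξ)) = up (fun t => (σ t).ren ξ) := by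
      funext n
      cases n with
      | zero => rfl
      | succ n => simp only [up, shift_zero, ren_ren]; rfl
    simp only [ren, inst, ih, this]
  | var t => rfl
  | done => rfl

theorem inst_inst (T : SType) (σ τ : ℕ → SType) :
    (T.inst σ).inst τ = T.inst (fun t => (σ t).inst τ) := by
  induction T generalizing σ τ with
  | inp p n ℓ S T ih => simp only [inst]; congr; funext i; exact ih i _ _
  | out p n ℓ S T ih => simp only [inst]; congr; funext i; exact ih i _ _
  | mu T ih =>
    have : (fun t => (up σ t).inst (up τ)) = up (fun t => (σ t).inst τ) := by
      funext n
      cases n with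
      | zero => rfl
      | succ n =>
        simp only [up, shift_zero, inst_ren, ren_inst]
        congr 1; funext m; exact shift_zero _
    simp only [inst, ih, this]
  | var t => rfl
  | done => rfl

theorem up_var : up SType.var = SType.var := by
  funext n; cases n <;> simp [up, shift]

theorem inst_var (T : SType) : T.inst SType.var = T := by
  induction T with
  | inp p n ℓ S T ih => simp only [inst, ih]
  | out p n ℓ S T ih => simp only [inst, ih]
  | mu T ih => simp only [inst, up_var, ih]
  | var t => rfl
  | done => rfl

theorem subst_eq_inst (T : SType) (k : ℕ) (U : SType) :
    T.subst k U =
      T.inst (fun t => if t < k then .var t else if t = k then U else .var (t - 1)) := by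
  induction T generalizing k U with
  | inp p n ℓ S T ih => simp only [subst, inst]; congr; funext i; exact ih i _ _
  | out p n ℓ S T ih => simp only [subst, inst]; congr; funext i; exact ih i _ _
  | mu T ih =>
    simp only [subst, inst, ih]
    congr 2
    funext n
    cases n with
    | zero => simp [up]
    | succ n =>
      simp only [up, Nat.add_lt_add_iff_right, Nat.add_right_cancel_iff, Nat.add_sub_cancel]
      split_ifs with h₁ h₂
      · simp [shift]
      · rfl
      · simp only [shift, Nat.not_lt_zero, if_false]; congr 1; omega
  | var t => rfl
  | done => rfl

theorem subst_zero (T U : SType) : T.subst 0 U = T.inst (scons U SType.var) := by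
  rw [subst_eq_inst]
  congr 1; funext n; cases n <;> simp [scons]

theorem inst_up_subst (T U : SType) (σ : ℕ → SType) :
    (T.inst (up σ)).subst 0 U = T.inst (scons U σ) := by
  rw [subst_zero, inst_inst]
  congr 1; funext n
  cases n with
  | zero => rfl
  | succ n => simp only [up, shift_zero, inst_ren]; exact inst_var _

theorem subst_inst (T U : SType) (σ : ℕ → SType) :
    (T.subst 0 U).inst σ = T.inst (scons (U.inst σ) σ) := by
  rw [subst_zero, inst_inst]
  congr 1; funext n; cases n <;> rfl

theorem unfold_inst (T : SType) (σ : ℕ → SType) :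
    (T.subst 0 (.mu T)).inst σ = (T.inst (up σ)).subst 0 (.mu (T.inst (up σ))) := by
  rw [subst_inst, inst_up_subst]; rfl

/-! ### Closedness and well-formedness -/

theorem inst_congr {T : SType} {k : ℕ} (h : T.ClosedAt k) {σ τ : ℕ → SType}
    (hστ : ∀ t < k, σ t = τ t) : T.inst σ = T.inst τ := by
  induction T generalizing k σ τ with
  | inp p n ℓ S T ih => simp only [inst]; congr; funext i; exact ih i (h i) hστ
  | out p n ℓ S T ih => simp only [inst]; congr; funext i; exact ih i (h i) hστ
  | mu T ih =>
    simp only [inst]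
    rw [ih h]
    intro t ht
    cases t with
    | zero => rfl
    | succ t => simp only [up]; rw [hστ t (by omega)]
  | var t => exact hστ t h
  | done => rfl

theorem inst_closed {T : SType} (h : T.ClosedAt 0) (σ : ℕ → SType) : T.inst σ = T := by
  rw [inst_congr h (τ := SType.var) (by simp), inst_var]

theorem closedAt_mono {T : SType} {k m : ℕ} (h : T.ClosedAt k) (hkm : k ≤ m) : T.ClosedAt m := by
  induction T generalizing k m with
  | inp p n ℓ S T ih => exact fun i => ih i (h i) hkm
  | out p n ℓ S T ih => exact fun i => ih i (h i) hkm
  | mu T ih => exact ih (k := k + 1) (m := m + 1) h (by omega)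
  | var t => exact lt_of_lt_of_le (show t < k from h) hkm
  | done => trivial

theorem closedAt_ren {T : SType} {k m : ℕ} {ξ : ℕ → ℕ} (h : T.ClosedAt k)
    (hξ : ∀ t < k, ξ t < m) : (T.ren ξ).ClosedAt m := by
  induction T generalizing k m ξ with
  | inp p n ℓ S T ih => exact fun i => ih i (h i) hξ
  | out p n ℓ S T ih => exact fun i => ih i (h i) hξ
  | mu T ih =>
    refine ih (k := k + 1) (m := m + 1) h fun t ht => ?_
    cases t with
    | zero => simp [liftRen]
    | succ t => have := hξ t (by omega); simp only [liftRen]; omega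
  | var t => exact hξ t h
  | done => trivial

theorem closedAt_inst {T : SType} {k m : ℕ} {σ : ℕ → SType} (h : T.ClosedAt k)
    (hσ : ∀ t < k, (σ t).ClosedAt m) : (T.inst σ).ClosedAt m := by
  induction T generalizing k m σ with
  | inp p n ℓ S T ih => exact fun i => ih i (h i) hσ
  | out p n ℓ S T ih => exact fun i => ih i (h i) hσ
  | mu T ih =>
    refine ih (k := k + 1) (m := m + 1) h fun t ht => ?_
    cases t with
    | zero => exact Nat.succ_pos m
    | succ t =>
      simp only [up, shift_zero]
      exact closedAt_ren (hσ t (by omega)) fun s hs => Nat.succ_lt_succ hs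
  | var t => exact hσ t h
  | done => trivial

theorem inst_closedAt {T : SType} {σ : ℕ → SType} {k : ℕ}
    (hσ : ∀ t, (σ t).ClosedAt k) : (T.inst σ).ClosedAt k := by
  induction T generalizing k σ with
  | inp p n ℓ S T ih => exact fun i => ih i hσ
  | out p n ℓ S T ih => exact fun i => ih i hσ
  | mu T ih =>
    refine ih (k := k + 1) fun t => ?_
    cases t with
    | zero => exact Nat.succ_pos k
    | succ t =>
      simp only [up, shift_zero]
      exact closedAt_ren (hσ t) fun s hs => Nat.succ_lt_succ hs
  | var t => exact hσ t
  | done => trivial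

theorem unguarded_ren {T : SType} {ξ : ℕ → ℕ} {t : ℕ} :
    (T.ren ξ).Unguarded t ↔ ∃ s, T.Unguarded s ∧ ξ s = t := by
  induction T generalizing ξ t with
  | inp p n ℓ S T ih => simp [ren, Unguarded]
  | out p n ℓ S T ih => simp [ren, Unguarded]
  | mu T ih =>
    simp only [ren, Unguarded, ih]
    constructor
    · rintro ⟨s, hs, h⟩
      cases s with
      | zero => simp [liftRen] at h
      | succ s => exact ⟨s, hs, by simpa [liftRen] using h⟩
    · rintro ⟨s, hs, h⟩
      exact ⟨s + 1, hs, by simpa [liftRen] using h⟩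
  | var s => simp [ren, Unguarded]
  | done => simp [ren, Unguarded]

theorem unguarded_inst {T : SType} {σ : ℕ → SType} {t : ℕ} :
    (T.inst σ).Unguarded t ↔ ∃ s, T.Unguarded s ∧ (σ s).Unguarded t := by
  induction T generalizing σ t with
  | inp p n ℓ S T ih => simp [inst, Unguarded]
  | out p n ℓ S T ih => simp [inst, Unguarded]
  | mu T ih =>
    simp only [inst, Unguarded, ih]
    constructor
    · rintro ⟨s, hs, h⟩
      cases s with
      | zero => simp [up, Unguarded] at h
      | succ s =>
        simp only [up, shift_zero, unguarded_ren] at h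
        obtain ⟨r, hr, hrt⟩ := h
        exact ⟨s, hs, by rwa [← Nat.succ_injective hrt]⟩
    · rintro ⟨s, hs, h⟩
      refine ⟨s + 1, hs, ?_⟩
      simp only [up, shift_zero, unguarded_ren]
      exact ⟨t, h, rfl⟩
  | var s => simp [inst, Unguarded]
  | done => simp [inst, Unguarded]

theorem not_unguarded_inst_up {T : SType} {σ : ℕ → SType} (h : ¬ T.Unguarded 0) :
    ¬ (T.inst (up σ)).Unguarded 0 := by
  rw [unguarded_inst]
  rintro ⟨s, hs, h'⟩
  cases s with
  | zero => exact h hs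
  | succ s =>
    simp only [up, shift_zero, unguarded_ren] at h'
    obtain ⟨r, -, hr⟩ := h'
    cases hr

theorem wellFormed_ren {T : SType} {ξ : ℕ → ℕ} (h : T.WellFormed) : (T.ren ξ).WellFormed := by
  induction T generalizing ξ with
  | inp p n ℓ S T ih => exact ⟨h.1, h.2.1, fun i => ih i (h.2.2 i)⟩
  | out p n ℓ S T ih => exact ⟨h.1, h.2.1, fun i => ih i (h.2.2 i)⟩
  | mu T ih =>
    refine ⟨?_, ih h.2⟩
    rw [unguarded_ren]
    rintro ⟨s, hs, h'⟩
    cases s with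
    | zero => exact h.1 hs
    | succ s => simp [liftRen] at h'
  | var t => trivial
  | done => trivial

theorem wellFormed_inst {T : SType} {σ : ℕ → SType} (h : T.WellFormed)
    (hσ : ∀ t, (σ t).WellFormed) : (T.inst σ).WellFormed := by
  induction T generalizing σ with
  | inp p n ℓ S T ih => exact ⟨h.1, h.2.1, fun i => ih i (h.2.2 i) hσ⟩
  | out p n ℓ S T ih => exact ⟨h.1, h.2.1, fun i => ih i (h.2.2 i) hσ⟩
  | mu T ih =>
    refine ⟨not_unguarded_inst_up h.1, ih h.2 fun t => ?_⟩
    cases t with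
    | zero => trivial
    | succ t => simp only [up, shift_zero]; exact wellFormed_ren (hσ t)
  | var t => exact hσ t
  | done => trivial

theorem wellFormed_subst {T U : SType} (h : T.WellFormed) (hU : U.WellFormed) :
    (T.subst 0 U).WellFormed := by
  rw [subst_zero]
  refine wellFormed_inst h fun t => ?_
  cases t with
  | zero => exact hU
  | succ t => trivial

theorem closedAt_subst {T U : SType} {k : ℕ} (h : T.ClosedAt (k + 1)) (hU : U.ClosedAt k) :
    (T.subst 0 U).ClosedAt k := by
  rw [subst_zero]
  refine closedAt_inst h fun t ht => ?_
  cases t with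
  | zero => exact hU
  | succ t => exact Nat.lt_of_succ_lt_succ ht

theorem IsSessionType.unfold {T : SType} (h : (SType.mu T).IsSessionType) :
    (T.subst 0 (.mu T)).IsSessionType :=
  ⟨closedAt_subst h.1 h.1, wellFormed_subst h.2.2 h.2⟩

theorem isSessionType_done : SType.done.IsSessionType := ⟨trivial, trivial⟩

/-! ### Unfolding at the root -/

theorem Unfolds.mu_iff {T U : SType} :
    (SType.mu T).Unfolds U ↔ (T.subst 0 (.mu T)).Unfolds U := by
  refine ⟨fun h => ?_, .mu⟩
  cases h with
  | root h => exact absurd rfl (h T)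
  | mu h => exact h

theorem Unfolds.not_mu {T U : SType} (h : T.Unfolds U) : ∀ V, U ≠ .mu V := by
  induction h with
  | root h => exact h
  | mu _ ih => exact ih

theorem Unfolds.det {T U V : SType} (h : T.Unfolds U) (h' : T.Unfolds V) : U = V := by
  induction h with
  | root h =>
    cases h' with
    | root => rfl
    | mu => exact absurd rfl (h _)
  | mu _ ih => exact ih (Unfolds.mu_iff.1 h')

theorem unfolds_inp {p n ℓ S T} : (SType.inp p n ℓ S T).Unfolds (.inp p n ℓ S T) :=
  .root (by simp)

theorem unfolds_out {p n ℓ S T} : (SType.out p n ℓ S T).Unfolds (.out p n ℓ S T) :=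
  .root (by simp)

theorem unfolds_done : SType.done.Unfolds .done := .root (by simp)

theorem unfolds_var {t} : (SType.var t).Unfolds (.var t) := .root (by simp)

theorem Unfolds.inst_iff {T U : SType} (h : T.Unfolds U) (σ : ℕ → SType) {W : SType} :
    (T.inst σ).Unfolds W ↔ (U.inst σ).Unfolds W := by
  induction h with
  | root => rfl
  | mu _ ih => rw [← ih, unfold_inst]; exact Unfolds.mu_iff

theorem Unfolds.inst_inp {T : SType} {p n ℓ S T'} (h : T.Unfolds (.inp p n ℓ S T'))
    (σ : ℕ → SType) : (T.inst σ).Unfolds (.inp p n ℓ S (fun i => (T' i).inst σ)) :=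
  (h.inst_iff σ).2 unfolds_inp

theorem Unfolds.inst_out {T : SType} {p n ℓ S T'} (h : T.Unfolds (.out p n ℓ S T'))
    (σ : ℕ → SType) : (T.inst σ).Unfolds (.out p n ℓ S (fun i => (T' i).inst σ)) :=
  (h.inst_iff σ).2 unfolds_out

theorem Unfolds.inst_done {T : SType} (h : T.Unfolds .done)
    (σ : ℕ → SType) : (T.inst σ).Unfolds .done :=
  (h.inst_iff σ).2 unfolds_done

theorem Unfolds.wellFormed {T U : SType} (h : T.Unfolds U) (hT : T.WellFormed) :
    U.WellFormed := by
  induction h with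
  | root => exact hT
  | mu _ ih => exact ih (wellFormed_subst hT.2 hT)

theorem Unfolds.closedAt {T U : SType} {k : ℕ} (h : T.Unfolds U) (hT : T.ClosedAt k) :
    U.ClosedAt k := by
  induction h with
  | root => exact hT
  | mu _ ih => exact ih (closedAt_subst hT hT)

theorem Unfolds.isSessionType {T U : SType} (h : T.Unfolds U) (hT : T.IsSessionType) :
    U.IsSessionType := ⟨h.closedAt hT.1, h.wellFormed hT.2⟩

/-- The number of recursion binders at the root. -/
def rootBinders : SType → ℕ
  | .mu T => T.rootBinders + 1
  | _ => 0

theorem rootBinders_inst {T : SType} {σ : ℕ → SType}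
    (h : ∀ t, T.Unguarded t → ∃ s, σ t = .var s) : (T.inst σ).rootBinders = T.rootBinders := by
  induction T generalizing σ with
  | mu T ih =>
    simp only [inst, rootBinders]
    rw [ih]
    intro t ht
    cases t with
    | zero => exact ⟨0, rfl⟩
    | succ t =>
      obtain ⟨s, hs⟩ := h t ht
      exact ⟨s + 1, by simp [up, hs, shift]⟩
  | var t => obtain ⟨s, hs⟩ := h t rfl; simp [inst, hs, rootBinders]
  | _ => rfl

theorem WellFormed.exists_unfolds {T : SType} (h : T.WellFormed) : ∃ U, T.Unfolds U := by
  induction hn : T.rootBinders generalizing T with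
  | zero =>
    refine ⟨T, .root ?_⟩
    rintro T' rfl
    simp [rootBinders] at hn
  | succ n ih =>
    cases T with
    | mu T =>
      obtain ⟨U, hU⟩ := ih (T := T.subst 0 (.mu T)) (wellFormed_subst h.2 h) (by
        rw [subst_zero, rootBinders_inst]
        · simpa [rootBinders] using hn
        · intro t ht
          cases t with
          | zero => exact absurd ht h.1
          | succ t => exact ⟨t, rfl⟩)
      exact ⟨U, .mu hU⟩
    | _ => simp [rootBinders] at hn

theorem Unguarded.unfolds {T : SType} {t : ℕ} (h : T.Unguarded t) : T.Unfolds (.var t) := by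
  induction hn : T.rootBinders generalizing T with
  | zero =>
    cases T with
    | var s => cases h; exact unfolds_var
    | mu T => simp [rootBinders] at hn
    | _ => exact h.elim
  | succ n ih =>
    cases T with
    | mu T =>
      refine .mu (ih ?_ ?_)
      · rw [subst_zero, unguarded_inst]; exact ⟨t + 1, h, rfl⟩
      · rw [subst_zero, rootBinders_inst]
        · simpa [rootBinders] using hn
        · have key : ∀ (U : SType) (a b : ℕ), U.Unguarded a → U.Unguarded b → a = b := by
            intro U
            induction U with
            | mu U ih => intro a b ha hb; have := ih _ _ ha hb; omega
            | var s => intro a b ha hb; exact ha.symm.trans hb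
            | _ => intro a b ha; exact ha.elim
          intro s hs
          cases key T s (t + 1) hs h
          exact ⟨t, rfl⟩
    | _ => simp [rootBinders] at hn

theorem Unfolds.unguarded {T : SType} {t : ℕ} (h : T.Unfolds (.var t)) : T.Unguarded t := by
  generalize hU : SType.var t = U at h
  induction h with
  | root => subst hU; rfl
  | @mu T U _ ih =>
    have := ih hU
    rw [subst_zero, unguarded_inst] at this
    obtain ⟨s, hs, h⟩ := this
    cases s with
    | zero => exact h
    | succ s => cases h; exact hs

/-- A session type has a root that is an intersection, a union or `end`. -/
theorem IsSessionType.cases {T : SType} (h : T.IsSessionType) :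
    T.Unfolds .done ∨ (∃ p n ℓ S T', T.Unfolds (.inp p n ℓ S T')) ∨
      ∃ p n ℓ S T', T.Unfolds (.out p n ℓ S T') := by
  obtain ⟨U, hU⟩ := h.2.exists_unfolds
  cases U with
  | inp p n ℓ S T' => exact .inr (.inl ⟨_, _, _, _, _, hU⟩)
  | out p n ℓ S T' => exact .inr (.inr ⟨_, _, _, _, _, hU⟩)
  | mu U => exact absurd rfl (hU.not_mu U)
  | var t => exact absurd (hU.closedAt h.1) (Nat.not_lt_zero t)
  | done => exact .inl hU

theorem IsSessionType.inp {p n ℓ S T} (h : (SType.inp p n ℓ S T).IsSessionType) (i : Fin n) :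
    (T i).IsSessionType := ⟨h.1 i, h.2.2.2 i⟩

theorem IsSessionType.out {p n ℓ S T} (h : (SType.out p n ℓ S T).IsSessionType) (i : Fin n) :
    (T i).IsSessionType := ⟨h.1 i, h.2.2.2 i⟩

/-! ### Equality of trees and subtyping -/

theorem WellFormed.treeEq_refl {T : SType} (h : T.WellFormed) : TreeEq T T := by
  refine ⟨fun T U => T = U ∧ T.WellFormed, ?_, rfl, h⟩
  rintro T _ ⟨rfl, hT⟩
  obtain ⟨U, hU⟩ := hT.exists_unfolds
  have hw := hU.wellFormed hT
  cases U with
  | inp p n ℓ S T' =>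
    exact .inp _ _ _ _ _ _ _ _ _ hU hU (fun i => ⟨i, rfl, rfl, rfl, hw.2.2 i⟩)
      (fun i => ⟨i, rfl, rfl, rfl, hw.2.2 i⟩)
  | out p n ℓ S T' =>
    exact .out _ _ _ _ _ _ _ _ _ hU hU (fun i => ⟨i, rfl, rfl, rfl, hw.2.2 i⟩)
      (fun i => ⟨i, rfl, rfl, rfl, hw.2.2 i⟩)
  | mu U => exact absurd rfl (hU.not_mu U)
  | var t => exact .var _ hU hU
  | done => exact .done hU hU

theorem TreeEq.symm {T U : SType} (h : TreeEq T U) : TreeEq U T := by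
  obtain ⟨R, hR, h⟩ := h
  refine ⟨fun U T => R T U, fun U T h => ?_, h⟩
  cases hR _ _ h with
  | done h₁ h₂ => exact .done h₂ h₁
  | var t h₁ h₂ => exact .var t h₂ h₁
  | inp p n m ℓ ℓ' S S' T' U' h₁ h₂ h₃ h₄ =>
    exact .inp _ _ _ _ _ _ _ _ _ h₂ h₁
      (fun j => (h₄ j).imp fun i hi => ⟨hi.1.symm, hi.2.1.symm, hi.2.2⟩)
      (fun j => (h₃ j).imp fun i hi => ⟨hi.1.symm, hi.2.1.symm, hi.2.2⟩)
  | out p n m ℓ ℓ' S S' T' U' h₁ h₂ h₃ h₄ =>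
    exact .out _ _ _ _ _ _ _ _ _ h₂ h₁
      (fun j => (h₄ j).imp fun i hi => ⟨hi.1.symm, hi.2.1.symm, hi.2.2⟩)
      (fun j => (h₃ j).imp fun i hi => ⟨hi.1.symm, hi.2.1.symm, hi.2.2⟩)

theorem EqRule.mono {R R' : SType → SType → Prop} (hR : ∀ T U, R T U → R' T U) {T U : SType}
    (h : EqRule R T U) : EqRule R' T U := by
  cases h with
  | done h₁ h₂ => exact .done h₁ h₂
  | var t h₁ h₂ => exact .var t h₁ h₂
  | inp p n m ℓ ℓ' S S' T' U' h₁ h₂ h₃ h₄ =>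
    exact .inp _ _ _ _ _ _ _ _ _ h₁ h₂
      (fun i => (h₃ i).imp fun j hj => ⟨hj.1, hj.2.1, hR _ _ hj.2.2⟩)
      (fun i => (h₄ i).imp fun j hj => ⟨hj.1, hj.2.1, hR _ _ hj.2.2⟩)
  | out p n m ℓ ℓ' S S' T' U' h₁ h₂ h₃ h₄ =>
    exact .out _ _ _ _ _ _ _ _ _ h₁ h₂
      (fun i => (h₃ i).imp fun j hj => ⟨hj.1, hj.2.1, hR _ _ hj.2.2⟩)
      (fun i => (h₄ i).imp fun j hj => ⟨hj.1, hj.2.1, hR _ _ hj.2.2⟩)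

theorem TreeEq.rule {T U : SType} (h : TreeEq T U) : EqRule TreeEq T U := by
  obtain ⟨R, hR, h⟩ := h
  exact (hR _ _ h).mono fun T U h => ⟨R, hR, h⟩

theorem SubRule.mono {R R' : SType → SType → Prop} (hR : ∀ T U, R T U → R' T U) {T U : SType}
    (h : SubRule R T U) : SubRule R' T U := by
  cases h with
  | done h₁ h₂ => exact .done h₁ h₂
  | inp p n m ℓ ℓ' S S' T' U' h₁ h₂ h₃ =>
    exact .inp _ _ _ _ _ _ _ _ _ h₁ h₂
      (fun i => (h₃ i).imp fun j hj => ⟨hj.1, hj.2.1, hR _ _ hj.2.2⟩)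
  | out p n m ℓ ℓ' S S' T' U' h₁ h₂ h₃ =>
    exact .out _ _ _ _ _ _ _ _ _ h₁ h₂
      (fun i => (h₃ i).imp fun j hj => ⟨hj.1, hj.2.1, hR _ _ hj.2.2⟩)

theorem Subtype.rule {T U : SType} (h : SType.Subtype T U) : SubRule SType.Subtype T U := by
  obtain ⟨R, hR, h⟩ := h
  exact (hR _ _ h).mono fun T U h => ⟨R, hR, h⟩

theorem Subtype.fold {T U : SType} (h : SubRule SType.Subtype T U) : SType.Subtype T U := by
  refine ⟨fun A B => SType.Subtype A B ∨ A = T ∧ B = U, ?_, .inr ⟨rfl, rfl⟩⟩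
  rintro A B (hAB | ⟨rfl, rfl⟩)
  · exact hAB.rule.mono fun _ _ => .inl
  · exact h.mono fun _ _ => .inl

theorem Subtype.of_unfolds {T U T' : SType} (hT : ∀ W, T.Unfolds W → T'.Unfolds W)
    (h : SType.Subtype T U) : SType.Subtype T' U := by
  refine ⟨fun A B => SType.Subtype A B ∨ A = T' ∧ B = U, ?_, .inr ⟨rfl, rfl⟩⟩
  rintro A B (hAB | ⟨rfl, rfl⟩)
  · exact hAB.rule.mono fun _ _ => .inl
  · cases h.rule with
    | done h₁ h₂ => exact .done (hT _ h₁) h₂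
    | inp p n m ℓ ℓ' S S' T' U' h₁ h₂ h₃ =>
      exact .inp _ _ _ _ _ _ _ _ _ (hT _ h₁) h₂
        (fun i => (h₃ i).imp fun j hj => ⟨hj.1, hj.2.1, .inl hj.2.2⟩)
    | out p n m ℓ ℓ' S S' T' U' h₁ h₂ h₃ =>
      exact .out _ _ _ _ _ _ _ _ _ (hT _ h₁) h₂
        (fun i => (h₃ i).imp fun j hj => ⟨hj.1, hj.2.1, .inl hj.2.2⟩)

/-- Equal closed trees are subtypes of each other; only the variables have no subtyping rule. -/
theorem TreeEq.subtype {T U : SType} (h : TreeEq T U) (hT : T.ClosedAt 0) :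
    SType.Subtype T U := by
  refine ⟨fun T U => TreeEq T U ∧ T.ClosedAt 0, ?_, h, hT⟩
  rintro T U ⟨h, hT⟩
  cases h.rule with
  | done h₁ h₂ => exact .done h₁ h₂
  | var t h₁ h₂ => exact absurd (h₁.closedAt hT) (Nat.not_lt_zero t)
  | inp p n m ℓ ℓ' S S' T' U' h₁ h₂ h₃ h₄ =>
    have := h₁.closedAt hT
    refine .inp _ _ _ _ _ _ _ _ _ h₁ h₂ fun j => ?_
    obtain ⟨i, hi, hS, h⟩ := h₄ j
    exact ⟨i, hi, hS ▸ .refl _, h, this i⟩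
  | out p n m ℓ ℓ' S S' T' U' h₁ h₂ h₃ h₄ =>
    have := h₁.closedAt hT
    refine .out _ _ _ _ _ _ _ _ _ h₁ h₂ fun i => ?_
    obtain ⟨j, hi, hS, h⟩ := h₃ i
    exact ⟨j, hi, hS ▸ .refl _, h, this i⟩

theorem IsSessionType.subtype_refl {T : SType} (h : T.IsSessionType) : SType.Subtype T T :=
  h.2.treeEq_refl.subtype h.1

theorem Subtype.trans {T U V : SType} (h : SType.Subtype T U) (h' : SType.Subtype U V) :
    SType.Subtype T V := by
  refine ⟨fun T V => ∃ U, SType.Subtype T U ∧ SType.Subtype U V, ?_, U, h, h'⟩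
  rintro T V ⟨U, h, h'⟩
  cases h.rule with
  | done h₁ h₂ =>
    cases h'.rule with
    | done h₃ h₄ => exact .done h₁ h₄
    | inp _ _ _ _ _ _ _ _ _ h₃ => cases h₂.det h₃
    | out _ _ _ _ _ _ _ _ _ h₃ => cases h₂.det h₃
  | inp p n m ℓ ℓ' S S' T' U' h₁ h₂ hs =>
    cases h'.rule with
    | done h₃ h₄ => cases h₂.det h₃
    | out _ _ _ _ _ _ _ _ _ h₃ => cases h₂.det h₃
    | inp _ _ _ _ _ _ _ _ _ h₃ h₄ hs' =>
      cases h₂.det h₃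
      refine .inp _ _ _ _ _ _ _ _ _ h₁ h₄ fun k => ?_
      obtain ⟨j, hj, hS, hV⟩ := hs' k
      obtain ⟨i, hi, hS', hU⟩ := hs j
      exact ⟨i, hi.trans hj, hS.trans hS', _, hU, hV⟩
  | out p n m ℓ ℓ' S S' T' U' h₁ h₂ hs =>
    cases h'.rule with
    | done h₃ h₄ => cases h₂.det h₃
    | inp _ _ _ _ _ _ _ _ _ h₃ => cases h₂.det h₃
    | out _ _ _ _ _ _ _ _ _ h₃ h₄ hs' =>
      cases h₂.det h₃
      refine .out _ _ _ _ _ _ _ _ _ h₁ h₄ fun k => ?_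
      obtain ⟨j, hj, hS, hV⟩ := hs k
      obtain ⟨i, hi, hS', hU⟩ := hs' j
      exact ⟨i, hj.trans hi, hS.trans hS', _, hV, hU⟩

theorem IsSessionType.mu_subtype_unfold {T : SType} (h : (SType.mu T).IsSessionType) :
    SType.Subtype (.mu T) (T.subst 0 (.mu T)) :=
  h.unfold.subtype_refl.of_unfolds fun _ => .mu

/-- The subtypes of an unfolding are those of the recursion. -/
theorem IsSessionType.unfold_subtype_mu {T : SType} (h : (SType.mu T).IsSessionType) :
    SType.Subtype (T.subst 0 (.mu T)) (.mu T) :=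
  h.subtype_refl.of_unfolds fun _ => Unfolds.mu_iff.1

theorem TreeEq.inst {T U : SType} (h : TreeEq T U) {σ : ℕ → SType}
    (hσ : ∀ t, (σ t).WellFormed) : TreeEq (T.inst σ) (U.inst σ) := by
  refine ⟨fun A B => TreeEq A B ∨ ∃ T U, TreeEq T U ∧ A = T.inst σ ∧ B = U.inst σ, ?_,
    .inr ⟨T, U, h, rfl, rfl⟩⟩
  rintro A B (h | ⟨T, U, h, rfl, rfl⟩)
  · exact h.rule.mono fun _ _ => .inl
  cases h.rule with
  | done h₁ h₂ => exact .done (h₁.inst_done σ) (h₂.inst_done σ)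
  | var t h₁ h₂ =>
    have e₁ : ∀ {W}, (σ t).Unfolds W → (T.inst σ).Unfolds W := (h₁.inst_iff σ).2
    have e₂ : ∀ {W}, (σ t).Unfolds W → (U.inst σ).Unfolds W := (h₂.inst_iff σ).2
    cases (hσ t).treeEq_refl.rule with
    | done h₁ h₂ => exact .done (e₁ h₁) (e₂ h₂)
    | var t h₁ h₂ => exact .var t (e₁ h₁) (e₂ h₂)
    | inp p n m ℓ ℓ' S S' T' U' h₁ h₂ h₃ h₄ =>
      exact .inp _ _ _ _ _ _ _ _ _ (e₁ h₁) (e₂ h₂)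
        (fun i => (h₃ i).imp fun j hj => ⟨hj.1, hj.2.1, .inl hj.2.2⟩)
        (fun i => (h₄ i).imp fun j hj => ⟨hj.1, hj.2.1, .inl hj.2.2⟩)
    | out p n m ℓ ℓ' S S' T' U' h₁ h₂ h₃ h₄ =>
      exact .out _ _ _ _ _ _ _ _ _ (e₁ h₁) (e₂ h₂)
        (fun i => (h₃ i).imp fun j hj => ⟨hj.1, hj.2.1, .inl hj.2.2⟩)
        (fun i => (h₄ i).imp fun j hj => ⟨hj.1, hj.2.1, .inl hj.2.2⟩)
  | inp p n m ℓ ℓ' S S' T' U' h₁ h₂ h₃ h₄ =>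
    exact .inp _ _ _ _ _ _ _ _ _ (h₁.inst_inp σ) (h₂.inst_inp σ)
      (fun i => (h₃ i).imp fun j hj => ⟨hj.1, hj.2.1, .inr ⟨_, _, hj.2.2, rfl, rfl⟩⟩)
      (fun i => (h₄ i).imp fun j hj => ⟨hj.1, hj.2.1, .inr ⟨_, _, hj.2.2, rfl, rfl⟩⟩)
  | out p n m ℓ ℓ' S S' T' U' h₁ h₂ h₃ h₄ =>
    exact .out _ _ _ _ _ _ _ _ _ (h₁.inst_out σ) (h₂.inst_out σ)
      (fun i => (h₃ i).imp fun j hj => ⟨hj.1, hj.2.1, .inr ⟨_, _, hj.2.2, rfl, rfl⟩⟩)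
      (fun i => (h₄ i).imp fun j hj => ⟨hj.1, hj.2.1, .inr ⟨_, _, hj.2.2, rfl, rfl⟩⟩)

end SType
/-! ### Simultaneous substitution in expressions and processes -/

namespace Expr

/-- Rename the variables. -/
def ren (ξ : ℕ → ℕ) : Expr → Expr
  | .var x => .var (ξ x)
  | .val v => .val v
  | .succ e => .succ (e.ren ξ)
  | .neg e => .neg (e.ren ξ)
  | .not e => .not (e.ren ξ)
  | .choice e₁ e₂ => .choice (e₁.ren ξ) (e₂.ren ξ)
  | .gt e₁ e₂ => .gt (e₁.ren ξ) (e₂.ren ξ)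

/-- Simultaneous substitution. -/
def inst (θ : ℕ → Expr) : Expr → Expr
  | .var x => θ x
  | .val v => .val v
  | .succ e => .succ (e.inst θ)
  | .neg e => .neg (e.inst θ)
  | .not e => .not (e.inst θ)
  | .choice e₁ e₂ => .choice (e₁.inst θ) (e₂.inst θ)
  | .gt e₁ e₂ => .gt (e₁.inst θ) (e₂.inst θ)

/-- The action of a substitution below a binder. -/
def up (θ : ℕ → Expr) : ℕ → Expr
  | 0 => .var 0
  | n + 1 => (θ n).shift 0

theorem shift_eq_ren (e : Expr) (k : ℕ) :
    e.shift k = e.ren (fun t => if t < k then t else t + 1) := by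
  induction e <;> simp_all [shift, ren]

theorem shift_zero (e : Expr) : e.shift 0 = e.ren Nat.succ := by
  rw [shift_eq_ren]; rfl

theorem ren_ren (e : Expr) (ξ ζ : ℕ → ℕ) : (e.ren ξ).ren ζ = e.ren (ζ ∘ ξ) := by
  induction e <;> simp_all [ren]

theorem inst_ren (e : Expr) (ξ : ℕ → ℕ) (θ : ℕ → Expr) : (e.ren ξ).inst θ = e.inst (θ ∘ ξ) := by
  induction e <;> simp_all [ren, inst]

theorem ren_inst (e : Expr) (θ : ℕ → Expr) (ξ : ℕ → ℕ) :
    (e.inst θ).ren ξ = e.inst (fun x => (θ x).ren ξ) := by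
  induction e <;> simp_all [ren, inst]

theorem inst_inst (e : Expr) (θ θ' : ℕ → Expr) :
    (e.inst θ).inst θ' = e.inst (fun x => (θ x).inst θ') := by
  induction e <;> simp_all [inst]

theorem inst_var (e : Expr) : e.inst Expr.var = e := by
  induction e <;> simp_all [inst]

theorem ren_eq_inst (e : Expr) (ξ : ℕ → ℕ) : e.ren ξ = e.inst (fun x => .var (ξ x)) := by
  induction e <;> simp_all [ren, inst]

theorem subst_eq_inst (e : Expr) (k : ℕ) (v : Value) :
    e.subst k v =
      e.inst (fun x => if x < k then .var x else if x = k then .val v else .var (x - 1)) := by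
  induction e <;> simp_all [subst, inst]

theorem up_var : up Expr.var = Expr.var := by
  funext n; cases n <;> simp [up, shift]

theorem up_comp_liftRen (θ : ℕ → Expr) (ξ : ℕ → ℕ) : up θ ∘ liftRen ξ = up (θ ∘ ξ) := by
  funext n; cases n <;> rfl

theorem up_ren (θ : ℕ → Expr) (ξ : ℕ → ℕ) :
    (fun x => (up θ x).ren (liftRen ξ)) = up (fun x => (θ x).ren ξ) := by
  funext n
  cases n with
  | zero => rfl
  | succ n => simp only [up, shift_zero, ren_ren]; rfl

theorem up_inst (θ θ' : ℕ → Expr) :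
    (fun x => (up θ x).inst (up θ')) = up (fun x => (θ x).inst θ') := by
  funext n
  cases n with
  | zero => rfl
  | succ n =>
    simp only [up, shift_zero, inst_ren, ren_inst]
    congr 1; funext m; exact shift_zero _

theorem up_var_ren (ξ : ℕ → ℕ) : (fun x => Expr.var (liftRen ξ x)) = up (fun x => .var (ξ x)) := by
  funext n; cases n <;> simp [up, shift, liftRen]

end Expr

namespace Proc

/-- Rename the expression variables by `ξ` and the process variables by `ζ`. -/
def ren : Proc → (ℕ → ℕ) → (ℕ → ℕ) → Proc
  | .inp p ℓ P, ξ, ζ => .inp p ℓ (P.ren (liftRen ξ) ζ)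
  | .out p ℓ e P, ξ, ζ => .out p ℓ (e.ren ξ) (P.ren ξ ζ)
  | .sum P Q, ξ, ζ => .sum (P.ren ξ ζ) (Q.ren ξ ζ)
  | .ite e P Q, ξ, ζ => .ite (e.ren ξ) (P.ren ξ ζ) (Q.ren ξ ζ)
  | .mu P, ξ, ζ => .mu (P.ren ξ (liftRen ζ))
  | .var X, _, ζ => .var (ζ X)
  | .nil, _, _ => .nil

/-- The action of a process substitution below a recursion. -/
def up (σ : ℕ → Proc) : ℕ → Proc
  | 0 => .var 0
  | n + 1 => (σ n).shiftProc 0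

/-- Simultaneous capture-avoiding substitution of the expression variables by `θ` and of the
process variables by `σ`. -/
def inst : Proc → (ℕ → Expr) → (ℕ → Proc) → Proc
  | .inp p ℓ P, θ, σ => .inp p ℓ (P.inst (Expr.up θ) (fun X => (σ X).shiftExpr 0))
  | .out p ℓ e P, θ, σ => .out p ℓ (e.inst θ) (P.inst θ σ)
  | .sum P Q, θ, σ => .sum (P.inst θ σ) (Q.inst θ σ)
  | .ite e P Q, θ, σ => .ite (e.inst θ) (P.inst θ σ) (Q.inst θ σ)
  | .mu P, θ, σ => .mu (P.inst θ (up σ))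
  | .var X, _, σ => σ X
  | .nil, _, _ => .nil

theorem _root_.MPST.Expr.ren_id (e : Expr) : e.ren id = e := by
  induction e <;> simp_all [Expr.ren]

theorem shiftExpr_eq_ren (P : Proc) (k : ℕ) :
    P.shiftExpr k = P.ren (fun t => if t < k then t else t + 1) id := by
  induction P generalizing k <;> simp_all [shiftExpr, ren, Expr.shift_eq_ren, liftRen_shift,
    liftRen_id]

theorem shiftProc_eq_ren (P : Proc) (k : ℕ) :
    P.shiftProc k = P.ren id (fun t => if t < k then t else t + 1) := by
  induction P generalizing k <;> simp_all [shiftProc, ren, liftRen_shift, liftRen_id, Expr.ren_id]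

theorem shiftExpr_zero (P : Proc) : P.shiftExpr 0 = P.ren Nat.succ id := by
  rw [shiftExpr_eq_ren]; rfl

theorem shiftProc_zero (P : Proc) : P.shiftProc 0 = P.ren id Nat.succ := by
  rw [shiftProc_eq_ren]; rfl

theorem ren_ren (P : Proc) (ξ ζ ξ' ζ' : ℕ → ℕ) :
    (P.ren ξ ζ).ren ξ' ζ' = P.ren (ξ' ∘ ξ) (ζ' ∘ ζ) := by
  induction P generalizing ξ ζ ξ' ζ' <;> simp_all [ren, Expr.ren_ren, liftRen_comp]

theorem inst_ren (P : Proc) (ξ ζ : ℕ → ℕ) (θ : ℕ → Expr) (σ : ℕ → Proc) :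
    (P.ren ξ ζ).inst θ σ = P.inst (θ ∘ ξ) (σ ∘ ζ) := by
  induction P generalizing ξ ζ θ σ with
  | mu P ih =>
    have : up σ ∘ liftRen ζ = up (σ ∘ ζ) := by funext n; cases n <;> rfl
    simp only [ren, inst, ih, this]
  | inp p ℓ P ih => simp only [ren, inst, ih, Expr.up_comp_liftRen]; rfl
  | _ => simp_all [ren, inst, Expr.inst_ren]

theorem ren_inst (P : Proc) (θ : ℕ → Expr) (σ : ℕ → Proc) (ξ ζ : ℕ → ℕ) :
    (P.inst θ σ).ren ξ ζ = P.inst (fun x => (θ x).ren ξ) (fun X => (σ X).ren ξ ζ) := by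
  induction P generalizing ξ ζ θ σ with
  | mu P ih =>
    have : (fun X => (up σ X).ren ξ (liftRen ζ)) = up (fun X => (σ X).ren ξ ζ) := by
      funext n
      cases n with
      | zero => rfl
      | succ n => simp only [up, shiftProc_zero, ren_ren]; rfl
    simp only [ren, inst, ih, this]
  | inp p ℓ P ih =>
    simp only [ren, inst, ih, Expr.up_ren, shiftExpr_zero, ren_ren]; rfl
  | _ => simp_all [ren, inst, Expr.ren_inst]

theorem inst_inst (P : Proc) (θ : ℕ → Expr) (σ : ℕ → Proc) (θ' : ℕ → Expr) (σ' : ℕ → Proc) :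
    (P.inst θ σ).inst θ' σ' = P.inst (fun x => (θ x).inst θ') (fun X => (σ X).inst θ' σ') := by
  induction P generalizing θ σ θ' σ' with
  | mu P ih =>
    have : (fun X => (up σ X).inst θ' (up σ')) = up (fun X => (σ X).inst θ' σ') := by
      funext n
      cases n with
      | zero => rfl
      | succ n =>
        simp only [up, shiftProc_zero, inst_ren, ren_inst, Expr.ren_id]
        congr 1; funext m; exact shiftProc_zero _
    simp only [inst, ih, this]
  | inp p ℓ P ih =>
    simp only [inst, ih, Expr.up_inst, shiftExpr_zero, inst_ren, ren_inst]
    congr 2; funext X; congr 1; funext m; exact Expr.shift_zero _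
  | _ => simp_all [inst, Expr.inst_inst]

theorem up_var : up Proc.var = Proc.var := by
  funext n; cases n <;> simp [up, shiftProc]

theorem inst_var (P : Proc) : P.inst Expr.var Proc.var = P := by
  induction P <;> simp_all [inst, up_var, Expr.up_var, Expr.inst_var, shiftExpr]

theorem ren_eq_inst (P : Proc) (ξ ζ : ℕ → ℕ) :
    P.ren ξ ζ = P.inst (fun x => .var (ξ x)) (fun X => .var (ζ X)) := by
  induction P generalizing ξ ζ with
  | mu P ih =>
    simp only [ren, inst, ih]; congr 2; funext n
    cases n <;> simp [up, shiftProc, liftRen]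
  | inp p ℓ P ih => simp only [ren, inst, ih, shiftExpr, Expr.up_var_ren]
  | _ => simp_all [ren, inst, Expr.ren_eq_inst]

theorem substVal_eq_inst (P : Proc) (k : ℕ) (v : Value) :
    P.substVal k v = P.inst
      (fun x => if x < k then .var x else if x = k then .val v else .var (x - 1)) Proc.var := by
  induction P generalizing k with
  | mu P ih => simp only [substVal, inst, ih, up_var]
  | inp p ℓ P ih =>
    simp only [substVal, inst, ih, shiftExpr]
    congr 2
    funext n
    cases n with
    | zero => simp [Expr.up]
    | succ n =>
      simp only [Expr.up, Nat.add_lt_add_iff_right, Nat.add_right_cancel_iff, Nat.add_sub_cancel]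
      split_ifs with h₁ h₂
      · simp [Expr.shift]
      · rfl
      · simp only [Expr.shift, Nat.not_lt_zero, if_false]; congr 1; omega
  | _ => simp_all [substVal, inst, Expr.subst_eq_inst]

theorem substProc_eq_inst (P : Proc) (k : ℕ) (R : Proc) :
    P.substProc k R = P.inst Expr.var
      (fun X => if X < k then .var X else if X = k then R else .var (X - 1)) := by
  induction P generalizing k R with
  | mu P ih =>
    simp only [substProc, inst, ih]
    congr 2
    funext n
    cases n with
    | zero => simp [up]
    | succ n =>
      simp only [up, Nat.add_lt_add_iff_right, Nat.add_right_cancel_iff, Nat.add_sub_cancel]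
      split_ifs with h₁ h₂
      · simp [shiftProc]
      · rfl
      · simp only [shiftProc, Nat.not_lt_zero, if_false]; congr 1; omega
  | inp p ℓ P ih =>
    simp only [substProc, inst, ih, Expr.up_var]
    congr 2; funext n; split_ifs <;> rfl
  | _ => simp_all [substProc, inst, Expr.inst_var]

theorem substVal_zero (P : Proc) (v : Value) :
    P.substVal 0 v = P.inst (scons (.val v) Expr.var) Proc.var := by
  rw [substVal_eq_inst]
  congr 1; funext n; cases n <;> simp [scons]

theorem substProc_zero (P R : Proc) :
    P.substProc 0 R = P.inst Expr.var (scons R Proc.var) := by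
  rw [substProc_eq_inst]
  congr 1; funext n; cases n <;> simp [scons]

theorem inst_up_substProc (P R : Proc) (θ : ℕ → Expr) (σ : ℕ → Proc) :
    (P.inst θ (up σ)).substProc 0 R = P.inst θ (scons R σ) := by
  rw [substProc_zero, inst_inst]
  congr 1
  · funext n; exact Expr.inst_var _
  · funext n
    cases n with
    | zero => rfl
    | succ n => simp only [up, shiftProc_zero, inst_ren]; exact inst_var _

theorem unfold_inst (P : Proc) (θ : ℕ → Expr) (σ : ℕ → Proc) :
    (P.substProc 0 (.mu P)).inst θ σ =
      (P.inst θ (up σ)).substProc 0 (.mu (P.inst θ (up σ))) := by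
  rw [inst_up_substProc, substProc_zero, inst_inst]
  congr 1
  funext n; cases n <;> rfl

theorem inst_up_substVal (P : Proc) (v : Value) (θ : ℕ → Expr) (σ : ℕ → Proc) :
    (P.inst (Expr.up θ) (fun X => (σ X).shiftExpr 0)).substVal 0 v =
      P.inst (scons (.val v) θ) σ := by
  rw [substVal_zero, inst_inst]
  congr 1
  · funext n
    cases n with
    | zero => rfl
    | succ n => simp only [Expr.up, Expr.shift_zero, Expr.inst_ren]; exact Expr.inst_var _
  · funext n
    simp only [shiftExpr_zero, inst_ren]; exact inst_var _

/-! ### Structural congruence under substitution -/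

theorem Cong.mono {B B' : Proc → Proc → Prop} (hB : ∀ P Q, B P Q → B' P Q) {P Q : Proc}
    (h : Cong B P Q) : Cong B' P Q := by
  induction h with
  | base h => exact .base (hB _ _ h)
  | refl => exact .refl _
  | symm _ ih => exact .symm ih
  | trans _ _ ih₁ ih₂ => exact .trans ih₁ ih₂
  | inp _ _ _ ih => exact .inp _ _ ih
  | out _ _ _ _ ih => exact .out _ _ _ ih
  | sum _ _ ih₁ ih₂ => exact .sum ih₁ ih₂
  | ite _ _ _ ih₁ ih₂ => exact .ite _ ih₁ ih₂
  | mu _ ih => exact .mu ih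

theorem UnfoldEq.structEq {P Q : Proc} (h : UnfoldEq P Q) : StructEq P Q :=
  h.mono fun _ _ h => by cases h; exact .unfold _

theorem StructEq.unfold (P : Proc) : StructEq (.mu P) (P.substProc 0 (.mu P)) :=
  .base (.unfold P)

theorem StructEq.inst {P Q : Proc} (h : StructEq P Q) (θ : ℕ → Expr) (σ : ℕ → Proc) :
    StructEq (P.inst θ σ) (Q.inst θ σ) := by
  induction h generalizing θ σ with
  | base h =>
    cases h with
    | unfold P => rw [unfold_inst]; exact .unfold _
    | comm => exact .base (.comm _ _)
    | assoc => exact .base (.assoc _ _ _)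
  | refl => exact .refl _
  | symm _ ih => exact (ih θ σ).symm
  | trans _ _ ih₁ ih₂ => exact (ih₁ θ σ).trans (ih₂ θ σ)
  | inp _ _ _ ih => exact .inp _ _ (ih _ _)
  | out _ _ _ _ ih => exact .out _ _ _ (ih _ _)
  | sum _ _ ih₁ ih₂ => exact .sum (ih₁ _ _) (ih₂ _ _)
  | ite _ _ _ ih₁ ih₂ => exact .ite _ (ih₁ _ _) (ih₂ _ _)
  | mu _ ih => exact .mu (ih _ _)

theorem StructEq.inst_right (P : Proc) (θ : ℕ → Expr) {σ τ : ℕ → Proc}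
    (h : ∀ X, StructEq (σ X) (τ X)) : StructEq (P.inst θ σ) (P.inst θ τ) := by
  induction P generalizing θ σ τ with
  | inp p ℓ P ih =>
    refine .inp _ _ (ih _ fun X => ?_)
    simp only [shiftExpr_zero, ren_eq_inst]
    exact (h X).inst _ _
  | out p ℓ e P ih => exact .out _ _ _ (ih _ h)
  | sum P Q ih₁ ih₂ => exact .sum (ih₁ _ h) (ih₂ _ h)
  | ite e P Q ih₁ ih₂ => exact .ite _ (ih₁ _ h) (ih₂ _ h)
  | mu P ih =>
    refine .mu (ih _ fun X => ?_)
    cases X with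
    | zero => exact .refl _
    | succ X =>
      simp only [up, shiftProc_zero, ren_eq_inst]
      exact (h X).inst _ _
  | var X => exact h X
  | nil => exact .refl _

theorem StructEq.substVal {P Q : Proc} (h : StructEq P Q) (v : Value) :
    StructEq (P.substVal 0 v) (Q.substVal 0 v) := by
  rw [substVal_zero, substVal_zero]; exact h.inst _ _

/-! ### The summands at the head of a process -/

/-- The process is neither a sum nor a recursion. -/
def IsHead : Proc → Prop
  | .sum _ _ => False
  | .mu _ => False
  | _ => True

/-- `HeadIn n P a`: with at most `n` nested unfoldings of the recursions at its root, `P` becomes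
a sum of the processes in `a`, none of which is itself a sum or a recursion. -/
inductive HeadIn : ℕ → Proc → Multiset Proc → Prop where
  | head {n : ℕ} {P : Proc} : P.IsHead → HeadIn n P {P}
  | sum {n : ℕ} {P Q : Proc} {a b : Multiset Proc} : HeadIn n P a → HeadIn n Q b →
      HeadIn n (.sum P Q) (a + b)
  | mu {n : ℕ} {P : Proc} {a : Multiset Proc} : HeadIn n (P.substProc 0 (.mu P)) a →
      HeadIn (n + 1) (.mu P) a

/-- The multiset of the summands of a process, up to unfolding of recursions. There is none
for a process such as `μX.(X + P)`. -/
def Head (P : Proc) (a : Multiset Proc) : Prop := ∃ n, HeadIn n P a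

theorem HeadIn.mono {n m : ℕ} {P : Proc} {a : Multiset Proc} (h : HeadIn n P a) (hnm : n ≤ m) :
    HeadIn m P a := by
  induction h generalizing m with
  | head h => exact .head h
  | sum _ _ ih₁ ih₂ => exact .sum (ih₁ hnm) (ih₂ hnm)
  | mu _ ih =>
    obtain ⟨m, rfl⟩ : ∃ k, m = k + 1 := ⟨m - 1, by omega⟩
    exact .mu (ih (by omega))

theorem HeadIn.det {n m : ℕ} {P : Proc} {a b : Multiset Proc} (h : HeadIn n P a)
    (h' : HeadIn m P b) : a = b := by
  induction h generalizing m b with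
  | head h => cases h' <;> first | rfl | exact h.elim
  | sum _ _ ih₁ ih₂ =>
    cases h' with
    | head h => exact h.elim
    | sum h₁ h₂ => rw [ih₁ h₁, ih₂ h₂]
  | mu _ ih =>
    cases h' with
    | head h => exact h.elim
    | mu h => exact ih h

theorem HeadIn.card_pos {n : ℕ} {P : Proc} {a : Multiset Proc} (h : HeadIn n P a) :
    0 < a.card := by
  induction h with
  | head => simp
  | sum _ _ ih₁ => rw [Multiset.card_add]; omega
  | mu _ ih => exact ih

theorem Head.det {P : Proc} {a b : Multiset Proc} (h : Head P a) (h' : Head P b) : a = b :=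
  h.choose_spec.det h'.choose_spec

theorem Head.of_isHead {P : Proc} (h : P.IsHead) : Head P {P} := ⟨0, .head h⟩

theorem Head.nil : Head .nil {.nil} := .of_isHead trivial
theorem Head.var {X : ℕ} : Head (.var X) {.var X} := .of_isHead trivial
theorem Head.inp {p ℓ P} : Head (.inp p ℓ P) {.inp p ℓ P} := .of_isHead trivial
theorem Head.out {p ℓ e P} : Head (.out p ℓ e P) {.out p ℓ e P} := .of_isHead trivial
theorem Head.ite {e P Q} : Head (.ite e P Q) {.ite e P Q} := .of_isHead trivial

theorem Head.sum {P Q : Proc} {a b : Multiset Proc} (h : Head P a) (h' : Head Q b) :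
    Head (.sum P Q) (a + b) := by
  obtain ⟨n, h⟩ := h
  obtain ⟨m, h'⟩ := h'
  exact ⟨max n m, .sum (h.mono (le_max_left _ _)) (h'.mono (le_max_right _ _))⟩

theorem head_sum_iff {P Q : Proc} {c : Multiset Proc} :
    Head (.sum P Q) c ↔ ∃ a b, Head P a ∧ Head Q b ∧ c = a + b := by
  constructor
  · rintro ⟨n, h⟩
    cases h with
    | head h => exact h.elim
    | sum h₁ h₂ => exact ⟨_, _, ⟨_, h₁⟩, ⟨_, h₂⟩, rfl⟩
  · rintro ⟨a, b, h₁, h₂, rfl⟩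
    exact h₁.sum h₂

theorem head_mu_iff {P : Proc} {a : Multiset Proc} :
    Head (.mu P) a ↔ Head (P.substProc 0 (.mu P)) a := by
  constructor
  · rintro ⟨n, h⟩
    cases h with
    | head h => exact h.elim
    | mu h => exact ⟨_, h⟩
  · rintro ⟨n, h⟩
    exact ⟨_, .mu h⟩

theorem Head.isHead {P : Proc} {a : Multiset Proc} (h : Head P a) : ∀ H ∈ a, H.IsHead := by
  obtain ⟨n, h⟩ := h
  induction h with
  | head h => intro H hH; rw [Multiset.mem_singleton] at hH; exact hH ▸ h
  | sum _ _ ih₁ ih₂ =>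
    intro H hH
    rcases Multiset.mem_add.1 hH with hH | hH
    · exact ih₁ H hH
    · exact ih₂ H hH
  | mu _ ih => exact ih

/-- Substitution acts on the summands, provided that it does not put a sum or a recursion at
the head. -/
theorem Head.inst {P : Proc} {a : Multiset Proc} (h : Head P a) (θ : ℕ → Expr) {σ : ℕ → Proc}
    (hσ : ∀ X, Proc.var X ∈ a → (σ X).IsHead) :
    Head (P.inst θ σ) (a.map fun H => H.inst θ σ) := by
  obtain ⟨n, h⟩ := h
  induction h with
  | @head _ P h =>
    refine .of_isHead ?_
    cases P with
    | var X => exact hσ X (by simp)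
    | sum => exact h.elim
    | mu => exact h.elim
    | _ => trivial
  | sum _ _ ih₁ ih₂ =>
    rw [Multiset.map_add]
    exact .sum (ih₁ fun X hX => hσ X (Multiset.mem_add.2 (.inl hX)))
      (ih₂ fun X hX => hσ X (Multiset.mem_add.2 (.inr hX)))
  | mu _ ih => exact head_mu_iff.2 (unfold_inst _ _ _ ▸ ih hσ)

/-- The summands of `P.inst θ σ` come from summands of `P`; the substituted processes that occur
at the head have summands at no greater depth. -/
theorem HeadIn.of_inst {n : ℕ} {P : Proc} {θ : ℕ → Expr} {σ : ℕ → Proc} {a : Multiset Proc}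
    (h : HeadIn n (P.inst θ σ) a) :
    ∃ a₀, Head P a₀ ∧ ∀ X, Proc.var X ∈ a₀ → ∃ b, HeadIn n (σ X) b := by
  induction n generalizing P a with
  | zero =>
    induction P generalizing a with
    | sum P Q ih₁ ih₂ =>
      cases h with
      | head h => exact h.elim
      | sum h₁ h₂ =>
        obtain ⟨a₁, h₁, h₁'⟩ := ih₁ h₁
        obtain ⟨a₂, h₂, h₂'⟩ := ih₂ h₂
        exact ⟨a₁ + a₂, h₁.sum h₂, fun X hX => (Multiset.mem_add.1 hX).elim (h₁' X) (h₂' X)⟩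
    | mu P => cases h with | head h => exact h.elim
    | var X =>
      refine ⟨_, .of_isHead trivial, fun Y hY => ?_⟩
      cases Multiset.mem_singleton.1 hY
      exact ⟨_, h⟩
    | _ => exact ⟨_, .of_isHead trivial, fun Y hY => by cases Multiset.mem_singleton.1 hY⟩
  | succ n ih =>
    induction P generalizing a with
    | sum P Q ih₁ ih₂ =>
      cases h with
      | head h => exact h.elim
      | sum h₁ h₂ =>
        obtain ⟨a₁, h₁, h₁'⟩ := ih₁ h₁
        obtain ⟨a₂, h₂, h₂'⟩ := ih₂ h₂
        exact ⟨a₁ + a₂, h₁.sum h₂, fun X hX => (Multiset.mem_add.1 hX).elim (h₁' X) (h₂' X)⟩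
    | mu P =>
      cases h with
      | head h => exact h.elim
      | mu h =>
        obtain ⟨a₀, h₀, h₀'⟩ := ih (P := P.substProc 0 (.mu P)) (unfold_inst _ _ _ ▸ h)
        exact ⟨a₀, head_mu_iff.2 h₀, fun X hX => (h₀' X hX).imp fun b hb =>
          hb.mono (Nat.le_succ n)⟩
    | var X =>
      refine ⟨_, .of_isHead trivial, fun Y hY => ?_⟩
      cases Multiset.mem_singleton.1 hY
      exact ⟨_, h⟩
    | _ => exact ⟨_, .of_isHead trivial, fun Y hY => by cases Multiset.mem_singleton.1 hY⟩

/-- The substitution that unfolds the recursion `μX.P`. -/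
abbrev unfoldSubst (P : Proc) : ℕ → Proc := scons (.mu P) Proc.var

theorem isHead_unfoldSubst {P : Proc} {a : Multiset Proc} (h : Proc.var 0 ∉ a) (X : ℕ)
    (hX : Proc.var X ∈ a) : (unfoldSubst P X).IsHead := by
  cases X with
  | zero => exact (h hX).elim
  | succ X => trivial

/-- A recursion with summands does not have its own variable at the head of its body, as
unfolding would never end there. -/
theorem Head.body_of_mu {P : Proc} {a : Multiset Proc} (h : Head (.mu P) a) :
    ∃ a₀, Head P a₀ ∧ Proc.var 0 ∉ a₀ ∧
      a = a₀.map fun H => H.inst Expr.var (unfoldSubst P) := by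
  have key : ∀ n a, HeadIn n (.mu P) a → ∃ a₀, Head P a₀ ∧ Proc.var 0 ∉ a₀ := by
    intro n
    induction n with
    | zero => intro a h; cases h with | head h => exact h.elim
    | succ n ih =>
      intro a h
      cases h with
      | head h => exact h.elim
      | mu h =>
        rw [substProc_zero] at h
        obtain ⟨a₀, h₀, h₀'⟩ := h.of_inst
        refine ⟨a₀, h₀, fun h0 => ?_⟩
        obtain ⟨b, hb⟩ := h₀' 0 h0
        obtain ⟨a₁, h₁, h₁'⟩ := ih b hb
        exact h₁' (h₁.det h₀ ▸ h0)
  obtain ⟨n, hn⟩ := h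
  obtain ⟨a₀, h₀, h₀'⟩ := key n a hn
  refine ⟨a₀, h₀, h₀', ?_⟩
  have h' := h₀.inst Expr.var (isHead_unfoldSubst (P := P) h₀')
  rw [← substProc_zero, ← head_mu_iff] at h'
  exact Head.det ⟨n, hn⟩ h'

/-- Two summands have the same shape and congruent continuations. -/
inductive HeadEq : Proc → Proc → Prop where
  | inp (p : Participant) (ℓ : Label) {P P' : Proc} : StructEq P P' →
      HeadEq (.inp p ℓ P) (.inp p ℓ P')
  | out (p : Participant) (ℓ : Label) (e : Expr) {P P' : Proc} : StructEq P P' →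
      HeadEq (.out p ℓ e P) (.out p ℓ e P')
  | ite (e : Expr) {P P' Q Q' : Proc} : StructEq P P' → StructEq Q Q' →
      HeadEq (.ite e P Q) (.ite e P' Q')
  | var (X : ℕ) : HeadEq (.var X) (.var X)
  | nil : HeadEq .nil .nil

theorem HeadEq.refl {P : Proc} (h : P.IsHead) : HeadEq P P := by
  cases P with
  | sum => exact h.elim
  | mu => exact h.elim
  | inp => exact .inp _ _ (.refl _)
  | out => exact .out _ _ _ (.refl _)
  | ite => exact .ite _ (.refl _) (.refl _)
  | var => exact .var _
  | nil => exact .nil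

theorem HeadEq.symm {P Q : Proc} (h : HeadEq P Q) : HeadEq Q P := by
  cases h with
  | inp _ _ h => exact .inp _ _ (.symm h)
  | out _ _ _ h => exact .out _ _ _ (.symm h)
  | ite _ h h' => exact .ite _ (.symm h) (.symm h')
  | var => exact .var _
  | nil => exact .nil

theorem HeadEq.trans {P Q R : Proc} (h : HeadEq P Q) (h' : HeadEq Q R) : HeadEq P R := by
  cases h with
  | inp _ _ h => cases h' with | inp _ _ h' => exact .inp _ _ (.trans h h')
  | out _ _ _ h => cases h' with | out _ _ _ h' => exact .out _ _ _ (.trans h h')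
  | ite _ h₁ h₂ => cases h' with | ite _ h₁' h₂' => exact .ite _ (.trans h₁ h₁') (.trans h₂ h₂')
  | var => exact h'
  | nil => exact h'

theorem HeadEq.inst {P P' H H' : Proc} (hP : StructEq P P') (h : HeadEq H H')
    (h0 : H ≠ .var 0) :
    HeadEq (H.inst Expr.var (unfoldSubst P)) (H'.inst Expr.var (unfoldSubst P')) := by
  have hσ : ∀ X, StructEq (unfoldSubst P X) (unfoldSubst P' X) := by
    intro X
    cases X with
    | zero => exact .mu hP
    | succ X => exact .refl _
  cases h with
  | inp _ _ h =>
    refine .inp _ _ ((h.inst _ _).trans (StructEq.inst_right _ _ fun X => ?_))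
    simp only [shiftExpr_zero, ren_eq_inst]
    exact (hσ X).inst _ _
  | out _ _ _ h => exact .out _ _ _ ((h.inst _ _).trans (StructEq.inst_right _ _ hσ))
  | ite _ h h' =>
    exact .ite _ ((h.inst _ _).trans (StructEq.inst_right _ _ hσ))
      ((h'.inst _ _).trans (StructEq.inst_right _ _ hσ))
  | var X =>
    cases X with
    | zero => exact (h0 rfl).elim
    | succ X => exact .var X
  | nil => exact .nil

theorem rel_headEq_refl {P : Proc} {a : Multiset Proc} (h : Head P a) :
    Multiset.Rel HeadEq a a :=
  Multiset.rel_refl_of_refl_on fun H hH => HeadEq.refl (h.isHead H hH)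

theorem rel_headEq_symm {a b : Multiset Proc} (h : Multiset.Rel HeadEq a b) :
    Multiset.Rel HeadEq b a := by
  rw [← Multiset.rel_flip]
  exact h.mono fun _ _ _ _ h => h.symm

theorem rel_headEq_trans {a b c : Multiset Proc} (h : Multiset.Rel HeadEq a b)
    (h' : Multiset.Rel HeadEq b c) : Multiset.Rel HeadEq a c :=
  haveI : IsTrans Proc HeadEq := ⟨fun _ _ _ => HeadEq.trans⟩
  Multiset.Rel.trans _ h h'

/-- Structurally congruent processes have the same summands up to congruence of the
continuations. -/
theorem StructEq.head {P Q : Proc} (h : StructEq P Q) {a : Multiset Proc} (ha : Head P a) :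
    ∃ b, Head Q b ∧ Multiset.Rel HeadEq a b := by
  suffices key : (∀ a, Head P a → ∃ b, Head Q b ∧ Multiset.Rel HeadEq a b) ∧
      ∀ b, Head Q b → ∃ a, Head P a ∧ Multiset.Rel HeadEq b a from key.1 a ha
  have single : ∀ {P Q : Proc}, P.IsHead → Q.IsHead → HeadEq P Q → ∀ a, Head P a →
      ∃ b, Head Q b ∧ Multiset.Rel HeadEq a b := by
    intro P Q hP hQ h a ha
    refine ⟨_, .of_isHead hQ, ?_⟩
    rw [ha.det (.of_isHead hP)]
    exact Multiset.Rel.cons h .zero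
  clear ha a
  induction h with
  | base h =>
    cases h with
    | unfold P =>
      exact ⟨fun a ha => ⟨a, head_mu_iff.1 ha, rel_headEq_refl ha⟩,
        fun a ha => ⟨a, head_mu_iff.2 ha, rel_headEq_refl ha⟩⟩
    | comm P Q =>
      have : ∀ P Q : Proc, ∀ a, Head (.sum P Q) a →
          ∃ b, Head (.sum Q P) b ∧ Multiset.Rel HeadEq a b := by
        intro P Q a ha
        refine ⟨a, ?_, rel_headEq_refl ha⟩
        obtain ⟨b, c, hb, hc, rfl⟩ := head_sum_iff.1 ha
        exact add_comm b c ▸ hc.sum hb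
      exact ⟨this _ _, this _ _⟩
    | assoc P Q R =>
      constructor
      · intro a ha
        refine ⟨a, ?_, rel_headEq_refl ha⟩
        obtain ⟨b, c, hb, hc, rfl⟩ := head_sum_iff.1 ha
        obtain ⟨d, e, hd, he, rfl⟩ := head_sum_iff.1 hb
        exact (add_assoc d e c).symm ▸ hd.sum (he.sum hc)
      · intro a ha
        refine ⟨a, ?_, rel_headEq_refl ha⟩
        obtain ⟨b, c, hb, hc, rfl⟩ := head_sum_iff.1 ha
        obtain ⟨d, e, hd, he, rfl⟩ := head_sum_iff.1 hc
        exact add_assoc b d e ▸ (hb.sum hd).sum he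
  | refl P =>
    exact ⟨fun a ha => ⟨a, ha, rel_headEq_refl ha⟩, fun a ha => ⟨a, ha, rel_headEq_refl ha⟩⟩
  | symm _ ih => exact ih.symm
  | trans _ _ ih₁ ih₂ =>
    constructor
    · intro a ha
      obtain ⟨b, hb, hab⟩ := ih₁.1 a ha
      obtain ⟨c, hc, hbc⟩ := ih₂.1 b hb
      exact ⟨c, hc, rel_headEq_trans hab hbc⟩
    · intro a ha
      obtain ⟨b, hb, hab⟩ := ih₂.2 a ha
      obtain ⟨c, hc, hbc⟩ := ih₁.2 b hb
      exact ⟨c, hc, rel_headEq_trans hab hbc⟩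
  | inp p ℓ h =>
    exact ⟨single trivial trivial (.inp p ℓ h), single trivial trivial (.inp p ℓ (.symm h))⟩
  | out p ℓ e h =>
    exact ⟨single trivial trivial (.out p ℓ e h), single trivial trivial (.out p ℓ e (.symm h))⟩
  | ite e h h' =>
    exact ⟨single trivial trivial (.ite e h h'),
      single trivial trivial (.ite e (.symm h) (.symm h'))⟩
  | sum _ _ ih₁ ih₂ =>
    constructor
    · intro a ha
      obtain ⟨b, c, hb, hc, rfl⟩ := head_sum_iff.1 ha
      obtain ⟨b', hb', hbb⟩ := ih₁.1 b hb
      obtain ⟨c', hc', hcc⟩ := ih₂.1 c hc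
      exact ⟨_, hb'.sum hc', hbb.add hcc⟩
    · intro a ha
      obtain ⟨b, c, hb, hc, rfl⟩ := head_sum_iff.1 ha
      obtain ⟨b', hb', hbb⟩ := ih₁.2 b hb
      obtain ⟨c', hc', hcc⟩ := ih₂.2 c hc
      exact ⟨_, hb'.sum hc', hbb.add hcc⟩
  | mu h ih =>
    have aux : ∀ {P P' : Proc}, StructEq P P' →
        (∀ a, Head P a → ∃ b, Head P' b ∧ Multiset.Rel HeadEq a b) →
        ∀ a, Head (.mu P) a → ∃ b, Head (.mu P') b ∧ Multiset.Rel HeadEq a b := by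
      intro P P' h ih a ha
      obtain ⟨a₀, h₀, h0, rfl⟩ := ha.body_of_mu
      obtain ⟨b₀, hb₀, hab⟩ := ih a₀ h₀
      have hb0 : Proc.var 0 ∉ b₀ := by
        intro hb
        obtain ⟨H, hH, hh⟩ := Multiset.exists_mem_of_rel_of_mem (rel_headEq_symm hab) hb
        cases hh
        exact h0 hH
      refine ⟨b₀.map fun H => H.inst Expr.var (unfoldSubst P'), ?_, ?_⟩
      · rw [head_mu_iff, substProc_zero]
        exact hb₀.inst _ (isHead_unfoldSubst hb0)
      · rw [Multiset.rel_map]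
        exact hab.mono fun H hH H' _ hh => hh.inst h fun e => h0 (e ▸ hH)
    exact ⟨aux h ih.1, aux (.symm h) ih.2⟩

theorem StructEq.head_singleton {P Q H : Proc} (h : StructEq P Q) (hP : Head P {H}) :
    ∃ H', Head Q {H'} ∧ HeadEq H H' := by
  obtain ⟨b, hb, hab⟩ := h.head hP
  obtain ⟨H', t, hH, ht, rfl⟩ := Multiset.rel_cons_left.1 hab
  rw [Multiset.rel_zero_left] at ht
  subst ht
  exact ⟨H', hb, hH⟩

/-! ### Guardedness -/

theorem Unguarded.head {P : Proc} {X : ℕ} (h : P.Unguarded X) : Head P {.var X} := by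
  induction P generalizing X with
  | mu P ih =>
    have := (ih h).inst Expr.var (σ := unfoldSubst P) (by
      intro Y hY
      cases Multiset.mem_singleton.1 hY
      trivial)
    rw [← substProc_zero] at this
    exact head_mu_iff.2 this
  | var Y => cases h; exact .var
  | _ => exact h.elim

theorem Head.unguarded {P : Proc} {X : ℕ} (h : Head P {.var X}) : P.Unguarded X := by
  induction P generalizing X with
  | mu P ih =>
    obtain ⟨a₀, h₀, h0, h⟩ := h.body_of_mu
    obtain ⟨H, rfl, hH⟩ := Multiset.map_eq_singleton.1 h.symm
    have hh := h₀.isHead H (by simp)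
    cases H with
    | var Y =>
      cases Y with
      | zero => exact (h0 (by simp)).elim
      | succ Y => cases hH; exact ih h₀
    | _ => simp [Proc.inst] at hH
  | var Y => cases Multiset.singleton_inj.1 (h.det .var); rfl
  | sum P Q =>
    obtain ⟨a, b, ha, hb, hab⟩ := head_sum_iff.1 h
    have := congrArg Multiset.card hab
    have ha := ha.choose_spec.card_pos
    have hb := hb.choose_spec.card_pos
    rw [Multiset.card_singleton, Multiset.card_add] at this
    omega
  | inp => cases Multiset.singleton_inj.1 (h.det .inp)
  | out => cases Multiset.singleton_inj.1 (h.det .out)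
  | ite => cases Multiset.singleton_inj.1 (h.det .ite)
  | nil => cases Multiset.singleton_inj.1 (h.det .nil)

theorem StructEq.unguarded_iff {P Q : Proc} (h : StructEq P Q) (X : ℕ) :
    P.Unguarded X ↔ Q.Unguarded X := by
  have key : ∀ {P Q : Proc}, StructEq P Q → P.Unguarded X → Q.Unguarded X := by
    intro P Q h hP
    obtain ⟨H, hH, hh⟩ := h.head_singleton hP.head
    cases hh
    exact hH.unguarded
  exact ⟨key h, key (.symm h)⟩

theorem unguarded_ren {P : Proc} {ξ ζ : ℕ → ℕ} {X : ℕ} :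
    (P.ren ξ ζ).Unguarded X ↔ ∃ Y, P.Unguarded Y ∧ ζ Y = X := by
  induction P generalizing ξ ζ X with
  | mu P ih =>
    simp only [ren, Unguarded, ih]
    constructor
    · rintro ⟨s, hs, h⟩
      cases s with
      | zero => simp [liftRen] at h
      | succ s => exact ⟨s, hs, by simpa [liftRen] using h⟩
    · rintro ⟨s, hs, h⟩
      exact ⟨s + 1, hs, by simpa [liftRen] using h⟩
  | _ => simp [ren, Unguarded]

theorem unguarded_inst {P : Proc} {θ : ℕ → Expr} {σ : ℕ → Proc} {X : ℕ} :
    (P.inst θ σ).Unguarded X ↔ ∃ Y, P.Unguarded Y ∧ (σ Y).Unguarded X := by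
  induction P generalizing θ σ X with
  | mu P ih =>
    simp only [inst, Unguarded, ih]
    constructor
    · rintro ⟨s, hs, h⟩
      cases s with
      | zero => simp [up, Unguarded] at h
      | succ s =>
        simp only [up, shiftProc_zero, unguarded_ren] at h
        obtain ⟨r, hr, hrt⟩ := h
        exact ⟨s, hs, by rwa [← Nat.succ_injective hrt]⟩
    · rintro ⟨s, hs, h⟩
      refine ⟨s + 1, hs, ?_⟩
      simp only [up, shiftProc_zero, unguarded_ren]
      exact ⟨X, h, rfl⟩
  | _ => simp [inst, Unguarded]

theorem unguarded_inst_up {P : Proc} {θ : ℕ → Expr} {σ : ℕ → Proc} :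
    (P.inst θ (up σ)).Unguarded 0 ↔ P.Unguarded 0 := by
  rw [unguarded_inst]
  constructor
  · rintro ⟨s, hs, h⟩
    cases s with
    | zero => exact hs
    | succ s =>
      simp only [up, shiftProc_zero, unguarded_ren] at h
      obtain ⟨r, -, hr⟩ := h
      cases hr
  · intro h
    exact ⟨0, h, rfl⟩

theorem guarded_ren {P : Proc} {ξ ζ : ℕ → ℕ} : (P.ren ξ ζ).Guarded ↔ P.Guarded := by
  induction P generalizing ξ ζ with
  | mu P ih =>
    simp only [ren, Guarded, ih, unguarded_ren]
    refine and_congr_left fun _ => not_congr ⟨?_, fun h => ⟨0, h, rfl⟩⟩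
    rintro ⟨s, hs, h⟩
    cases s with
    | zero => exact hs
    | succ s => simp [liftRen] at h
  | _ => simp_all [ren, Guarded]

theorem Guarded.inst {P : Proc} {θ : ℕ → Expr} {σ : ℕ → Proc} (h : P.Guarded)
    (hσ : ∀ X, (σ X).Guarded) : (P.inst θ σ).Guarded := by
  induction P generalizing θ σ with
  | mu P ih =>
    refine ⟨fun h' => h.1 (unguarded_inst_up.1 h'), ih h.2 fun X => ?_⟩
    cases X with
    | zero => trivial
    | succ X => simp only [up, shiftProc_zero, guarded_ren]; exact hσ X
  | inp p ℓ P ih =>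
    exact ih (show P.Guarded from h) fun X => by
      simp only [shiftExpr_zero, guarded_ren]; exact hσ X
  | out p ℓ e P ih => exact ih h hσ
  | sum P Q ih₁ ih₂ => exact ⟨ih₁ h.1 hσ, ih₂ h.2 hσ⟩
  | ite e P Q ih₁ ih₂ => exact ⟨ih₁ h.1 hσ, ih₂ h.2 hσ⟩
  | var X => exact hσ X
  | nil => trivial

theorem Guarded.of_inst {P : Proc} {θ : ℕ → Expr} {σ : ℕ → Proc} (h : (P.inst θ σ).Guarded) :
    P.Guarded ∧ ∀ X, P.Unguarded X → (σ X).Guarded := by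
  induction P generalizing θ σ with
  | mu P ih =>
    obtain ⟨h₁, h₂⟩ := ih h.2
    refine ⟨⟨fun h' => h.1 (unguarded_inst_up.2 h'), h₁⟩, fun X hX => ?_⟩
    have := h₂ (X + 1) hX
    simpa only [up, shiftProc_zero, guarded_ren] using this
  | inp p ℓ P ih => exact ⟨(ih h).1, fun X hX => hX.elim⟩
  | out p ℓ e P ih => exact ⟨(ih h).1, fun X hX => hX.elim⟩
  | sum P Q ih₁ ih₂ => exact ⟨⟨(ih₁ h.1).1, (ih₂ h.2).1⟩, fun X hX => hX.elim⟩
  | ite e P Q ih₁ ih₂ => exact ⟨⟨(ih₁ h.1).1, (ih₂ h.2).1⟩, fun X hX => hX.elim⟩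
  | var X => exact ⟨trivial, fun Y hY => by cases hY; exact h⟩
  | nil => exact ⟨trivial, fun Y hY => hY.elim⟩

theorem StructEq.guarded_iff {P Q : Proc} (h : StructEq P Q) : P.Guarded ↔ Q.Guarded := by
  induction h with
  | base h =>
    cases h with
    | unfold P =>
      rw [substProc_zero]
      constructor
      · intro h
        refine Guarded.inst h.2 fun X => ?_
        cases X with
        | zero => exact h
        | succ X => trivial
      · intro h
        obtain ⟨h₁, h₂⟩ := h.of_inst
        exact ⟨fun h0 => (h₂ 0 h0).1 h0, h₁⟩
    | comm => exact and_comm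
    | assoc => exact and_assoc
  | refl => rfl
  | symm _ ih => exact ih.symm
  | trans _ _ ih₁ ih₂ => exact ih₁.trans ih₂
  | inp _ _ _ ih => exact ih
  | out _ _ _ _ ih => exact ih
  | sum _ _ ih₁ ih₂ => exact and_congr ih₁ ih₂
  | ite _ _ _ ih₁ ih₂ => exact and_congr ih₁ ih₂
  | mu h ih => exact and_congr (not_congr (StructEq.unguarded_iff h 0)) ih

end Proc
/-! ### Sessions as multisets of process classes -/

namespace Proc

theorem structEq_equivalence : Equivalence StructEq := ⟨.refl, .symm, .trans⟩

/-- Processes up to structural congruence. -/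
abbrev Class := Quotient (⟨StructEq, structEq_equivalence⟩ : Setoid Proc)

/-- The class of a process. -/
def cls (P : Proc) : Class := Quotient.mk _ P

theorem cls_eq_iff {P Q : Proc} : P.cls = Q.cls ↔ StructEq P Q :=
  ⟨fun h => Quotient.exact h, fun h => Quotient.sound h⟩

theorem cls_mu (P : Proc) : cls (.mu P) = cls (P.substProc 0 (.mu P)) :=
  cls_eq_iff.2 (.unfold P)

theorem InSum.head {q : Participant} {P : Proc} {bs : List (Label × Proc)} (h : InSum q P bs) :
    Head P ((bs.map fun b => Proc.inp q b.1 b.2 : List Proc) : Multiset Proc) := by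
  induction h with
  | inp ℓ P => exact .inp
  | sum _ _ ih₁ ih₂ =>
    rw [List.map_append, ← Multiset.coe_add]
    exact ih₁.sum ih₂

theorem InSum.ne_nil {q : Participant} {P : Proc} {bs : List (Label × Proc)} (h : InSum q P bs) :
    bs ≠ [] := by
  induction h with
  | inp => simp
  | sum _ _ ih => simp [ih]

theorem cls_eq_of_head {P Q H : Proc} (h : P.cls = Q.cls) (hP : Head P {H}) :
    ∃ H', Head Q {H'} ∧ HeadEq H H' :=
  (cls_eq_iff.1 h).head_singleton hP

theorem cls_out_ne_nil {p ℓ e P} : cls (.out p ℓ e P) ≠ cls .nil := by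
  intro h
  obtain ⟨H, hH, hh⟩ := cls_eq_of_head h .out
  cases Multiset.singleton_inj.1 (hH.det .nil)
  cases hh

theorem cls_ite_ne_nil {e P Q} : cls (.ite e P Q) ≠ cls .nil := by
  intro h
  obtain ⟨H, hH, hh⟩ := cls_eq_of_head h .ite
  cases Multiset.singleton_inj.1 (hH.det .nil)
  cases hh

theorem InSum.cls_ne_nil {q : Participant} {P : Proc} {bs : List (Label × Proc)}
    (h : InSum q P bs) : P.cls ≠ cls .nil := by
  intro h'
  obtain ⟨b, hb, hh⟩ := (cls_eq_iff.1 h').head h.head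
  cases hb.det .nil
  obtain ⟨b, hb⟩ := List.exists_mem_of_ne_nil bs h.ne_nil
  obtain ⟨H, hH, hh'⟩ := Multiset.exists_mem_of_rel_of_mem hh
    (Multiset.mem_coe.2 (List.mem_map.2 ⟨b, hb, rfl⟩))
  cases Multiset.mem_singleton.1 hH
  cases hh'

end Proc

/-- A multiset of participants with their processes, the latter up to structural congruence. -/
abbrev Config := Multiset (Participant × Proc.Class)

open Classical in
/-- The configuration of `p ◁ P`; a terminated process leaves no trace. -/
noncomputable def Config.atom (p : Participant) (P : Proc) : Config :=
  if P.cls = Proc.cls .nil then 0 else {(p, P.cls)}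

theorem Config.atom_of_ne {p : Participant} {P : Proc} (h : P.cls ≠ Proc.cls .nil) :
    Config.atom p P = {(p, P.cls)} := if_neg h

theorem Config.atom_of_eq {p : Participant} {P : Proc} (h : P.cls = Proc.cls .nil) :
    Config.atom p P = 0 := if_pos h

theorem Config.mem_atom {p : Participant} {P : Proc} {c : Participant × Proc.Class} :
    c ∈ Config.atom p P ↔ P.cls ≠ Proc.cls .nil ∧ c = (p, P.cls) := by
  by_cases h : P.cls = Proc.cls .nil
  · simp [Config.atom_of_eq h, h]
  · simp [Config.atom_of_ne h, h]

theorem Config.atom_congr {p : Participant} {P Q : Proc} (h : P.cls = Q.cls) :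
    Config.atom p P = Config.atom p Q := by
  rw [Config.atom, Config.atom, h]

/-- The configuration of a session. -/
noncomputable def Session.config : Session → Config
  | .pa p P => Config.atom p P
  | .par M N => M.config + N.config

theorem Session.StructEq.config {M N : Session} (h : Session.StructEq M N) :
    M.config = N.config := by
  induction h with
  | refl => rfl
  | symm _ ih => exact ih.symm
  | trans _ _ ih₁ ih₂ => exact ih₁.trans ih₂
  | par _ _ ih₁ ih₂ => simp only [Session.config, ih₁, ih₂]
  | multi p h => exact Config.atom_congr (Proc.cls_eq_iff.2 h)
  | par_nil p M => simp [Session.config, Config.atom_of_eq]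
  | par_comm M N => exact add_comm _ _
  | par_assoc M N K => exact add_assoc _ _ _

/-- Reduction of configurations. -/
inductive Config.Step : Config → Config → Prop where
  | comm {p q : Participant} {P Pj Q : Proc} {bs : List (Label × Proc)} {ℓ : Label} {e : Expr}
      {v : Value} (s : Config) : Proc.InSum q P bs → (ℓ, Pj) ∈ bs → Expr.Eval e v →
      Config.Step ((p, P.cls) ::ₘ (q, Proc.cls (.out p ℓ e Q)) ::ₘ s)
        (Config.atom p (Pj.substVal 0 v) + Config.atom q Q + s)
  | ite {p : Participant} {e : Expr} {b : Bool} (P Q : Proc) (s : Config) :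
      Expr.Eval e (.bool b) →
      Config.Step ((p, Proc.cls (.ite e P Q)) ::ₘ s) (Config.atom p (if b then P else Q) + s)

theorem Config.Step.add {m m' : Config} (h : Config.Step m m') (t : Config) :
    Config.Step (m + t) (m' + t) := by
  cases h with
  | comm s h₁ h₂ h₃ =>
    rw [Multiset.cons_add, Multiset.cons_add, add_assoc]
    exact .comm _ h₁ h₂ h₃
  | ite P Q s h =>
    rw [Multiset.cons_add, add_assoc]
    exact .ite _ _ _ h

theorem Session.Step.config {M N : Session} (h : Session.Step M N) :
    Config.Step M.config N.config := by
  induction h with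
  | @comm p q P Pj Q bs ℓ e v h₁ h₂ h₃ =>
    have := Config.Step.comm (p := p) (Q := Q) 0 h₁ h₂ h₃
    simpa only [Session.config, Config.atom_of_ne h₁.cls_ne_nil,
      Config.atom_of_ne Proc.cls_out_ne_nil, add_zero, Multiset.singleton_add,
      Multiset.cons_zero] using this
  | @ite_true p e P Q h =>
    have := Config.Step.ite (p := p) P Q 0 h
    simpa only [Session.config, Config.atom_of_ne Proc.cls_ite_ne_nil, add_zero, if_true,
      Multiset.cons_zero] using this
  | @ite_false p e P Q h =>
    have := Config.Step.ite (p := p) P Q 0 h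
    simpa [Session.config, Config.atom_of_ne Proc.cls_ite_ne_nil] using this
  | context N _ ih => exact ih.add _
  | struct h₁ _ h₂ ih => rwa [h₁.config, ← h₂.config]

theorem Session.StructEq.par_swap_nil (p : Participant) (M : Session) :
    Session.StructEq (.par M (.pa p .nil)) M :=
  (Session.StructEq.par_comm _ _).trans (.par_nil p M)

theorem Config.ne_nil_of_mem {M : Session} {c : Participant × Proc.Class} (h : c ∈ M.config) :
    c.2 ≠ Proc.cls .nil := by
  induction M with
  | pa p P =>
    obtain ⟨h', rfl⟩ := Config.mem_atom.1 h
    exact h'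
  | par M N ih₁ ih₂ => exact (Multiset.mem_add.1 h).elim ih₁ ih₂

/-- Any component that is not terminated may be moved to the front. -/
theorem Session.exists_front {M : Session} {p : Participant} {P : Proc}
    (h : (p, P.cls) ∈ M.config) :
    ∃ K : Session, Session.StructEq M (.par (.pa p P) K) ∧ M.config = (p, P.cls) ::ₘ K.config := by
  suffices h' : ∃ K : Session, Session.StructEq M (.par (.pa p P) K) by
    obtain ⟨K, hK⟩ := h'
    refine ⟨K, hK, ?_⟩
    rw [hK.config, Session.config, Session.config, Config.atom_of_ne (Config.ne_nil_of_mem h),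
      Multiset.singleton_add]
  induction M with
  | pa q Q =>
    obtain ⟨-, h⟩ := Config.mem_atom.1 h
    obtain ⟨rfl, h'⟩ := Prod.mk.inj h
    exact ⟨.pa 0 .nil, (Session.StructEq.multi p (Proc.cls_eq_iff.1 h'.symm)).trans
      (Session.StructEq.par_swap_nil 0 _).symm⟩
  | par M N ih₁ ih₂ =>
    rcases Multiset.mem_add.1 h with h | h
    · obtain ⟨K, hK⟩ := ih₁ h
      exact ⟨.par K N, (Session.StructEq.par hK (.refl N)).trans (.par_assoc _ _ _)⟩
    · obtain ⟨K, hK⟩ := ih₂ h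
      exact ⟨.par K M, ((Session.StructEq.par_comm _ _).trans
        (Session.StructEq.par hK (.refl M))).trans (.par_assoc _ _ _)⟩

/-- Every reduction of the configuration comes from a reduction of the session. -/
theorem Config.Step.session {M : Session} {m' : Config} (h : Config.Step M.config m') :
    ∃ N : Session, Session.Step M N ∧ N.config = m' := by
  generalize hm : M.config = m at h
  cases h with
  | @comm p q P Pj Q bs ℓ e v s h₁ h₂ h₃ =>
    obtain ⟨K, hK, hc⟩ := Session.exists_front (M := M) (p := p) (P := P) (by simp [hm])
    rw [hm, Multiset.cons_inj_right] at hc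
    obtain ⟨L, hL, hc'⟩ := Session.exists_front (M := K) (p := q) (P := .out p ℓ e Q)
      (by simp [← hc])
    rw [← hc, Multiset.cons_inj_right] at hc'
    refine ⟨.par (.par (.pa p (Pj.substVal 0 v)) (.pa q Q)) L, .struct ?_
      (.context L (.comm h₁ h₂ h₃)) (.refl _), ?_⟩
    · exact hK.trans ((Session.StructEq.par (.refl _) hL).trans
        (Session.StructEq.par_assoc _ _ _).symm)
    · simp only [Session.config, hc']
  | @ite p e b P Q s h =>
    obtain ⟨K, hK, hc⟩ := Session.exists_front (M := M) (p := p) (P := .ite e P Q) (by simp [hm])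
    rw [hm, Multiset.cons_inj_right] at hc
    refine ⟨.par (.pa p (if b then P else Q)) K, .struct hK (.context K ?_) (.refl _), ?_⟩
    · cases b
      · exact .ite_false _ _ h
      · exact .ite_true _ _ h
    · simp only [Session.config, hc]

theorem Session.structEq_nil_iff {M : Session} :
    (∃ p : Participant, Session.StructEq M (.pa p .nil)) ↔ M.config = 0 := by
  constructor
  · rintro ⟨p, h⟩
    rw [h.config, Session.config, Config.atom_of_eq rfl]
  · intro h
    induction M with
    | pa p P =>
      refine ⟨p, .multi p (Proc.cls_eq_iff.1 ?_)⟩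
      by_contra hP
      simp [Session.config, Config.atom_of_ne hP] at h
    | par M N ih₁ ih₂ =>
      rw [Session.config, add_eq_zero] at h
      obtain ⟨p, hp⟩ := ih₁ h.1
      obtain ⟨q, hq⟩ := ih₂ h.2
      exact ⟨q, (Session.StructEq.par hp hq).trans (.par_nil p _)⟩

/-- A configuration is stuck if it is not empty and does not reduce. -/
def Config.Stuck (m : Config) : Prop := m ≠ 0 ∧ ∀ m', ¬ Config.Step m m'

/-- The configuration reduces to a stuck one. -/
def Config.GetsStuck (m : Config) : Prop :=
  ∃ m', Relation.ReflTransGen Config.Step m m' ∧ m'.Stuck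

theorem Session.stuck_iff {M : Session} : M.Stuck ↔ M.config.Stuck := by
  refine and_congr (not_congr Session.structEq_nil_iff) ⟨fun h m' hm => ?_, ?_⟩
  · obtain ⟨N, hN, -⟩ := hm.session
    exact h ⟨N, hN⟩
  · rintro h ⟨N, hN⟩
    exact h _ hN.config

/-- Getting stuck is a property of the configuration. -/
theorem Session.getsStuck_iff {M : Session} : M.GetsStuck ↔ M.config.GetsStuck := by
  constructor
  · rintro ⟨N, h, hN⟩
    refine ⟨N.config, ?_, Session.stuck_iff.1 hN⟩
    exact h.lift Session.config fun _ _ h => Session.Step.config h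
  · rintro ⟨m', h, hm⟩
    suffices ∃ N, Relation.ReflTransGen Session.Step M N ∧ N.config = m' by
      obtain ⟨N, hN, rfl⟩ := this
      exact ⟨N, hN, Session.stuck_iff.2 hm⟩
    clear hm
    induction h with
    | refl => exact ⟨M, .refl, rfl⟩
    | tail _ h ih =>
      obtain ⟨N, hN, rfl⟩ := ih
      obtain ⟨N', hN', hc⟩ := h.session
      exact ⟨N', hN.tail hN', hc⟩

/-! ### Values of closed expressions -/

/-- The value belongs to the sort. -/
def Value.Is : Value → Srt → Prop
  | .num z, .nat => 0 ≤ z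
  | .num _, .int => True
  | .bool _, .bool => True
  | _, _ => False

theorem Value.Is.sub {v : Value} {S S' : Srt} (h : v.Is S) (hS : Srt.Sub S S') : v.Is S' := by
  cases hS with
  | refl => exact h
  | nat_int => cases v with
    | num z => trivial
    | bool b => exact h.elim

theorem Value.Is.hasSort {v : Value} {S : Srt} {Γ : List Srt} (h : v.Is S) :
    Expr.HasSort Γ (.val v) S := by
  cases v <;> cases S <;> first | exact h.elim | skip
  · exact .nat _ h
  · exact .int _
  · exact .bool _

theorem Value.Is.num {v : Value} {S : Srt} (h : v.Is S) (hS : S ≠ .bool) : ∃ z, v = .num z := by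
  cases v with
  | num z => exact ⟨z, rfl⟩
  | bool b => cases S <;> first | exact h.elim | exact (hS rfl).elim

theorem Value.Is.bool {v : Value} (h : v.Is .bool) : ∃ b, v = .bool b := by
  cases v with
  | num z => exact h.elim
  | bool b => exact ⟨b, rfl⟩

theorem Expr.HasSort.inst {Γ Γ' : List Srt} {e : Expr} {S : Srt} (h : Expr.HasSort Γ e S)
    {θ : ℕ → Expr} (hθ : ∀ x S, Γ[x]? = some S → Expr.HasSort Γ' (θ x) S) :
    Expr.HasSort Γ' (e.inst θ) S := by
  induction h with
  | nat z h => exact .nat z h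
  | int z => exact .int z
  | bool b => exact .bool b
  | var x S h => exact hθ x S h
  | succ _ ih => exact .succ ih
  | neg _ ih => exact .neg ih
  | not _ ih => exact .not ih
  | choice _ _ ih₁ ih₂ => exact .choice ih₁ ih₂
  | gt _ _ ih₁ ih₂ => exact .gt ih₁ ih₂
  | sub _ h ih => exact .sub ih h

/-- A closed expression of sort `S` has a value, and all of its values belong to `S`. -/
theorem Expr.HasSort.eval {e : Expr} {S : Srt} (h : Expr.HasSort [] e S) :
    (∃ v, Expr.Eval e v) ∧ ∀ v, Expr.Eval e v → v.Is S := by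
  induction h with
  | nat z h => exact ⟨⟨_, .val _⟩, fun v hv => by cases hv; exact h⟩
  | int z => exact ⟨⟨_, .val _⟩, fun v hv => by cases hv; trivial⟩
  | bool b => exact ⟨⟨_, .val _⟩, fun v hv => by cases hv; trivial⟩
  | var x S h => simp at h
  | succ _ ih =>
    obtain ⟨⟨v, hv⟩, h⟩ := ih
    obtain ⟨z, rfl⟩ := (h v hv).num (by simp)
    refine ⟨⟨_, .succ hv (h _ hv)⟩, fun w hw => ?_⟩
    cases hw with
    | succ hw h0 => exact Int.add_nonneg h0 zero_le_one
  | neg _ ih =>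
    obtain ⟨⟨v, hv⟩, h⟩ := ih
    obtain ⟨z, rfl⟩ := (h v hv).num (by simp)
    exact ⟨⟨_, .neg hv⟩, fun w hw => by cases hw; trivial⟩
  | not _ ih =>
    obtain ⟨⟨v, hv⟩, h⟩ := ih
    obtain ⟨z, rfl⟩ := (h v hv).bool
    exact ⟨⟨_, .not hv⟩, fun w hw => by cases hw; trivial⟩
  | choice _ _ ih₁ ih₂ =>
    obtain ⟨⟨v, hv⟩, h⟩ := ih₁
    refine ⟨⟨v, .choice_left hv⟩, fun w hw => ?_⟩
    cases hw with
    | choice_left hw => exact h w hw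
    | choice_right hw => exact ih₂.2 w hw
  | gt _ _ ih₁ ih₂ =>
    obtain ⟨⟨v, hv⟩, h⟩ := ih₁
    obtain ⟨⟨v', hv'⟩, h'⟩ := ih₂
    obtain ⟨z, rfl⟩ := (h v hv).num (by simp)
    obtain ⟨z', rfl⟩ := (h' v' hv').num (by simp)
    exact ⟨⟨_, .gt hv hv'⟩, fun w hw => by cases hw; trivial⟩
  | sub _ hS ih =>
    obtain ⟨hv, h⟩ := ih
    exact ⟨hv, fun w hw => (h w hw).sub hS⟩

/-! ### Semantic typing of closed processes -/

namespace Proc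

/-- One layer of semantic typing; `Q` is what the continuations have to satisfy. A conditional
leaves the type as it is, so a process that only ever evaluates conditionals has every type. -/
inductive SemRule (Q : Proc → SType → Prop) (P : Proc) (V : SType) : Prop where
  | nil : Head P {.nil} → V.Unfolds .done → SemRule Q P V
  | out {q : Participant} {ℓ : Label} {e : Expr} {P' : Proc} {n : ℕ} {ℓ' : Fin n → Label}
      {S : Fin n → Srt} {T : Fin n → SType} (j : Fin n) : Head P {.out q ℓ e P'} →
      V.Unfolds (.out q n ℓ' S T) → ℓ = ℓ' j → Expr.HasSort [] e (S j) → Q P' (T j) →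
      SemRule Q P V
  | ite {e : Expr} {A B : Proc} : Head P {.ite e A B} → Expr.HasSort [] e .bool → Q A V → Q B V →
      SemRule Q P V
  | inp {q : Participant} {n : ℕ} {ℓ : Fin n → Label} {S : Fin n → Srt} {T : Fin n → SType}
      (bs : Multiset (Label × Proc)) : Head P (bs.map fun b => .inp q b.1 b.2) →
      V.Unfolds (.inp q n ℓ S T) → (∀ j, ∃ b ∈ bs, b.1 = ℓ j) →
      (∀ j, ∀ b ∈ bs, b.1 = ℓ j → ∀ v : Value, v.Is (S j) → Q (b.2.substVal 0 v) (T j)) →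
      SemRule Q P V

/-- Semantic typing `P : V` of closed processes: the coinductive reading of the rules. -/
def Sem (P : Proc) (V : SType) : Prop :=
  ∃ Q : Proc → SType → Prop, (∀ P V, Q P V → SemRule Q P V) ∧ Q P V

theorem SemRule.mono {Q Q' : Proc → SType → Prop} (hQ : ∀ P V, Q P V → Q' P V) {P : Proc}
    {V : SType} (h : SemRule Q P V) : SemRule Q' P V := by
  cases h with
  | nil h₁ h₂ => exact .nil h₁ h₂
  | out j h₁ h₂ h₃ h₄ h₅ => exact .out j h₁ h₂ h₃ h₄ (hQ _ _ h₅)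
  | ite h₁ h₂ h₃ h₄ => exact .ite h₁ h₂ (hQ _ _ h₃) (hQ _ _ h₄)
  | inp bs h₁ h₂ h₃ h₄ =>
    exact .inp bs h₁ h₂ h₃ fun j b hb hj v hv => hQ _ _ (h₄ j b hb hj v hv)

theorem Sem.rule {P : Proc} {V : SType} (h : Sem P V) : SemRule Sem P V := by
  obtain ⟨Q, hQ, h⟩ := h
  exact (hQ _ _ h).mono fun P V h => ⟨Q, hQ, h⟩

theorem SemRule.sub {Q : Proc → SType → Prop} {P : Proc} {V V' : SType} (h : SemRule Q P V)
    (hV : SType.Subtype V V') :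
    SemRule (fun P V' => ∃ V, Q P V ∧ SType.Subtype V V') P V' := by
  cases h with
  | nil h₁ h₂ =>
    cases hV.rule with
    | done h₃ h₄ => exact .nil h₁ h₄
    | inp _ _ _ _ _ _ _ _ _ h₃ => cases h₂.det h₃
    | out _ _ _ _ _ _ _ _ _ h₃ => cases h₂.det h₃
  | out j h₁ h₂ h₃ h₄ h₅ =>
    cases hV.rule with
    | done h₃ h₄ => cases h₂.det h₃
    | inp _ _ _ _ _ _ _ _ _ h₃ => cases h₂.det h₃
    | out _ _ _ _ _ _ _ _ _ h h' hs =>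
      cases h₂.det h
      obtain ⟨k, hk, hS, hT⟩ := hs j
      exact .out k h₁ h' (h₃.trans hk) (h₄.sub hS) ⟨_, h₅, hT⟩
  | ite h₁ h₂ h₃ h₄ => exact .ite h₁ h₂ ⟨_, h₃, hV⟩ ⟨_, h₄, hV⟩
  | inp bs h₁ h₂ h₃ h₄ =>
    cases hV.rule with
    | done h₃ h₄ => cases h₂.det h₃
    | out _ _ _ _ _ _ _ _ _ h₃ => cases h₂.det h₃
    | inp _ _ _ _ _ _ _ _ _ h h' hs =>
      cases h₂.det h
      refine .inp bs h₁ h' (fun j => ?_) fun j b hb hj v hv => ?_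
      · obtain ⟨i, hi, -⟩ := hs j
        obtain ⟨b, hb, hbi⟩ := h₃ i
        exact ⟨b, hb, hbi.trans hi⟩
      · obtain ⟨i, hi, hS, hT⟩ := hs j
        exact ⟨_, h₄ i b hb (hj.trans hi.symm) v (hv.sub hS), hT⟩

theorem rel_headEq_inp {q : Participant} {bs : Multiset (Label × Proc)} {c : Multiset Proc}
    (h : Multiset.Rel HeadEq (bs.map fun b => .inp q b.1 b.2) c) :
    ∃ bs' : Multiset (Label × Proc), c = bs'.map (fun b => .inp q b.1 b.2) ∧
      Multiset.Rel (fun b b' => b.1 = b'.1 ∧ StructEq b.2 b'.2) bs bs' := by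
  induction bs using Multiset.induction_on generalizing c with
  | empty =>
    rw [Multiset.map_zero, Multiset.rel_zero_left] at h
    exact ⟨0, h, .zero⟩
  | cons b bs ih =>
    rw [Multiset.map_cons] at h
    obtain ⟨H, t, hH, ht, rfl⟩ := Multiset.rel_cons_left.1 h
    obtain ⟨bs', rfl, hbs⟩ := ih ht
    obtain ⟨ℓ, P⟩ := b
    cases hH with
    | @inp _ _ _ P' hH => exact ⟨(ℓ, P') ::ₘ bs', by simp, .cons ⟨rfl, hH⟩ hbs⟩

theorem SemRule.congr {Q : Proc → SType → Prop} {P P' : Proc} {V : SType} (h : SemRule Q P V)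
    (hP : StructEq P P') : SemRule (fun P' V => ∃ P, Q P V ∧ StructEq P P') P' V := by
  cases h with
  | nil h₁ h₂ =>
    obtain ⟨H, h, hh⟩ := hP.head_singleton h₁
    cases hh
    exact .nil h h₂
  | out j h₁ h₂ h₃ h₄ h₅ =>
    obtain ⟨H, h, hh⟩ := hP.head_singleton h₁
    cases hh with
    | out _ _ _ hh => exact .out j h h₂ h₃ h₄ ⟨_, h₅, hh⟩
  | ite h₁ h₂ h₃ h₄ =>
    obtain ⟨H, h, hh⟩ := hP.head_singleton h₁
    cases hh with
    | ite _ ha hb => exact .ite h h₂ ⟨_, h₃, ha⟩ ⟨_, h₄, hb⟩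
  | inp bs h₁ h₂ h₃ h₄ =>
    obtain ⟨c, hc, hr⟩ := hP.head h₁
    obtain ⟨bs', rfl, hbs⟩ := rel_headEq_inp hr
    refine .inp bs' hc h₂ (fun j => ?_) fun j b' hb' hj v hv => ?_
    · obtain ⟨b, hb, hj⟩ := h₃ j
      obtain ⟨b', hb', h⟩ := Multiset.exists_mem_of_rel_of_mem hbs hb
      exact ⟨b', hb', h.1.symm.trans hj⟩
    · obtain ⟨b, hb, h⟩ := Multiset.exists_mem_of_rel_of_mem (Multiset.rel_flip.2 hbs) hb'
      exact ⟨_, h₄ j b hb (h.1.trans hj) v hv, h.2.substVal v⟩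

theorem Sem.congr {P P' : Proc} {V : SType} (h : Sem P V) (hP : StructEq P P') : Sem P' V := by
  refine ⟨fun P' V => ∃ P, Sem P V ∧ StructEq P P', ?_, P, h, hP⟩
  rintro P' V ⟨P, h, hP⟩
  exact h.rule.congr hP

end Proc

/-! ### Typed processes are semantically typed -/

theorem Fin.append_injective {α : Type*} {n m : ℕ} {f : Fin n → α} {g : Fin m → α}
    (hf : Function.Injective f) (hg : Function.Injective g) (h : ∀ i j, f i ≠ g j) :
    Function.Injective (Fin.append f g) := by
  intro i j
  refine Fin.addCases (fun i => ?_) (fun i => ?_) i <;>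
    refine Fin.addCases (fun j => ?_) (fun j => ?_) j <;>
    simp only [Fin.append_left, Fin.append_right]
  · intro e; rw [hf e]
  · intro e; exact (h _ _ e).elim
  · intro e; exact (h _ _ e.symm).elim
  · intro e; rw [hg e]

theorem SType.Union.isSessionType {T U V : SType} (h : SType.Union T U V) (hT : T.IsSessionType)
    (hU : U.IsSessionType) : V.IsSessionType := by
  cases h with
  | same => exact hT
  | union h₁ h₂ hd =>
    have hT' := h₁.isSessionType hT
    have hU' := h₂.isSessionType hU
    refine ⟨fun i => ?_, by have := hT'.2.1; omega,
      Fin.append_injective hT'.2.2.1 hU'.2.2.1 hd, fun i => ?_⟩ <;>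
    refine Fin.addCases (fun i => ?_) (fun i => ?_) i <;>
    simp only [Fin.append_left, Fin.append_right]
    · exact hT'.1 i
    · exact hU'.1 i
    · exact hT'.2.2.2 i
    · exact hU'.2.2.2 i

theorem SType.Union.subtype {T U V : SType} (h : SType.Union T U V) (hT : T.IsSessionType)
    (hU : U.IsSessionType) : SType.Subtype T V ∧ SType.Subtype U V := by
  cases h with
  | same h => exact ⟨hT.subtype_refl, h.symm.subtype hU.1⟩
  | @union p n m ℓ ℓ' S S' T' U' h₁ h₂ hd =>
    have hT' := h₁.isSessionType hT
    have hU' := h₂.isSessionType hU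
    constructor
    · refine SType.Subtype.fold (.out _ _ _ _ _ _ _ _ _ h₁ SType.unfolds_out
        fun i => ⟨Fin.castAdd m i, ?_⟩)
      simp only [Fin.append_left]
      exact ⟨trivial, .refl _, (hT'.out i).subtype_refl⟩
    · refine SType.Subtype.fold (.out _ _ _ _ _ _ _ _ _ h₂ SType.unfolds_out
        fun i => ⟨Fin.natAdd n i, ?_⟩)
      simp only [Fin.append_right]
      exact ⟨trivial, .refl _, (hU'.out i).subtype_refl⟩

namespace Proc

theorem HasType.isSessionType {Γ : List Srt} {Δ : List SType} {P : Proc} {T : SType}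
    (h : HasType Γ Δ P T) (hΔ : ∀ U ∈ Δ, U.IsSessionType) : T.IsSessionType := by
  induction h with
  | @in_choice Γ Δ q P n ℓ P' S T h₁ h₂ _ ih =>
    have hn : 0 < n := by
      have := h₁.ne_nil
      rcases Nat.eq_zero_or_pos n with rfl | hn
      · simp at this
      · exact hn
    exact ⟨fun i => (ih i hΔ).1, hn, h₂, fun i => (ih i hΔ).2⟩
  | nil => exact SType.isSessionType_done
  | out _ _ ih =>
    exact ⟨fun _ => (ih hΔ).1, Nat.one_pos, fun i j _ => Subsingleton.elim i j,
      fun _ => (ih hΔ).2⟩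
  | cond _ _ _ hu ih₁ ih₂ => exact hu.isSessionType (ih₁ hΔ) (ih₂ hΔ)
  | recur h => exact h
  | var h => exact hΔ _ (List.mem_of_getElem? h)
  | sub _ h => exact h
  | unfold _ _ ih => exact ih hΔ

theorem InSum.inst {q : Participant} {P : Proc} {bs : List (Label × Proc)} (h : InSum q P bs)
    (θ : ℕ → Expr) (σ : ℕ → Proc) :
    InSum q (P.inst θ σ)
      (bs.map fun b => (b.1, b.2.inst (Expr.up θ) fun X => (σ X).shiftExpr 0)) := by
  induction h with
  | inp => exact .inp _ _
  | sum _ _ ih₁ ih₂ => rw [List.map_append]; exact .sum ih₁ ih₂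

theorem InSum.guarded {q : Participant} {P : Proc} {bs : List (Label × Proc)} (h : InSum q P bs)
    (hP : P.Guarded) : ∀ b ∈ bs, b.2.Guarded := by
  induction h with
  | inp => intro b hb; cases List.mem_singleton.1 hb; exact hP
  | sum _ _ ih₁ ih₂ =>
    intro b hb
    exact (List.mem_append.1 hb).elim (ih₁ hP.1 b) (ih₂ hP.2 b)

/-- Closed instances of typed processes. The process variables are replaced by processes for
which the same holds, which covers the unfoldings of recursive processes. -/
inductive ClosedInst : Proc → SType → Prop where
  | inst {Γ : List Srt} {Δ : List SType} {P : Proc} {T : SType} {θ : ℕ → Expr} {σ : ℕ → Proc} :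
      HasType Γ Δ P T → P.Guarded → (∀ U ∈ Δ, U.IsSessionType) →
      (∀ x S, Γ[x]? = some S → Expr.HasSort [] (θ x) S) →
      (∀ X U, Δ[X]? = some U → ClosedInst (σ X) U) → ClosedInst (P.inst θ σ) T
  | sub {P : Proc} {V V' : SType} : ClosedInst P V → SType.Subtype V V' → ClosedInst P V'
  | congr {P P' : Proc} {V : SType} : ClosedInst P V → StructEq P P' → ClosedInst P' V

theorem SemRule.closedInst_sub {P : Proc} {V V' : SType} (h : SemRule ClosedInst P V)
    (hV : SType.Subtype V V') : SemRule ClosedInst P V' :=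
  (h.sub hV).mono fun _ _ ⟨_, h, hV⟩ => h.sub hV

theorem SemRule.closedInst_congr {P P' : Proc} {V : SType} (h : SemRule ClosedInst P V)
    (hP : StructEq P P') : SemRule ClosedInst P' V :=
  (h.congr hP).mono fun _ _ ⟨_, h, hP⟩ => h.congr hP

/-- The rule of semantic typing holds for an instance of a typed process as soon as it holds for
the processes that are substituted at unguarded occurrences. By guardedness these do not include
the unfolding of a recursion in its own body. -/
theorem HasType.semRule {Γ : List Srt} {Δ : List SType} {P : Proc} {T : SType}
    (h : HasType Γ Δ P T) {θ : ℕ → Expr} {σ : ℕ → Proc} (hP : P.Guarded)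
    (hΔ : ∀ U ∈ Δ, U.IsSessionType)
    (hθ : ∀ x S, Γ[x]? = some S → Expr.HasSort [] (θ x) S)
    (hσ : ∀ X U, Δ[X]? = some U → ClosedInst (σ X) U)
    (hu : ∀ X U, Δ[X]? = some U → P.Unguarded X → SemRule ClosedInst (σ X) U) :
    SemRule ClosedInst (P.inst θ σ) T := by
  induction h generalizing θ σ with
  | @in_choice Γ Δ q P n ℓ P' S T h₁ h₂ h₃ ih =>
    have hh := (h₁.inst θ σ).head
    rw [List.map_map, List.map_ofFn] at hh
    refine .inp (bs := (List.ofFn fun i => (ℓ i, (P' i).inst (Expr.up θ) fun X =>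
      (σ X).shiftExpr 0) : List (Label × Proc))) ?_ SType.unfolds_inp (fun j => ?_)
      fun j b hb hj v hv => ?_
    · rw [Multiset.map_coe, List.map_ofFn]; exact hh
    · exact ⟨_, Multiset.mem_coe.2 (List.mem_ofFn.2 ⟨j, rfl⟩), rfl⟩
    · obtain ⟨i, rfl⟩ := List.mem_ofFn.1 (Multiset.mem_coe.1 hb)
      cases h₂ hj
      simp only [inst_up_substVal]
      refine .inst (h₃ _) (h₁.guarded hP _ (List.mem_ofFn.2 ⟨_, rfl⟩)) hΔ (fun x S' hx => ?_) hσ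
      cases x with
      | zero => cases hx; exact hv.hasSort
      | succ x => exact hθ x S' hx
  | nil => exact .nil .nil SType.unfolds_done
  | out he hP' ih => exact .out 0 .out SType.unfolds_out rfl (he.inst hθ) (.inst hP' hP hΔ hθ hσ)
  | cond he h₁ h₂ hU =>
    have hs := hU.subtype (h₁.isSessionType hΔ) (h₂.isSessionType hΔ)
    exact .ite .ite (he.inst hθ) (.sub (.inst h₁ hP.1 hΔ hθ hσ) hs.1)
      (.sub (.inst h₂ hP.2 hΔ hθ hσ) hs.2)
  | @recur Γ Δ P T hT h ih =>
    have key : SemRule ClosedInst (P.inst θ (scons ((Proc.mu P).inst θ σ) σ)) T := by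
      refine ih hP.2 (by simpa using ⟨hT, hΔ⟩) hθ (fun X U hX => ?_) fun X U hX hXu => ?_
      · cases X with
        | zero => cases hX; exact .inst (.recur hT h) hP hΔ hθ hσ
        | succ X => exact hσ X U hX
      · cases X with
        | zero => exact (hP.1 hXu).elim
        | succ X => exact hu X U hX hXu
    refine key.closedInst_congr (.symm ?_)
    rw [← inst_up_substProc]
    exact StructEq.unfold _
  | var hX => exact hu _ _ hX rfl
  | sub _ _ hs ih => exact (ih hP hΔ hθ hσ hu).closedInst_sub hs
  | unfold _ hPQ ih =>
    have hPQ := hPQ.structEq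
    exact (ih (hPQ.guarded_iff.2 hP) hΔ hθ hσ fun X U hX hXu =>
      hu X U hX ((hPQ.unguarded_iff X).1 hXu)).closedInst_congr (hPQ.inst θ σ)

theorem ClosedInst.semRule {P : Proc} {V : SType} (h : ClosedInst P V) :
    SemRule ClosedInst P V := by
  induction h with
  | inst h hP hΔ hθ hσ ih => exact h.semRule hP hΔ hθ hσ fun X U hX _ => ih X U hX
  | sub _ h ih => exact ih.closedInst_sub h
  | congr _ h ih => exact ih.closedInst_congr h

/-- Typed processes are semantically typed. -/
theorem HasType.sem {P : Proc} {T : SType} (h : HasType [] [] P T) (hP : P.Guarded) : Sem P T := by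
  refine ⟨ClosedInst, fun P V => ClosedInst.semRule, ?_⟩
  rw [← inst_var P]
  exact .inst h hP (by simp) (by simp) (by simp)

end Proc
/-! ### Merging and subtyping -/

namespace SType

/-- The root of the type is an intersection or a union. -/
def Acts (T : SType) : Prop :=
  (∃ p n ℓ S T', T.Unfolds (.inp p n ℓ S T')) ∨ ∃ p n ℓ S T', T.Unfolds (.out p n ℓ S T')

theorem Acts.not_done {T : SType} (h : T.Acts) : ¬ T.Unfolds .done := by
  intro h'
  rcases h with ⟨p, n, ℓ, S, T', h⟩ | ⟨p, n, ℓ, S, T', h⟩ <;> cases h.det h'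

theorem Acts.not_var {T : SType} (h : T.Acts) (t : ℕ) : ¬ T.Unfolds (.var t) := by
  intro h'
  rcases h with ⟨p, n, ℓ, S, T', h⟩ | ⟨p, n, ℓ, S, T', h⟩ <;> cases h.det h'

theorem Unfolds.acts_inst_iff {T U : SType} (h : T.Unfolds U) (σ : ℕ → SType) :
    (T.inst σ).Acts ↔ (U.inst σ).Acts := by
  simp only [Acts, h.inst_iff]

theorem Subtype.acts_iff {T U : SType} (h : SType.Subtype T U) : T.Acts ↔ U.Acts := by
  cases h.rule with
  | done h₁ h₂ => exact ⟨fun h => (h.not_done h₁).elim, fun h => (h.not_done h₂).elim⟩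
  | inp p n m ℓ ℓ' S S' T' U' h₁ h₂ =>
    exact ⟨fun _ => .inl ⟨_, _, _, _, _, h₂⟩, fun _ => .inl ⟨_, _, _, _, _, h₁⟩⟩
  | out p n m ℓ ℓ' S S' T' U' h₁ h₂ =>
    exact ⟨fun _ => .inr ⟨_, _, _, _, _, h₂⟩, fun _ => .inr ⟨_, _, _, _, _, h₁⟩⟩

theorem WellFormed.cases {T : SType} (h : T.WellFormed) :
    T.Unfolds .done ∨ (∃ t, T.Unfolds (.var t)) ∨ T.Acts := by
  obtain ⟨U, hU⟩ := h.exists_unfolds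
  cases U with
  | inp p n ℓ S T' => exact .inr (.inr (.inl ⟨_, _, _, _, _, hU⟩))
  | out p n ℓ S T' => exact .inr (.inr (.inr ⟨_, _, _, _, _, hU⟩))
  | mu U => exact absurd rfl (hU.not_mu U)
  | var t => exact .inr (.inl ⟨t, hU⟩)
  | done => exact .inl hU

theorem TreeEq.acts {T U : SType} (h : TreeEq T U) (hT : T.Acts) : U.Acts := by
  cases h.rule with
  | done h₁ h₂ => exact (hT.not_done h₁).elim
  | var t h₁ h₂ => exact (hT.not_var t h₁).elim
  | inp p n m ℓ ℓ' S S' T' U' h₁ h₂ => exact .inl ⟨_, _, _, _, _, h₂⟩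
  | out p n m ℓ ℓ' S S' T' U' h₁ h₂ => exact .inr ⟨_, _, _, _, _, h₂⟩

theorem TreeEq.var {T U : SType} (h : TreeEq T U) {t : ℕ} (hT : T.Unfolds (.var t)) :
    U.Unfolds (.var t) := by
  cases h.rule with
  | done h₁ h₂ => cases hT.det h₁
  | var t h₁ h₂ => cases hT.det h₁; exact h₂
  | inp p n m ℓ ℓ' S S' T' U' h₁ h₂ => cases hT.det h₁
  | out p n m ℓ ℓ' S S' T' U' h₁ h₂ => cases hT.det h₁

theorem Merge.var_iff {T U V : SType} (h : Merge T U V) (t : ℕ) :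
    (T.Unfolds (.var t) ↔ V.Unfolds (.var t)) ∧ (U.Unfolds (.var t) ↔ V.Unfolds (.var t)) := by
  cases h with
  | same h => exact ⟨.rfl, h.symm.var, h.var⟩
  | inter h₁ h₂ =>
    exact ⟨⟨fun h => by (cases h.det h₁), fun h => by cases h.det unfolds_inp⟩,
      ⟨fun h => by (cases h.det h₂), fun h => by cases h.det unfolds_inp⟩⟩

theorem Merge.acts {T U V : SType} (h : Merge T U V) (hV : V.Acts) : T.Acts ∧ U.Acts := by
  cases h with
  | same h => exact ⟨hV, h.acts hV⟩
  | inter h₁ h₂ => exact ⟨.inl ⟨_, _, _, _, _, h₁⟩, .inl ⟨_, _, _, _, _, h₂⟩⟩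

theorem Merge.wellFormed {T U V : SType} (h : Merge T U V) (hT : T.WellFormed)
    (hU : U.WellFormed) : V.WellFormed := by
  cases h with
  | same => exact hT
  | inter h₁ h₂ hd =>
    have hT' := h₁.wellFormed hT
    have hU' := h₂.wellFormed hU
    refine ⟨by have := hT'.1; omega, Fin.append_injective hT'.2.1 hU'.2.1 hd, fun i => ?_⟩
    refine Fin.addCases (fun i => ?_) (fun i => ?_) i <;>
    simp only [Fin.append_left, Fin.append_right]
    · exact hT'.2.2 i
    · exact hU'.2.2 i

/-- The merge of two types is a common subtype, for all closed instances. -/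
theorem Merge.subtype {T U V : SType} (h : Merge T U V) (hT : T.WellFormed)
    (hU : U.WellFormed) {σ : ℕ → SType} (hσ : ∀ t, (σ t).IsSessionType) :
    SType.Subtype (V.inst σ) (T.inst σ) ∧ SType.Subtype (V.inst σ) (U.inst σ) := by
  have session : ∀ {W : SType}, W.WellFormed → (W.inst σ).IsSessionType := fun h =>
    ⟨inst_closedAt fun t => (hσ t).1, wellFormed_inst h fun t => (hσ t).2⟩
  cases h with
  | same h =>
    exact ⟨(session hT).subtype_refl,
      (h.inst fun t => (hσ t).2).subtype (session hT).1⟩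
  | @inter p n m ℓ ℓ' S S' T' U' h₁ h₂ hd =>
    have hT' := h₁.wellFormed hT
    have hU' := h₂.wellFormed hU
    constructor
    · refine .fold (.inp _ _ _ _ _ _ _ _ _ (unfolds_inp.inst_inp σ) (h₁.inst_inp σ)
        fun i => ⟨Fin.castAdd m i, ?_⟩)
      simp only [Fin.append_left]
      exact ⟨trivial, .refl _, (session (hT'.2.2 i)).subtype_refl⟩
    · refine .fold (.inp _ _ _ _ _ _ _ _ _ (unfolds_inp.inst_inp σ) (h₂.inst_inp σ)
        fun i => ⟨Fin.natAdd n i, ?_⟩)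
      simp only [Fin.append_right]
      exact ⟨trivial, .refl _, (session (hU'.2.2 i)).subtype_refl⟩

theorem MergeAll.wellFormed {s : Multiset SType} {U : SType} (h : MergeAll s U)
    (hs : ∀ T ∈ s, T.WellFormed) : U.WellFormed := by
  induction h with
  | single T => exact hs T (by simp)
  | add _ _ h ih₁ ih₂ =>
    exact h.wellFormed (ih₁ fun T hT => hs T (Multiset.mem_add.2 (.inl hT)))
      (ih₂ fun T hT => hs T (Multiset.mem_add.2 (.inr hT)))

theorem MergeAll.var_iff {s : Multiset SType} {U : SType} (h : MergeAll s U) {T : SType}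
    (hT : T ∈ s) (t : ℕ) : T.Unfolds (.var t) ↔ U.Unfolds (.var t) := by
  induction h with
  | single => rw [Multiset.mem_singleton.1 hT]
  | add _ _ h ih₁ ih₂ =>
    rcases Multiset.mem_add.1 hT with hT | hT
    · exact (ih₁ hT).trans (h.var_iff t).1
    · exact (ih₂ hT).trans (h.var_iff t).2

theorem MergeAll.acts {s : Multiset SType} {U : SType} (h : MergeAll s U) (hU : U.Acts)
    {T : SType} (hT : T ∈ s) : T.Acts := by
  induction h with
  | single => rwa [Multiset.mem_singleton.1 hT]
  | add _ _ h ih₁ ih₂ =>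
    rcases Multiset.mem_add.1 hT with hT | hT
    · exact ih₁ (h.acts hU).1 hT
    · exact ih₂ (h.acts hU).2 hT

theorem MergeAll.subtype {s : Multiset SType} {U : SType} (h : MergeAll s U)
    (hs : ∀ T ∈ s, T.WellFormed) {σ : ℕ → SType} (hσ : ∀ t, (σ t).IsSessionType) {T : SType}
    (hT : T ∈ s) : SType.Subtype (U.inst σ) (T.inst σ) := by
  induction h with
  | single =>
    have hw := hs T hT
    rw [Multiset.mem_singleton.1 hT] at hw ⊢
    exact (show (SType.inst _ σ).IsSessionType from
      ⟨inst_closedAt fun t => (hσ t).1, wellFormed_inst hw fun t => (hσ t).2⟩).subtype_refl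
  | add h₁ h₂ h ih₁ ih₂ =>
    have hs₁ := fun T hT => hs T (Multiset.mem_add.2 (.inl hT))
    have hs₂ := fun T hT => hs T (Multiset.mem_add.2 (.inr hT))
    have := h.subtype (h₁.wellFormed hs₁) (h₂.wellFormed hs₂) hσ
    rcases Multiset.mem_add.1 hT with hT | hT
    · exact this.1.trans (ih₁ hs₁ hT)
    · exact this.2.trans (ih₂ hs₂ hT)

end SType

/-! ### Closed instances and unfolding of global types -/

namespace GType

/-- Replace the variable `t ≥ k` by `γ (t - k)`. The types `γ t` are meant to be closed, so that
nothing has to be renamed below binders. -/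
def inst : GType → ℕ → (ℕ → GType) → GType
  | .comm p q n ℓ S G, k, γ => .comm p q n ℓ S (fun i => (G i).inst k γ)
  | .mu G, k, γ => .mu (G.inst (k + 1) γ)
  | .var t, k, γ => if t < k then .var t else γ (t - k)
  | .done, _, _ => .done

/-- The unfolding of the closed recursion `μt.G`. -/
def unfold (G : GType) : GType := G.inst 0 (scons (.mu G) fun _ => .done)

/-- Unfolding the recursions at the root of the closed type `G` gives `H`. -/
inductive Unfolds : GType → GType → Prop where
  | root {G : GType} : (∀ G', G ≠ .mu G') → Unfolds G G
  | mu {G H : GType} : Unfolds G.unfold H → Unfolds (.mu G) H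

theorem inst_closed {G : GType} {k : ℕ} (h : G.ClosedAt k) (γ : ℕ → GType) : G.inst k γ = G := by
  induction G generalizing k with
  | comm p q n ℓ S G ih => simp only [inst]; congr; funext i; exact ih i (h i)
  | mu G ih => simp only [inst]; rw [ih h]
  | var t => exact if_pos h
  | done => rfl

theorem closedAt_mono {G : GType} {k m : ℕ} (h : G.ClosedAt k) (hkm : k ≤ m) : G.ClosedAt m := by
  induction G generalizing k m with
  | comm p q n ℓ S G ih => exact fun i => ih i (h i) hkm
  | mu G ih => exact ih (k := k + 1) (m := m + 1) h (by omega)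
  | var t => exact lt_of_lt_of_le (show t < k from h) hkm
  | done => trivial

theorem closedAt_inst {G : GType} {k : ℕ} {γ : ℕ → GType} (hγ : ∀ t, (γ t).ClosedAt 0) :
    (G.inst k γ).ClosedAt k := by
  induction G generalizing k with
  | comm p q n ℓ S G ih => exact fun i => ih i
  | mu G ih => exact ih (k := k + 1)
  | var t =>
    simp only [inst]
    split_ifs with h
    · exact h
    · exact closedAt_mono (hγ _) (Nat.zero_le k)
  | done => trivial

theorem inst_succ_inst {G : GType} {k : ℕ} {γ : ℕ → GType} (hγ : ∀ t, (γ t).ClosedAt 0)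
    (H : GType) (δ : ℕ → GType) :
    (G.inst (k + 1) γ).inst k (scons H δ) = G.inst k (scons H γ) := by
  induction G generalizing k with
  | comm p q n ℓ S G ih => simp only [inst]; congr; funext i; exact ih i
  | mu G ih => simp only [inst]; rw [ih]
  | var t =>
    simp only [inst]
    rcases Nat.lt_trichotomy t k with h | rfl | h
    · rw [if_pos (by omega), if_pos h]; exact if_pos h
    · rw [if_pos (by omega), if_neg (by omega), Nat.sub_self]
      simp only [inst, lt_irrefl, if_false, Nat.sub_self]; rfl
    · rw [if_neg (by omega), if_neg (by omega), inst_closed (closedAt_mono (hγ _) (Nat.zero_le k))]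
      obtain ⟨s, rfl⟩ : ∃ s, t = k + 1 + s := ⟨t - (k + 1), by omega⟩
      rw [show k + 1 + s - (k + 1) = s by omega, show k + 1 + s - k = s + 1 by omega]; rfl
  | done => rfl

theorem unfold_inst {G : GType} {γ : ℕ → GType} (hγ : ∀ t, (γ t).ClosedAt 0) :
    (G.inst 1 γ).unfold = G.inst 0 (scons ((GType.mu G).inst 0 γ) γ) :=
  inst_succ_inst hγ _ _

theorem Unguarded.lt {G : GType} {k t : ℕ} (h : G.Unguarded t) (hG : G.ClosedAt k) : t < k := by
  induction G generalizing k t with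
  | comm => exact h.elim
  | mu G ih => exact Nat.lt_of_succ_lt_succ (ih (k := k + 1) h hG)
  | var s => cases h; exact hG
  | done => exact h.elim

theorem unguarded_of_inst {G : GType} {k t : ℕ} {γ : ℕ → GType} (hγ : ∀ t, (γ t).ClosedAt 0)
    (ht : t < k) (h : (G.inst k γ).Unguarded t) : G.Unguarded t := by
  induction G generalizing k t with
  | comm => exact h.elim
  | mu G ih => exact ih (k := k + 1) (t := t + 1) (by omega) h
  | var s =>
    simp only [inst] at h
    split_ifs at h with hs
    · exact h
    · exact absurd (h.lt (hγ _)) (Nat.not_lt_zero t)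
  | done => exact h.elim

theorem wellFormed_inst {G : GType} {k : ℕ} {γ : ℕ → GType} (hγ : ∀ t, (γ t).IsGlobalType)
    (h : G.WellFormed) : (G.inst k γ).WellFormed := by
  induction G generalizing k with
  | comm p q n ℓ S G ih => exact ⟨h.1, h.2.1, h.2.2.1, fun i => ih i (h.2.2.2 i)⟩
  | mu G ih =>
    exact ⟨fun h' => h.1 (unguarded_of_inst (fun t => (hγ t).1) (Nat.succ_pos k) h'), ih h.2⟩
  | var t =>
    simp only [inst]
    split_ifs
    · trivial
    · exact (hγ _).2
  | done => trivial

theorem isGlobalType_done : GType.done.IsGlobalType := ⟨trivial, trivial⟩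

theorem isGlobalType_inst {G : GType} {γ : ℕ → GType} (hγ : ∀ t, (γ t).IsGlobalType)
    (h : G.WellFormed) : (G.inst 0 γ).IsGlobalType :=
  ⟨closedAt_inst fun t => (hγ t).1, wellFormed_inst hγ h⟩

theorem isGlobalType_scons {G : GType} {γ : ℕ → GType} (hG : G.IsGlobalType)
    (hγ : ∀ t, (γ t).IsGlobalType) (t : ℕ) : (scons G γ t).IsGlobalType := by
  cases t with
  | zero => exact hG
  | succ t => exact hγ t

theorem IsGlobalType.unfold {G : GType} (h : (GType.mu G).IsGlobalType) :
    G.unfold.IsGlobalType :=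
  isGlobalType_inst (isGlobalType_scons h fun _ => isGlobalType_done) h.2.2

theorem not_mem_participants_inst {r : Participant} {G : GType} {k : ℕ} {γ : ℕ → GType}
    (h : r ∉ G.participants) (hγ : ∀ t, r ∉ (γ t).participants) :
    r ∉ (G.inst k γ).participants := by
  induction G generalizing k with
  | comm p q n ℓ S G ih =>
    simp only [inst, participants, Set.mem_union, Set.mem_iUnion, not_or, not_exists] at h ⊢
    exact ⟨h.1, fun i => ih i (h.2 i)⟩
  | mu G ih => exact ih h
  | var t =>
    simp only [inst]
    split_ifs
    · exact h
    · exact hγ _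
  | done => exact h

theorem not_mem_participants_unfold {r : Participant} {G : GType} (h : r ∉ G.participants) :
    r ∉ G.unfold.participants := by
  refine not_mem_participants_inst h fun t => ?_
  cases t with
  | zero => exact h
  | succ t => exact id

theorem Unfolds.mu_iff {G H : GType} : (GType.mu G).Unfolds H ↔ G.unfold.Unfolds H := by
  refine ⟨fun h => ?_, .mu⟩
  cases h with
  | root h => exact absurd rfl (h G)
  | mu h => exact h

theorem Unfolds.not_mu {G H : GType} (h : G.Unfolds H) : ∀ K, H ≠ .mu K := by
  induction h with
  | root h => exact h
  | mu _ ih => exact ih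

theorem Unfolds.det {G H K : GType} (h : G.Unfolds H) (h' : G.Unfolds K) : H = K := by
  induction h with
  | root h =>
    cases h' with
    | root => rfl
    | mu => exact absurd rfl (h _)
  | mu _ ih => exact ih (Unfolds.mu_iff.1 h')

theorem unfolds_comm {p q n ℓ S G} : (GType.comm p q n ℓ S G).Unfolds (.comm p q n ℓ S G) :=
  .root (by simp)

theorem unfolds_done : GType.done.Unfolds .done := .root (by simp)

theorem Unfolds.isGlobalType {G H : GType} (h : G.Unfolds H) (hG : G.IsGlobalType) :
    H.IsGlobalType := by
  induction h with
  | root => exact hG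
  | mu _ ih => exact ih hG.unfold

theorem Unfolds.not_mem_participants {r : Participant} {G H : GType} (h : G.Unfolds H)
    (hG : r ∉ G.participants) : r ∉ H.participants := by
  induction h with
  | root => exact hG
  | mu _ ih => exact ih (not_mem_participants_unfold hG)

/-- The number of recursion binders at the root. -/
def rootBinders : GType → ℕ
  | .mu G => G.rootBinders + 1
  | _ => 0

theorem rootBinders_inst {G : GType} {k : ℕ} {γ : ℕ → GType}
    (h : ∀ t, G.Unguarded t → t < k ∨ (γ (t - k)).rootBinders = 0) :
    (G.inst k γ).rootBinders = G.rootBinders := by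
  induction G generalizing k with
  | mu G ih =>
    simp only [inst, rootBinders]
    rw [ih]
    intro t ht
    cases t with
    | zero => exact .inl (Nat.succ_pos k)
    | succ t =>
      rcases h t ht with h | h
      · exact .inl (Nat.succ_lt_succ h)
      · exact .inr (by rwa [Nat.add_sub_add_right])
  | var t =>
    simp only [inst]
    split_ifs with hk
    · rfl
    · exact (h t rfl).resolve_left hk
  | _ => rfl

/-- A closed global type is `end` or starts with a communication. -/
theorem IsGlobalType.cases {G : GType} (h : G.IsGlobalType) :
    G.Unfolds .done ∨ ∃ p q n ℓ S G', G.Unfolds (.comm p q n ℓ S G') := by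
  suffices ∃ H, G.Unfolds H by
    obtain ⟨H, hH⟩ := this
    cases H with
    | comm p q n ℓ S G' => exact .inr ⟨_, _, _, _, _, _, hH⟩
    | mu H => exact absurd rfl (hH.not_mu H)
    | var t => exact absurd (hH.isGlobalType h).1 (Nat.not_lt_zero t)
    | done => exact .inl hH
  induction hn : G.rootBinders generalizing G with
  | zero =>
    refine ⟨G, .root ?_⟩
    rintro G' rfl
    simp [rootBinders] at hn
  | succ n ih =>
    cases G with
    | mu G =>
      obtain ⟨H, hH⟩ := ih h.unfold (by
        rw [GType.unfold, rootBinders_inst]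
        · simpa [rootBinders] using hn
        · intro t ht
          cases t with
          | zero => exact absurd ht h.2.1
          | succ t => exact .inr rfl)
      exact ⟨H, .mu hH⟩
    | _ => simp [rootBinders] at hn

/-! ### Projections are well formed -/

/-- The variable `t` occurs free. -/
def Free (t : ℕ) : GType → Prop
  | .comm _ _ _ _ _ G => ∃ i, (G i).Free t
  | .mu G => G.Free (t + 1)
  | .var s => s = t
  | .done => False

theorem exists_free {G : GType} {k : ℕ} (h : ¬ G.ClosedAt k) : ∃ t, k ≤ t ∧ G.Free t := by
  induction G generalizing k with
  | comm p q n ℓ S G ih =>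
    obtain ⟨i, hi⟩ := not_forall.1 h
    obtain ⟨t, ht, h⟩ := ih i hi
    exact ⟨t, ht, i, h⟩
  | mu G ih =>
    obtain ⟨t, ht, h⟩ := ih (k := k + 1) h
    cases t with
    | zero => omega
    | succ t => exact ⟨t, by omega, h⟩
  | var t => exact ⟨t, not_lt.1 h, rfl⟩
  | done => exact (h trivial).elim

theorem Free.not_closed {G : GType} {k t : ℕ} (h : G.Free t) (hG : G.ClosedAt k) : t < k := by
  induction G generalizing k t with
  | comm p q n ℓ S G ih =>
    obtain ⟨i, h⟩ := h
    exact ih i h (hG i)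
  | mu G ih => exact Nat.lt_of_succ_lt_succ (ih (k := k + 1) h hG)
  | var s => cases h; exact hG
  | done => exact h.elim

/-- Projections of well-formed types are well formed. For guardedness: where `r` occurs, its
projection starts with an action, and where it does not occur, all branches have to agree, so that
every free variable is the whole projection. -/
theorem Proj.wellFormed_aux {r : Participant} {G : GType} {T : SType} (h : Proj r G T)
    (hG : G.WellFormed) : T.WellFormed ∧ (r ∈ G.participants → ∀ t, ¬ T.Unfolds (.var t)) ∧
      (r ∉ G.participants → ∀ t, G.Free t → T.Unfolds (.var t)) := by
  induction h with
  | send h ih =>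
    exact ⟨⟨hG.2.1, hG.2.2.1, fun i => (ih i (hG.2.2.2 i)).1⟩,
      fun _ t h => by (cases h.det SType.unfolds_out), fun h => (h (by simp [participants])).elim⟩
  | recv hp h ih =>
    exact ⟨⟨hG.2.1, hG.2.2.1, fun i => (ih i (hG.2.2.2 i)).1⟩,
      fun _ t h => by (cases h.det SType.unfolds_inp), fun h => (h (by simp [participants])).elim⟩
  | @other p q n ℓ S G T U hp hq h hm ih =>
    have mem : ∀ i, T i ∈ Multiset.map T Finset.univ.val := fun i =>
      Multiset.mem_map_of_mem T (Finset.mem_univ_val i)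
    refine ⟨hm.wellFormed ?_, fun hr t hU => ?_, ?_⟩
    · rintro _ hT
      obtain ⟨i, -, rfl⟩ := Multiset.mem_map.1 hT
      exact (ih i (hG.2.2.2 i)).1
    · simp only [participants, Set.mem_union, Set.mem_insert_iff, Set.mem_singleton_iff, hp, hq,
        or_self, false_or, Set.mem_iUnion] at hr
      obtain ⟨i, hi⟩ := hr
      exact (ih i (hG.2.2.2 i)).2.1 hi t ((hm.var_iff (mem i) t).2 hU)
    · rintro hr t ⟨i, hi⟩
      simp only [participants, Set.mem_union, Set.mem_iUnion, not_or, not_exists] at hr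
      exact (hm.var_iff (mem i) t).1 ((ih i (hG.2.2.2 i)).2.2 (hr.2 i) t hi)
  | @mu G T hc h ih =>
    obtain ⟨h₁, h₂, h₃⟩ := ih hG.2
    have free : ∀ t, T.Unfolds (.var (t + 1)) → (SType.mu T).Unfolds (.var t) := fun t h =>
      SType.Unguarded.unfolds (T := .mu T) h.unguarded
    refine ⟨⟨fun h0 => ?_, h₁⟩, fun hr t hT => ?_, fun hr t ht => free t (h₃ hr (t + 1) ht)⟩
    · by_cases hr : r ∈ G.participants
      · exact h₂ hr 0 h0.unfolds
      · obtain ⟨t, -, ht⟩ := exists_free (hc.resolve_left hr)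
        cases h0.unfolds.det (h₃ hr (t + 1) ht)
    · exact h₂ hr (t + 1) (SType.Unguarded.unfolds (T := T) hT.unguarded)
  | mu_end hr hc =>
    exact ⟨trivial, fun h => (hr h).elim, fun _ t ht =>
      absurd (ht.not_closed hc) (Nat.not_lt_zero t)⟩
  | var t => exact ⟨trivial, fun h => h.elim, fun _ s hs => by cases hs; exact SType.unfolds_var⟩
  | done => exact ⟨trivial, fun h => h.elim, fun _ s hs => hs.elim⟩

theorem Proj.wellFormed {r : Participant} {G : GType} {T : SType} (h : Proj r G T)
    (hG : G.WellFormed) : T.WellFormed := (h.wellFormed_aux hG).1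

/-! ### Coinductive projection -/

/-- On every path through the closed type `G` there is a communication of `r`. -/
inductive Reaches (r : Participant) : GType → Prop where
  | here {G : GType} {p q : Participant} {n : ℕ} {ℓ : Fin n → Label} {S : Fin n → Srt}
      {G' : Fin n → GType} : G.Unfolds (.comm p q n ℓ S G') → r = p ∨ r = q → Reaches r G
  | there {G : GType} {p q : Participant} {n : ℕ} {ℓ : Fin n → Label} {S : Fin n → Srt}
      {G' : Fin n → GType} : G.Unfolds (.comm p q n ℓ S G') → (∀ i, Reaches r (G' i)) →
      Reaches r G

theorem Reaches.mu {r : Participant} {G : GType} (h : Reaches r G.unfold) :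
    Reaches r (.mu G) := by
  cases h with
  | here h h' => exact .here (.mu h) h'
  | there h h' => exact .there (.mu h) h'

/-- One layer of the coinductive projection: `V` is a subtype of what `r` does in `G`. Instead
of being merged, the branches of a communication between others all have to project to `V`; this
must not go on forever without `r`, unless `V` is `end`. -/
inductive ProjRule (r : Participant) (Q : GType → SType → Prop) (G : GType) (V : SType) : Prop where
  | done : G.Unfolds .done → V.Unfolds .done → ProjRule r Q G V
  | send {q : Participant} {n m : ℕ} {ℓ : Fin n → Label} {S : Fin n → Srt} {G' : Fin n → GType}
      {ℓ' : Fin m → Label} {S' : Fin m → Srt} {T : Fin m → SType} :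
      G.Unfolds (.comm r q n ℓ S G') → r ≠ q → V.Unfolds (.out q m ℓ' S' T) →
      (∀ j, ∃ i, ℓ' j = ℓ i ∧ Srt.Sub (S' j) (S i) ∧ Q (G' i) (T j)) → ProjRule r Q G V
  | recv {p : Participant} {n m : ℕ} {ℓ : Fin n → Label} {S : Fin n → Srt} {G' : Fin n → GType}
      {ℓ' : Fin m → Label} {S' : Fin m → Srt} {T : Fin m → SType} :
      G.Unfolds (.comm p r n ℓ S G') → p ≠ r → V.Unfolds (.inp p m ℓ' S' T) →
      Function.Injective ℓ' →
      (∀ i, ∃ j, ℓ i = ℓ' j ∧ Srt.Sub (S i) (S' j) ∧ Q (G' i) (T j)) → ProjRule r Q G V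
  | other {p q : Participant} {n : ℕ} {ℓ : Fin n → Label} {S : Fin n → Srt} {G' : Fin n → GType} :
      G.Unfolds (.comm p q n ℓ S G') → p ≠ q → r ≠ p → r ≠ q → 0 < n → (∀ i, Q (G' i) V) →
      (V.Acts → ∀ i, Reaches r (G' i)) → ProjRule r Q G V

/-- The coinductive projection of a closed global type onto `r`. -/
def CoProj (r : Participant) (G : GType) (V : SType) : Prop :=
  ∃ Q : GType → SType → Prop, (∀ G V, Q G V → ProjRule r Q G V) ∧ Q G V

theorem ProjRule.mono {r : Participant} {Q Q' : GType → SType → Prop}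
    (hQ : ∀ G V, Q G V → Q' G V) {G : GType} {V : SType} (h : ProjRule r Q G V) :
    ProjRule r Q' G V := by
  cases h with
  | done h₁ h₂ => exact .done h₁ h₂
  | send h₁ h₂ h₃ h₄ =>
    exact .send h₁ h₂ h₃ fun j => (h₄ j).imp fun i h => ⟨h.1, h.2.1, hQ _ _ h.2.2⟩
  | recv h₁ h₂ h₃ h₄ h₅ =>
    exact .recv h₁ h₂ h₃ h₄ fun j => (h₅ j).imp fun i h => ⟨h.1, h.2.1, hQ _ _ h.2.2⟩
  | other h₁ h₂ h₃ h₄ h₅ h₆ h₇ => exact .other h₁ h₂ h₃ h₄ h₅ (fun i => hQ _ _ (h₆ i)) h₇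

theorem CoProj.rule {r : Participant} {G : GType} {V : SType} (h : CoProj r G V) :
    ProjRule r (CoProj r) G V := by
  obtain ⟨Q, hQ, h⟩ := h
  exact (hQ _ _ h).mono fun _ _ h => ⟨Q, hQ, h⟩

theorem CoProj.fold {r : Participant} {G : GType} {V : SType} (h : ProjRule r (CoProj r) G V) :
    CoProj r G V := by
  refine ⟨fun H W => CoProj r H W ∨ H = G ∧ W = V, ?_, .inr ⟨rfl, rfl⟩⟩
  rintro H W (h' | ⟨rfl, rfl⟩)
  · exact h'.rule.mono fun _ _ => .inl
  · exact h.mono fun _ _ => .inl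

theorem CoProj.reaches {r : Participant} {G : GType} {V : SType} (h : CoProj r G V)
    (hV : V.Acts) : Reaches r G := by
  cases h.rule with
  | done h₁ h₂ => exact (hV.not_done h₂).elim
  | send h₁ => exact .here h₁ (.inl rfl)
  | recv h₁ => exact .here h₁ (.inr rfl)
  | other h₁ _ _ _ _ _ h => exact .there h₁ (h hV)

/-- Closed instances of projections. The variables are replaced by global types and their
projections in the same sense, which covers the unfoldings of recursive types. -/
inductive ProjInst (r : Participant) : GType → SType → Prop where
  | inst {G : GType} {T : SType} {γ : ℕ → GType} {σ : ℕ → SType} : Proj r G T → G.WellFormed →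
      (∀ t, (γ t).IsGlobalType) → (∀ t, (σ t).IsSessionType) → (∀ t, ProjInst r (γ t) (σ t)) →
      ProjInst r (G.inst 0 γ) (T.inst σ)
  | dead {G : GType} : G.IsGlobalType → r ∉ G.participants → ProjInst r G .done
  | sub {G : GType} {V V' : SType} : ProjInst r G V → V'.IsSessionType → SType.Subtype V' V →
      ProjInst r G V'

theorem ProjInst.isSessionType {r : Participant} {G : GType} {V : SType} (h : ProjInst r G V) :
    V.IsSessionType := by
  cases h with
  | inst h hG _ hσ =>
    exact ⟨SType.inst_closedAt fun t => (hσ t).1,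
      SType.wellFormed_inst (h.wellFormed hG) fun t => (hσ t).2⟩
  | dead => exact SType.isSessionType_done
  | sub _ h => exact h

theorem Proj.reaches {r : Participant} {G : GType} {T : SType} (h : Proj r G T)
    (hG : G.WellFormed) {γ : ℕ → GType} (hγ : ∀ t, (γ t).ClosedAt 0)
    (hT : T.Acts ∨ ∃ t, T.Unfolds (.var t) ∧ Reaches r (γ t)) : Reaches r (G.inst 0 γ) := by
  induction h generalizing γ with
  | send => exact .here unfolds_comm (.inl rfl)
  | recv => exact .here unfolds_comm (.inr rfl)
  | @other p q n ℓ S G T U hp hq h hm ih =>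
    refine .there unfolds_comm fun i => ih i (hG.2.2.2 i) hγ ?_
    have mem : T i ∈ Multiset.map T Finset.univ.val :=
      Multiset.mem_map_of_mem T (Finset.mem_univ_val i)
    exact hT.imp (fun h => hm.acts h mem) fun ⟨t, h, h'⟩ => ⟨t, (hm.var_iff mem t).2 h, h'⟩
  | @mu G T hc h ih =>
    refine Reaches.mu ?_
    rw [unfold_inst hγ]
    have hw := (Proj.mu hc h).wellFormed hG
    refine ih hG.2 (fun t => ?_) ?_
    · cases t with
      | zero => exact closedAt_inst hγ
      | succ t => exact hγ t
    · rcases hw.2.cases with h' | ⟨t, h'⟩ | h'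
      · have hd : (SType.mu T).Unfolds .done := .mu (SType.subst_zero T _ ▸ h'.inst_done _)
        rcases hT with hT | ⟨t, hT, -⟩
        · exact (hT.not_done hd).elim
        · cases hd.det hT
      · cases t with
        | zero => exact (hw.1 h'.unguarded).elim
        | succ t =>
          have hv : (SType.mu T).Unfolds (.var t) :=
            SType.Unguarded.unfolds (T := .mu T) h'.unguarded
          rcases hT with hT | ⟨s, hT, hs⟩
          · exact (hT.not_var t hv).elim
          · cases hv.det hT
            exact .inr ⟨t + 1, h', hs⟩
      · exact .inl h'
  | mu_end =>
    rcases hT with hT | ⟨t, hT, -⟩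
    · exact (hT.not_done SType.unfolds_done).elim
    · cases hT.det SType.unfolds_done
  | var t =>
    rcases hT with hT | ⟨s, hT, hs⟩
    · exact (hT.not_var t SType.unfolds_var).elim
    · cases hT.det SType.unfolds_var
      exact hs
  | done =>
    rcases hT with hT | ⟨t, hT, -⟩
    · exact (hT.not_done SType.unfolds_done).elim
    · cases hT.det SType.unfolds_done

theorem ProjInst.reaches {r : Participant} {G : GType} {V : SType} (h : ProjInst r G V)
    (hV : V.Acts) : Reaches r G := by
  induction h with
  | @inst G T γ σ h hG hγ hσ _ ih =>
    refine h.reaches hG (fun t => (hγ t).1) ?_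
    rcases (h.wellFormed hG).cases with h' | ⟨t, h'⟩ | h'
    · exact (hV.not_done (h'.inst_done σ)).elim
    · exact .inr ⟨t, h', ih t ((h'.acts_inst_iff σ).1 hV)⟩
    · exact .inl h'
  | dead => exact (hV.not_done SType.unfolds_done).elim
  | sub _ _ h ih => exact ih (h.acts_iff.1 hV)

theorem ProjRule.sub {r : Participant} {G : GType} {V V' : SType}
    (h : ProjRule r (ProjInst r) G V) (hV' : V'.IsSessionType) (hs : SType.Subtype V' V) :
    ProjRule r (ProjInst r) G V' := by
  cases h with
  | done h₁ h₂ =>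
    cases hs.rule with
    | done h₃ _ => exact .done h₁ h₃
    | inp _ _ _ _ _ _ _ _ _ _ h₄ => cases h₂.det h₄
    | out _ _ _ _ _ _ _ _ _ _ h₄ => cases h₂.det h₄
  | send h₁ h₂ h₃ h₄ =>
    cases hs.rule with
    | done _ h => cases h₃.det h
    | inp _ _ _ _ _ _ _ _ _ _ h => cases h₃.det h
    | out _ _ _ _ _ _ _ _ _ h h' hs =>
      cases h₃.det h'
      refine .send h₁ h₂ h fun j => ?_
      obtain ⟨k, hk, hS, hT⟩ := hs j
      obtain ⟨i, hi, hS', hQ⟩ := h₄ k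
      exact ⟨i, hk.trans hi, hS.trans hS', hQ.sub ((h.isSessionType hV').out j) hT⟩
  | recv h₁ h₂ h₃ h₄ h₅ =>
    cases hs.rule with
    | done _ h => cases h₃.det h
    | out _ _ _ _ _ _ _ _ _ _ h => cases h₃.det h
    | inp _ _ _ _ _ _ _ _ _ h h' hs =>
      cases h₃.det h'
      have hV := h.isSessionType hV'
      refine .recv h₁ h₂ h hV.2.2.1 fun i => ?_
      obtain ⟨j, hj, hS, hQ⟩ := h₅ i
      obtain ⟨k, hk, hS', hT⟩ := hs j
      exact ⟨k, hj.trans hk.symm, hS.trans hS', hQ.sub (hV.inp k) hT⟩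
  | other h₁ h₂ h₃ h₄ h₅ h₆ h₇ =>
    exact .other h₁ h₂ h₃ h₄ h₅ (fun i => (h₆ i).sub hV' hs) fun h => h₇ (hs.acts_iff.1 h)

theorem ProjRule.dead {r : Participant} {G : GType} (hG : G.IsGlobalType)
    (hr : r ∉ G.participants) : ProjRule r (ProjInst r) G .done := by
  rcases hG.cases with h | ⟨p, q, n, ℓ, S, G', h⟩
  · exact .done h SType.unfolds_done
  · have hG' := h.isGlobalType hG
    have hr' := h.not_mem_participants hr
    simp only [participants, Set.mem_union, Set.mem_insert_iff, Set.mem_singleton_iff, not_or,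
      Set.mem_iUnion, not_exists] at hr'
    exact .other h hG'.2.1 hr'.1.1 hr'.1.2 hG'.2.2.1
      (fun i => .dead ⟨hG'.1 i, hG'.2.2.2.2 i⟩ (hr'.2 i))
      fun h => (h.not_done SType.unfolds_done).elim

/-- The rule of coinductive projection holds for a closed instance of a projection as soon as it
holds for what is substituted at unguarded occurrences. -/
theorem Proj.projRule {r : Participant} {G : GType} {T : SType} (h : Proj r G T)
    {γ : ℕ → GType} {σ : ℕ → SType} (hG : G.WellFormed) (hγ : ∀ t, (γ t).IsGlobalType)
    (hσ : ∀ t, (σ t).IsSessionType) (hγσ : ∀ t, ProjInst r (γ t) (σ t))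
    (hu : ∀ t, G.Unguarded t → ProjRule r (ProjInst r) (γ t) (σ t)) :
    ProjRule r (ProjInst r) (G.inst 0 γ) (T.inst σ) := by
  induction h generalizing γ σ with
  | send h ih =>
    exact .send unfolds_comm hG.1 SType.unfolds_out fun j =>
      ⟨j, rfl, .refl _, .inst (h j) (hG.2.2.2 j) hγ hσ hγσ⟩
  | recv hp h ih =>
    exact .recv unfolds_comm hG.1 SType.unfolds_inp hG.2.2.1 fun j =>
      ⟨j, rfl, .refl _, .inst (h j) (hG.2.2.2 j) hγ hσ hγσ⟩
  | @other p q n ℓ S G T U hp hq h hm ih =>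
    have hU := (ProjInst.inst (.other hp hq h hm) hG hγ hσ hγσ).isSessionType
    have hQ : ∀ i, ProjInst r ((G i).inst 0 γ) (U.inst σ) := fun i => by
      refine .sub (.inst (h i) (hG.2.2.2 i) hγ hσ hγσ) hU (hm.subtype ?_ hσ
        (Multiset.mem_map_of_mem T (Finset.mem_univ_val i)))
      rintro _ hT
      obtain ⟨j, -, rfl⟩ := Multiset.mem_map.1 hT
      exact (h j).wellFormed (hG.2.2.2 j)
    exact .other unfolds_comm hG.1 hp hq hG.2.1 hQ fun ha i => (hQ i).reaches ha
  | @mu G T hc h ih =>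
    have hself := ProjInst.inst (.mu hc h) hG hγ hσ hγσ
    have hs := hself.isSessionType
    have key := ih (γ := scons ((GType.mu G).inst 0 γ) γ) (σ := scons ((SType.mu T).inst σ) σ)
      hG.2 (isGlobalType_scons (isGlobalType_inst hγ hG) hγ)
      (fun t => by cases t with
        | zero => exact hs
        | succ t => exact hσ t)
      (fun t => by cases t with
        | zero => exact hself
        | succ t => exact hγσ t)
      (fun t ht => by cases t with
        | zero => exact (hG.1 ht).elim
        | succ t => exact hu t ht)
    have e : T.inst (scons ((SType.mu T).inst σ) σ) =
        (T.inst (SType.up σ)).subst 0 (.mu (T.inst (SType.up σ))) :=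
      (SType.inst_up_subst _ _ _).symm
    have key' := key.sub hs (by rw [e]; exact hs.mu_subtype_unfold)
    rw [← unfold_inst fun t => (hγ t).1] at key'
    cases key' with
    | done h₁ h₂ => exact .done (.mu h₁) h₂
    | send h₁ h₂ h₃ h₄ => exact .send (.mu h₁) h₂ h₃ h₄
    | recv h₁ h₂ h₃ h₄ h₅ => exact .recv (.mu h₁) h₂ h₃ h₄ h₅
    | other h₁ h₂ h₃ h₄ h₅ h₆ h₇ => exact .other (.mu h₁) h₂ h₃ h₄ h₅ h₆ h₇
  | mu_end hr hc =>
    rw [inst_closed hc]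
    exact .dead ⟨hc, hG⟩ hr
  | var t => exact hu t rfl
  | done => exact .done unfolds_done SType.unfolds_done

theorem ProjInst.projRule {r : Participant} {G : GType} {V : SType} (h : ProjInst r G V) :
    ProjRule r (ProjInst r) G V := by
  induction h with
  | inst h hG hγ hσ hγσ ih => exact h.projRule hG hγ hσ hγσ fun t _ => ih t
  | dead hG hr => exact .dead hG hr
  | sub _ hV hs ih => exact ih.sub hV hs

theorem ProjInst.coProj {r : Participant} {G : GType} {V : SType} (h : ProjInst r G V) :
    CoProj r G V := ⟨ProjInst r, fun _ _ => ProjInst.projRule, h⟩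

theorem Proj.coProj {r : Participant} {G : GType} {T : SType} (h : Proj r G T)
    (hG : G.IsGlobalType) (hT : T.ClosedAt 0) : CoProj r G T := by
  have := (ProjInst.inst h hG.2 (γ := fun _ => .done) (σ := fun _ => .done)
    (fun _ => isGlobalType_done) (fun _ => SType.isSessionType_done)
    fun _ => .dead isGlobalType_done id).coProj
  rwa [inst_closed hG.1, SType.inst_closed hT] at this

theorem coProj_of_not_mem {r : Participant} {G : GType} (hG : G.IsGlobalType)
    (hr : r ∉ G.participants) : CoProj r G .done := (ProjInst.dead hG hr).coProj

/-- The communication that two projections are ready for can be removed from the global type,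
wherever it is. -/
theorem CoProj.exists_comm {G : GType} {p q : Participant} {m k : ℕ} {ℓ : Fin m → Label}
    {S : Fin m → Srt} {T : Fin m → SType} {ℓ' : Fin k → Label} {S' : Fin k → Srt}
    {T' : Fin k → SType} {V W : SType} (hG : Reaches p G) (hp : CoProj p G V)
    (hV : V.Unfolds (.out q m ℓ S T)) (hq : CoProj q G W) (hW : W.Unfolds (.inp p k ℓ' S' T'))
    (j : Fin m) :
    Function.Injective ℓ' ∧ ∃ i, ℓ j = ℓ' i ∧ Srt.Sub (S j) (S' i) ∧ ∃ H : GType,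
      CoProj p H (T j) ∧ CoProj q H (T' i) ∧
      ∀ r X, r ≠ p → r ≠ q → CoProj r G X → CoProj r H X := by
  -- the communication is at the root as soon as `p` takes part there
  have here : ∀ {G a b n} {ℓ₀ : Fin n → Label} {S₀ : Fin n → Srt} {G' : Fin n → GType},
      G.Unfolds (.comm a b n ℓ₀ S₀ G') → p = a ∨ p = b → CoProj p G V → CoProj q G W →
      Function.Injective ℓ' ∧ ∃ i, ℓ j = ℓ' i ∧ Srt.Sub (S j) (S' i) ∧ ∃ H : GType,
        CoProj p H (T j) ∧ CoProj q H (T' i) ∧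
        ∀ r X, r ≠ p → r ≠ q → CoProj r G X → CoProj r H X := by
    intro G a b n ℓ₀ S₀ G' h hab hp hq
    cases hp.rule with
    | done h₁ => cases h.det h₁
    | recv _ _ h₁ => cases hV.det h₁
    | other h₁ _ hpa hpb =>
      cases h.det h₁
      exact (hab.elim hpa hpb).elim
    | send h₁ hpq h₂ hc =>
      cases h.det h₁
      cases hV.det h₂
      cases hq.rule with
      | done h₃ => cases h.det h₃
      | send h₃ _ _ => cases h.det h₃; exact (hpq rfl).elim
      | other h₃ _ _ h₄ => cases h.det h₃; exact (h₄ rfl).elim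
      | recv h₃ _ h₄ hinj hc' =>
        cases h.det h₃
        cases hW.det h₄
        obtain ⟨i₀, hi₀, hS, hT⟩ := hc j
        obtain ⟨i, hi, hS', hT'⟩ := hc' i₀
        refine ⟨hinj, i, hi₀.trans hi, hS.trans hS', G' i₀, hT, hT', fun r X hrp hrq hr => ?_⟩
        cases hr.rule with
        | done h₅ => cases h.det h₅
        | send h₅ => cases h.det h₅; exact (hrp rfl).elim
        | recv h₅ => cases h.det h₅; exact (hrq rfl).elim
        | other h₅ _ _ _ _ hh => cases h.det h₅; exact hh i₀
  induction hG with
  | here h hab => exact here h hab hp hq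
  | @there G a b n ℓ₀ S₀ G' h _ ih =>
    by_cases hab : p = a ∨ p = b
    · exact here h hab hp hq
    rw [not_or] at hab
    cases hp.rule with
    | done h₁ => cases h.det h₁
    | send h₁ => cases h.det h₁; exact (hab.1 rfl).elim
    | recv h₁ => cases h.det h₁; exact (hab.2 rfl).elim
    | other h₁ hne _ _ hn hp' =>
      cases h.det h₁
      cases hq.rule with
      | done h₂ => cases h.det h₂
      | send _ _ h₂ => cases hW.det h₂
      | recv h₂ _ h₃ =>
        cases h.det h₂
        cases hW.det h₃
        exact (hab.1 rfl).elim
      | other h₂ _ hqa hqb _ hq' =>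
        cases h.det h₂
        have ih' := fun i => ih i (hp' i) (hq' i)
        obtain ⟨hinj, i, hi, hS, -⟩ := ih' ⟨0, hn⟩
        -- the receiver's labels are distinct, so all branches select the same one
        have hH : ∀ b, ∃ H : GType, CoProj p H (T j) ∧ CoProj q H (T' i) ∧
            ∀ r X, r ≠ p → r ≠ q → CoProj r (G' b) X → CoProj r H X := by
          intro b
          obtain ⟨-, i', hi', -, hH⟩ := ih' b
          cases hinj (hi'.symm.trans hi)
          exact hH
        choose H h₁ h₂ h₃ using hH
        refine ⟨hinj, i, hi, hS, .comm a b n ℓ₀ S₀ H, ?_, ?_, fun r X hrp hrq hr => ?_⟩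
        · exact .fold (.other unfolds_comm hne hab.1 hab.2 hn h₁ fun ha b => (h₁ b).reaches ha)
        · exact .fold (.other unfolds_comm hne hqa hqb hn h₂ fun ha b => (h₂ b).reaches ha)
        · refine .fold ?_
          cases hr.rule with
          | done h₅ => cases h.det h₅
          | send h₅ h₆ h₇ hc =>
            cases h.det h₅
            refine .send unfolds_comm h₆ h₇ fun j => ?_
            obtain ⟨i, hi, hS, hT⟩ := hc j
            exact ⟨i, hi, hS, h₃ i _ _ hrp hrq hT⟩
          | recv h₅ h₆ h₇ h₈ hc =>
            cases h.det h₅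
            refine .recv unfolds_comm h₆ h₇ h₈ fun i => ?_
            obtain ⟨j, hi, hS, hT⟩ := hc i
            exact ⟨j, hi, hS, h₃ i _ _ hrp hrq hT⟩
          | other h₅ h₆ h₇ h₈ _ hh =>
            cases h.det h₅
            have hr' := fun b => h₃ b r _ hrp hrq (hh b)
            exact .other unfolds_comm h₆ h₇ h₈ hn hr' fun ha b => (hr' b).reaches ha

end GType
/-! ### Well-typed sessions do not get stuck -/

namespace Proc

theorem Head.structEq {P H : Proc} (h : Head P {H}) : StructEq P H := by
  generalize ha : ({H} : Multiset Proc) = a at h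
  obtain ⟨n, h⟩ := h
  induction h with
  | head h => rw [Multiset.singleton_inj.1 ha]; exact .refl _
  | @sum n P Q a b h₁ h₂ =>
    have h₁ := h₁.card_pos
    have h₂ := h₂.card_pos
    have := congrArg Multiset.card ha
    rw [Multiset.card_singleton, Multiset.card_add] at this
    omega
  | mu _ ih => exact (StructEq.unfold _).trans (ih ha)

/-- A process all of whose summands are inputs from `q` is congruent to a sum of inputs. -/
theorem Head.inSum {q : Participant} {P : Proc} {a : Multiset Proc} (h : Head P a)
    (ha : ∀ H ∈ a, ∃ ℓ P', H = .inp q ℓ P') :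
    ∃ P₀ bs, StructEq P P₀ ∧ InSum q P₀ bs ∧
      a = ((bs.map fun b => Proc.inp q b.1 b.2 : List Proc) : Multiset Proc) := by
  obtain ⟨n, h⟩ := h
  induction h with
  | @head n P =>
    obtain ⟨ℓ, P', rfl⟩ := ha P (by simp)
    exact ⟨_, _, .refl _, .inp ℓ P', rfl⟩
  | sum _ _ ih₁ ih₂ =>
    obtain ⟨P₀, bs, hP, hb, rfl⟩ := ih₁ fun H hH => ha H (Multiset.mem_add.2 (.inl hH))
    obtain ⟨Q₀, cs, hQ, hc, rfl⟩ := ih₂ fun H hH => ha H (Multiset.mem_add.2 (.inr hH))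
    exact ⟨_, _, .sum hP hQ, .sum hb hc, by rw [List.map_append, ← Multiset.coe_add]⟩
  | mu _ ih =>
    obtain ⟨P₀, bs, hP, h⟩ := ih ha
    exact ⟨P₀, bs, (StructEq.unfold _).trans hP, h⟩

theorem Sem.nil {V : SType} (h : Sem .nil V) : V.Unfolds .done := by
  cases h.rule with
  | nil _ h => exact h
  | out _ h => cases Multiset.singleton_inj.1 (h.det .nil)
  | ite h => cases Multiset.singleton_inj.1 (h.det .nil)
  | inp bs h =>
    have h' := h.det .nil
    obtain ⟨b, -, hb⟩ := Multiset.map_eq_singleton.1 h'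
    cases hb

theorem Sem.out {p : Participant} {ℓ : Label} {e : Expr} {P : Proc} {V : SType}
    (h : Sem (.out p ℓ e P) V) : ∃ n ℓ' S T, V.Unfolds (.out p n ℓ' S T) ∧
      ∃ j, ℓ = ℓ' j ∧ Expr.HasSort [] e (S j) ∧ Sem P (T j) := by
  cases h.rule with
  | nil h => cases Multiset.singleton_inj.1 (h.det .out)
  | out j h h₁ h₂ h₃ h₄ =>
    cases Multiset.singleton_inj.1 (h.det .out)
    exact ⟨_, _, _, _, h₁, j, h₂, h₃, h₄⟩
  | ite h => cases Multiset.singleton_inj.1 (h.det .out)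
  | inp bs h =>
    have h' := h.det .out
    obtain ⟨b, -, hb⟩ := Multiset.map_eq_singleton.1 h'
    cases hb

theorem Sem.ite {e : Expr} {P Q : Proc} {V : SType} (h : Sem (.ite e P Q) V) :
    Sem P V ∧ Sem Q V := by
  cases h.rule with
  | nil h => cases Multiset.singleton_inj.1 (h.det .ite)
  | out j h => cases Multiset.singleton_inj.1 (h.det .ite)
  | ite h _ h₁ h₂ => cases Multiset.singleton_inj.1 (h.det .ite); exact ⟨h₁, h₂⟩
  | inp bs h =>
    have h' := h.det .ite
    obtain ⟨b, -, hb⟩ := Multiset.map_eq_singleton.1 h'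
    cases hb

theorem Sem.inSum {q : Participant} {P : Proc} {bs : List (Label × Proc)} {V : SType}
    (h : Sem P V) (hP : InSum q P bs) : ∃ n ℓ S T, V.Unfolds (.inp q n ℓ S T) ∧
      ∀ j, ∀ b ∈ bs, b.1 = ℓ j → ∀ v : Value, v.Is (S j) → Sem (b.2.substVal 0 v) (T j) := by
  obtain ⟨b₀, hb₀⟩ := List.exists_mem_of_ne_nil bs hP.ne_nil
  have mem : ∀ {b a}, b ∈ bs → Head P a → Proc.inp q b.1 b.2 ∈ a := by
    intro b a hb ha
    rw [ha.det hP.head]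
    exact Multiset.mem_coe.2 (List.mem_map.2 ⟨b, hb, rfl⟩)
  cases h.rule with
  | nil h => cases Multiset.mem_singleton.1 (mem hb₀ h)
  | out j h => cases Multiset.mem_singleton.1 (mem hb₀ h)
  | ite h => cases Multiset.mem_singleton.1 (mem hb₀ h)
  | inp cs h h₁ h₂ h₃ =>
    obtain ⟨c, -, hc⟩ := Multiset.mem_map.1 (mem hb₀ h)
    obtain ⟨rfl, -⟩ := Proc.inp.inj hc
    refine ⟨_, _, _, _, h₁, fun j b hb hj v hv => ?_⟩
    obtain ⟨c, hc, hcb⟩ := Multiset.mem_map.1 (mem hb h)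
    obtain ⟨ℓ, P'⟩ := b
    obtain ⟨ℓ', Q'⟩ := c
    cases hcb
    exact h₃ j _ hc hj v hv

end Proc

/-- Semantic typing of configurations: the components belong to different participants and have
the types that a common global type prescribes. -/
def Config.Safe (m : Config) : Prop :=
  (m.map Prod.fst).Nodup ∧ ∃ (G : GType) (V : Participant → SType),
    (∀ r, GType.CoProj r G (V r)) ∧ (∀ r P, (r, Proc.cls P) ∈ m → P.Sem (V r)) ∧
    (∀ r, r ∉ m.map Prod.fst → (V r).Unfolds .done) ∧ ∀ c ∈ m, c.2 ≠ Proc.cls .nil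

theorem Proc.Sem.of_mem_atom {p r : Participant} {P Q : Proc} {V : SType} (h : P.Sem V)
    (hQ : (r, Q.cls) ∈ Config.atom p P) : r = p ∧ Q.Sem V := by
  obtain ⟨-, h'⟩ := Config.mem_atom.1 hQ
  obtain ⟨rfl, e⟩ := Prod.mk.inj h'
  exact ⟨rfl, h.congr (Proc.cls_eq_iff.1 e.symm)⟩

theorem Config.map_fst_atom (p : Participant) (P : Proc) :
    (Config.atom p P).map Prod.fst = 0 ∨ (Config.atom p P).map Prod.fst = {p} := by
  by_cases h : P.cls = Proc.cls .nil
  · simp [Config.atom_of_eq h]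
  · simp [Config.atom_of_ne h]

theorem Proc.Sem.done_of_not_mem {p : Participant} {P : Proc} {V : SType} (h : P.Sem V)
    (hp : p ∉ (Config.atom p P).map Prod.fst) : V.Unfolds .done := by
  by_cases hP : P.cls = Proc.cls .nil
  · exact (h.congr (Proc.cls_eq_iff.1 hP)).nil
  · simp [Config.atom_of_ne hP] at hp

theorem Config.nodup_cons_of_atom {p : Participant} {P : Proc} {s t : Config} {c : Proc.Class}
    (h : (((p, c) ::ₘ s).map Prod.fst).Nodup) (ht : t.map Prod.fst ≤ s.map Prod.fst) :
    ((Config.atom p P + t).map Prod.fst).Nodup := by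
  refine Multiset.nodup_of_le ?_ h
  rw [Multiset.map_add, Multiset.map_cons]
  rcases Config.map_fst_atom p P with e | e <;> rw [e]
  · rw [zero_add]; exact ht.trans (Multiset.le_cons_self _ _)
  · rw [Multiset.singleton_add]; exact (Multiset.cons_le_cons_iff _).2 ht

/-- Subject reduction. -/
theorem Config.Safe.step {m m' : Config} (h : m.Safe) (hs : Config.Step m m') : m'.Safe := by
  obtain ⟨hn, G, V, hG, hV, hd, hne⟩ := h
  cases hs with
  | @comm p q P P' Q bs ℓ e v s hP hb he =>
    have hn' : p ≠ q ∧ p ∉ s.map Prod.fst ∧ q ∉ s.map Prod.fst := by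
      simp only [Multiset.map_cons, Multiset.nodup_cons, Multiset.mem_cons, not_or] at hn
      exact ⟨hn.1.1, hn.1.2, hn.2.1⟩
    obtain ⟨k, ℓ', S', T', hVp, hT'⟩ := (hV p P (by simp)).inSum hP
    obtain ⟨n, ℓ₁, S, T, hVq, j, rfl, hS, hT⟩ := (hV q (.out p ℓ e Q) (by simp)).out
    obtain ⟨-, i, hi, hSS, H, hHq, hHp, hH⟩ := GType.CoProj.exists_comm
      ((hG q).reaches (.inr ⟨_, _, _, _, _, hVq⟩)) (hG q) hVq (hG p) hVp j
    have hPp := hT' i _ hb hi v ((hS.eval.2 v he).sub hSS)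
    have hmem : ∀ r, r ∉ Multiset.map Prod.fst (Config.atom p (P'.substVal 0 v) +
        Config.atom q Q + s) → r ∉ (Config.atom p (P'.substVal 0 v)).map Prod.fst ∧
        r ∉ (Config.atom q Q).map Prod.fst ∧ r ∉ s.map Prod.fst := by
      intro r hr
      rw [Multiset.map_add, Multiset.map_add, Multiset.mem_add, Multiset.mem_add, not_or,
        not_or] at hr
      exact ⟨hr.1.1, hr.1.2, hr.2⟩
    refine ⟨?_, H, Function.update (Function.update V q (T j)) p (T' i), fun r => ?_,
      fun r R hR => ?_, fun r hr => ?_, fun c hc => ?_⟩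
    · rw [add_assoc]
      refine Config.nodup_cons_of_atom hn ?_
      rw [Multiset.map_add, Multiset.map_cons]
      rcases Config.map_fst_atom q Q with e | e <;> rw [e]
      · rw [zero_add]; exact Multiset.le_cons_self _ _
      · rw [Multiset.singleton_add]
    · by_cases hrp : r = p
      · subst hrp; rwa [Function.update_self]
      rw [Function.update_of_ne hrp]
      by_cases hrq : r = q
      · subst hrq; rwa [Function.update_self]
      rw [Function.update_of_ne hrq]
      exact hH r _ hrq hrp (hG r)
    · rcases Multiset.mem_add.1 hR with hR | hR
      · rcases Multiset.mem_add.1 hR with hR | hR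
        · obtain ⟨rfl, h⟩ := hPp.of_mem_atom hR
          rwa [Function.update_self]
        · obtain ⟨rfl, h⟩ := hT.of_mem_atom hR
          rwa [Function.update_of_ne hn'.1.symm, Function.update_self]
      · have hr : r ∈ s.map Prod.fst := Multiset.mem_map_of_mem Prod.fst hR
        rw [Function.update_of_ne (by rintro rfl; exact hn'.2.1 hr),
          Function.update_of_ne (by rintro rfl; exact hn'.2.2 hr)]
        exact hV r R (by simp [hR])
    · obtain ⟨h₁, h₂, h₃⟩ := hmem r hr
      by_cases hrp : r = p
      · subst hrp
        rw [Function.update_self]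
        exact hPp.done_of_not_mem h₁
      rw [Function.update_of_ne hrp]
      by_cases hrq : r = q
      · subst hrq
        rw [Function.update_self]
        exact hT.done_of_not_mem h₂
      rw [Function.update_of_ne hrq]
      refine hd r ?_
      rw [Multiset.map_cons, Multiset.map_cons, Multiset.mem_cons, Multiset.mem_cons]
      simp only [not_or]
      exact ⟨hrp, hrq, h₃⟩
    · rcases Multiset.mem_add.1 hc with hc | hc
      · rcases Multiset.mem_add.1 hc with hc | hc <;>
        · obtain ⟨h, rfl⟩ := Config.mem_atom.1 hc
          exact h
      · exact hne c (by simp [hc])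
  | @ite p e b P Q s he =>
    have hp : p ∉ s.map Prod.fst := by
      rw [Multiset.map_cons, Multiset.nodup_cons] at hn
      exact hn.1
    have hPQ := (hV p (.ite e P Q) (by simp)).ite
    have hR : Proc.Sem (if b then P else Q) (V p) := by
      cases b
      · exact hPQ.2
      · exact hPQ.1
    refine ⟨Config.nodup_cons_of_atom hn le_rfl, G, V, hG, fun r R hR' => ?_, fun r hr => ?_,
      fun c hc => ?_⟩
    · rcases Multiset.mem_add.1 hR' with h | h
      · obtain ⟨rfl, h⟩ := hR.of_mem_atom h
        exact h
      · exact hV r R (by simp [h])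
    · rw [Multiset.map_add, Multiset.mem_add, not_or] at hr
      by_cases hrp : r = p
      · subst hrp
        exact hR.done_of_not_mem hr.1
      · refine hd r ?_
        rw [Multiset.map_cons, Multiset.mem_cons]
        simp only [not_or]
        exact ⟨hrp, hr.2⟩
    · rcases Multiset.mem_add.1 hc with hc | hc
      · obtain ⟨h, rfl⟩ := Config.mem_atom.1 hc
        exact h
      · exact hne c (by simp [hc])

/-- Progress. -/
theorem Config.Safe.not_stuck {m : Config} (h : m.Safe) : ¬ m.Stuck := by
  rintro ⟨h0, hs⟩
  obtain ⟨hn, G, V, hG, hV, hd, hne⟩ := h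
  -- a component that is ready to evaluate a conditional can do so
  have no_ite : ∀ {r P e A B}, (r, Proc.cls P) ∈ m → Proc.Head P {.ite e A B} →
      Expr.HasSort [] e .bool → False := by
    intro r P e A B hr hP he
    obtain ⟨⟨v, hv⟩, hv'⟩ := he.eval
    obtain ⟨b, rfl⟩ := (hv' v hv).bool
    obtain ⟨s, rfl⟩ := Multiset.exists_cons_of_mem hr
    rw [Proc.cls_eq_iff.2 hP.structEq] at hs
    exact hs _ (.ite A B s hv)
  have mem : ∀ {r}, (V r).Acts → ∃ P, (r, Proc.cls P) ∈ m := by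
    intro r hr
    by_contra h
    refine hr.not_done (hd r fun hr' => h ?_)
    obtain ⟨⟨r', c⟩, hc, rfl⟩ := Multiset.mem_map.1 hr'
    obtain ⟨P, rfl⟩ := Quotient.exists_rep c
    exact ⟨P, hc⟩
  have hroot : G.Unfolds .done ∨ ∃ p q n ℓ S G', G.Unfolds (.comm p q n ℓ S G') ∧ p ≠ q := by
    cases (hG 0).rule with
    | done h => exact .inl h
    | send h h' => exact .inr ⟨_, _, _, _, _, _, h, h'⟩
    | recv h h' => exact .inr ⟨_, _, _, _, _, _, h, h'⟩
    | other h h' => exact .inr ⟨_, _, _, _, _, _, h, h'⟩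
  rcases hroot with hend | ⟨p, q, n, ℓ, S, G', hcomm, hpq⟩
  · obtain ⟨⟨r, c⟩, hc⟩ := Multiset.exists_mem_of_ne_zero h0
    obtain ⟨P, rfl⟩ := Quotient.exists_rep c
    have hVr : (V r).Unfolds .done := by
      cases (hG r).rule with
      | done _ h => exact h
      | send h => cases hend.det h
      | recv h => cases hend.det h
      | other h => cases hend.det h
    cases (hV r P hc).rule with
    | nil h => exact hne _ hc (Proc.cls_eq_iff.2 h.structEq)
    | out _ _ h => cases hVr.det h
    | ite h h' => exact no_ite hc h h'
    | inp _ _ h => cases hVr.det h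
  · cases (hG p).rule with
    | done h => cases hcomm.det h
    | recv h => cases hcomm.det h; exact hpq rfl
    | other h _ h' => cases hcomm.det h; exact h' rfl
    | send h _ hVp hc =>
      cases hcomm.det h
      cases (hG q).rule with
      | done h => cases hcomm.det h
      | send h => cases hcomm.det h; exact hpq rfl
      | other h _ _ h' => cases hcomm.det h; exact h' rfl
      | recv h _ hVq _ hc' =>
        cases hcomm.det h
        obtain ⟨P, hP⟩ := mem (.inr ⟨_, _, _, _, _, hVp⟩)
        obtain ⟨Q, hQ⟩ := mem (.inl ⟨_, _, _, _, _, hVq⟩)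
        cases (hV p P hP).rule with
        | nil _ h => cases hVp.det h
        | inp _ _ h => cases hVp.det h
        | ite h h' => exact no_ite hP h h'
        | @out q' ℓ₁ e P' _ _ _ _ j hPh h hj he _ =>
          cases hVp.det h
          cases (hV q Q hQ).rule with
          | nil _ h => cases hVq.det h
          | out _ _ h => cases hVq.det h
          | ite h h' => exact no_ite hQ h h'
          | inp bs hQh h hbs _ =>
            cases hVq.det h
            obtain ⟨i, hi, -⟩ := hc j
            obtain ⟨k, hk, -⟩ := hc' i
            obtain ⟨⟨ℓ₂, R⟩, hb, hbk⟩ := hbs k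
            obtain ⟨Q₀, cs, hQQ, hcs, hbc⟩ := hQh.inSum (fun H hH => by
              obtain ⟨b, -, rfl⟩ := Multiset.mem_map.1 hH
              exact ⟨_, _, rfl⟩)
            obtain ⟨⟨v, hv⟩, -⟩ := he.eval
            have hmem : (ℓ₂, R) ∈ cs := by
              have : Proc.inp p ℓ₂ R ∈ bs.map fun b => Proc.inp p b.1 b.2 :=
                Multiset.mem_map.2 ⟨_, hb, rfl⟩
              rw [hbc, Multiset.mem_coe] at this
              obtain ⟨⟨ℓ₃, R'⟩, hb', e⟩ := List.mem_map.1 this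
              cases e
              exact hb'
            have hℓ : ℓ₂ = ℓ₁ := hbk.trans (hk.symm.trans (hi.symm.trans hj.symm))
            subst hℓ
            obtain ⟨s, rfl⟩ := Multiset.exists_cons_of_mem hQ
            obtain ⟨t, rfl⟩ := Multiset.exists_cons_of_mem
              ((Multiset.mem_cons.1 hP).resolve_left fun h => hpq (Prod.mk.inj h).1)
            rw [Proc.cls_eq_iff.2 hQQ, Proc.cls_eq_iff.2 hPh.structEq] at hs
            exact hs _ (.comm t hcs hmem hv)

theorem Config.Safe.not_getsStuck {m : Config} (h : m.Safe) : ¬ m.GetsStuck := by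
  rintro ⟨m', hm, hs⟩
  refine Config.Safe.not_stuck ?_ hs
  clear hs
  induction hm with
  | refl => exact h
  | tail _ hs ih => exact ih.step hs

theorem Session.mem_config {M : Session} {c : Participant × Proc.Class} :
    c ∈ M.config ↔ ∃ P, (c.1, P) ∈ M.components ∧ c.2 = Proc.cls P ∧ c.2 ≠ Proc.cls .nil := by
  induction M with
  | pa p P =>
    obtain ⟨r, c⟩ := c
    simp only [config, Config.mem_atom, components, List.mem_singleton, Prod.mk.injEq]
    constructor
    · rintro ⟨h, rfl, rfl⟩
      exact ⟨P, ⟨rfl, rfl⟩, rfl, h⟩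
    · rintro ⟨Q, ⟨rfl, rfl⟩, rfl, h⟩
      exact ⟨h, rfl, rfl⟩
  | par M N ih₁ ih₂ =>
    simp only [config, components, Multiset.mem_add, List.mem_append, ih₁, ih₂]
    constructor
    · rintro (⟨P, h, h'⟩ | ⟨P, h, h'⟩)
      · exact ⟨P, .inl h, h'⟩
      · exact ⟨P, .inr h, h'⟩
    · rintro ⟨P, h | h, h'⟩
      · exact .inl ⟨P, h, h'⟩
      · exact .inr ⟨P, h, h'⟩

theorem Session.map_fst_config_le (M : Session) :
    M.config.map Prod.fst ≤ (M.components.map Prod.fst : List Participant) := by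
  induction M with
  | pa p P =>
    rcases Config.map_fst_atom p P with h | h <;> simp [config, components, h]
  | par M N ih₁ ih₂ =>
    simp only [config, components, Multiset.map_add, List.map_append, ← Multiset.coe_add]
    exact add_le_add ih₁ ih₂

theorem Session.Guarded.components {M : Session} (h : M.Guarded) :
    ∀ c ∈ M.components, c.2.Guarded := by
  induction M with
  | pa p P => intro c hc; cases List.mem_singleton.1 hc; exact h
  | par M N ih₁ ih₂ =>
    intro c hc
    exact (List.mem_append.1 hc).elim (ih₁ h.1 c) (ih₂ h.2 c)

theorem Session.Typable.safe {M : Session} (h : M.Typable) (hM : M.Guarded) : M.config.Safe := by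
  obtain ⟨G, hG, hn, hT, hp⟩ := h
  have key : ∀ r, ∃ V, GType.CoProj r G V ∧ (∀ P, (r, P) ∈ M.components → P.Sem V) ∧
      (r ∉ M.components.map Prod.fst → V.Unfolds .done) := by
    intro r
    by_cases hr : r ∈ M.components.map Prod.fst
    · obtain ⟨⟨r, P⟩, hc, rfl⟩ := List.mem_map.1 hr
      obtain ⟨T, hpr, hty⟩ := hT _ hc
      refine ⟨T, hpr.coProj hG (hty.isSessionType (by simp)).1, fun Q hQ => ?_,
        fun h => (h hr).elim⟩
      cases List.inj_on_of_nodup_map hn hc hQ rfl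
      exact hty.sem (hM.components _ hc)
    · exact ⟨.done, GType.coProj_of_not_mem hG fun h => hr (hp r h),
        fun P hP => (hr (List.mem_map.2 ⟨_, hP, rfl⟩)).elim, fun _ => SType.unfolds_done⟩
  choose V h₁ h₂ h₃ using key
  refine ⟨Multiset.nodup_of_le M.map_fst_config_le (Multiset.coe_nodup.2 hn), G, V, h₁,
    fun r P hP => ?_, fun r hr => ?_, fun c hc => ?_⟩
  · obtain ⟨Q, hQ, hPQ, -⟩ := Session.mem_config.1 hP
    exact (h₂ r Q hQ).congr (Proc.cls_eq_iff.1 hPQ.symm)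
  · by_cases hr' : r ∈ M.components.map Prod.fst
    · obtain ⟨⟨r, P⟩, hc, rfl⟩ := List.mem_map.1 hr'
      by_cases hP : P.cls = Proc.cls .nil
      · exact ((h₂ _ P hc).congr (Proc.cls_eq_iff.1 hP)).nil
      · exact (hr (Multiset.mem_map.2 ⟨(r, P.cls), Session.mem_config.2 ⟨P, hc, rfl, hP⟩,
          rfl⟩)).elim
    · exact h₃ r hr'
  · obtain ⟨Q, -, -, h⟩ := Session.mem_config.1 hc
    exact h

/-- Well-typed sessions do not get stuck. -/
theorem Session.Typable.not_getsStuck {M : Session} (h : M.Typable) (hM : M.Guarded) :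
    ¬ M.GetsStuck := fun h' => (h.safe hM).not_getsStuck (Session.getsStuck_iff.1 h')

/-! ### Characteristic processes -/

/-- A value of the sort that belongs to no other sorts than its supersorts; for `int` this has to
be a negative number. -/
def Srt.value : Srt → Value
  | .nat => .num 0
  | .int => .num (-1)
  | .bool => .bool true

/-- An expression in the variable `0` that evaluates to a boolean exactly for the values of the
sort. -/
def Srt.check : Srt → Expr
  | .nat => .gt (.succ (.var 0)) (.val (.num 0))
  | .int => .gt (.neg (.var 0)) (.val (.num 0))
  | .bool => .not (.var 0)

/-- The expression `true ⊕ false`. -/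
def Expr.coin : Expr := .choice (.val (.bool true)) (.val (.bool false))

theorem Expr.coin_hasSort {Γ : List Srt} : Expr.HasSort Γ Expr.coin .bool :=
  .choice (.bool _) (.bool _)

theorem Expr.coin_eval (b : Bool) : Expr.Eval Expr.coin (.bool b) := by
  cases b
  · exact .choice_right (.val _)
  · exact .choice_left (.val _)

theorem Srt.value_is (S : Srt) : S.value.Is S := by
  cases S
  · exact le_refl (0 : ℤ)
  · trivial
  · trivial

theorem Srt.check_hasSort {Γ : List Srt} (S : Srt) : Expr.HasSort (S :: Γ) S.check .bool := by
  cases S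
  · exact .gt (.sub (.succ (.var _ _ rfl)) .nat_int) (.int _)
  · exact .gt (.neg (.var _ _ rfl)) (.int _)
  · exact .not (.var _ _ rfl)

theorem Srt.check_inst (S : Srt) (θ : ℕ → Expr) : S.check.inst (Expr.up θ) = S.check := by
  cases S <;> rfl

theorem Srt.check_ren (S : Srt) (ξ : ℕ → ℕ) : S.check.ren (liftRen ξ) = S.check := by
  cases S <;> rfl

theorem Srt.check_eval {S S' : Srt} (h : Srt.Sub S S') :
    ∃ b, Expr.Eval (S'.check.subst 0 S.value) (.bool b) := by
  have hs : Expr.HasSort [] (S'.check.subst 0 S.value) .bool := by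
    rw [Expr.subst_eq_inst]
    refine (S'.check_hasSort (Γ := [])).inst fun x U hx => ?_
    cases x with
    | zero => cases hx; exact (S.value_is.sub h).hasSort
    | succ x => simp at hx
  obtain ⟨⟨v, hv⟩, hv'⟩ := hs.eval
  obtain ⟨b, rfl⟩ := (hv' v hv).bool
  exact ⟨b, hv⟩

theorem Srt.check_not_eval {S S' : Srt} (h : ¬ Srt.Sub S S') (v : Value) :
    ¬ Expr.Eval (S'.check.subst 0 S.value) v := by
  intro hv
  cases S' with
  | nat =>
    cases hv with
    | gt h₁ h₂ =>
      cases h₁ with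
      | succ h₁ h0 =>
        cases S with
        | nat => exact h (.refl _)
        | int => cases h₁; norm_num at h0
        | bool => cases h₁
  | int =>
    cases hv with
    | gt h₁ h₂ =>
      cases h₁ with
      | neg h₁ =>
        cases S with
        | nat => exact h .nat_int
        | int => exact h (.refl _)
        | bool => cases h₁
  | bool =>
    cases hv with
    | not h₁ =>
      cases S with
      | nat => cases h₁
      | int => cases h₁
      | bool => exact h (.refl _)

namespace Proc

/-- The sum of the processes `P i`. -/
def sumFin : (n : ℕ) → (Fin n → Proc) → Proc
  | 0, _ => .nil
  | 1, P => P 0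
  | n + 2, P => .sum (sumFin (n + 1) fun i => P i.castSucc) (P (Fin.last (n + 1)))

/-- A nondeterministic choice among the processes `P i`, by means of conditionals. -/
def anyFin : (n : ℕ) → (Fin n → Proc) → Proc
  | 0, _ => .nil
  | 1, P => P 0
  | n + 2, P => .ite Expr.coin (anyFin (n + 1) fun i => P i.castSucc) (P (Fin.last (n + 1)))

theorem sumFin_ren (n : ℕ) (P : Fin n → Proc) (ξ ζ : ℕ → ℕ) :
    (sumFin n P).ren ξ ζ = sumFin n fun i => (P i).ren ξ ζ := by
  induction n, P using sumFin.induct with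
  | case1 => rfl
  | case2 => rfl
  | case3 n P ih => simp only [sumFin, ren, ih]

theorem sumFin_inst (n : ℕ) (P : Fin n → Proc) (θ : ℕ → Expr) (σ : ℕ → Proc) :
    (sumFin n P).inst θ σ = sumFin n fun i => (P i).inst θ σ := by
  induction n, P using sumFin.induct with
  | case1 => rfl
  | case2 => rfl
  | case3 n P ih => simp only [sumFin, inst, ih]

theorem anyFin_ren (n : ℕ) (P : Fin n → Proc) (ξ ζ : ℕ → ℕ) :
    (anyFin n P).ren ξ ζ = anyFin n fun i => (P i).ren ξ ζ := by
  induction n, P using anyFin.induct with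
  | case1 => rfl
  | case2 => rfl
  | case3 n P ih => simp only [anyFin, ren, ih]; rfl

theorem anyFin_inst (n : ℕ) (P : Fin n → Proc) (θ : ℕ → Expr) (σ : ℕ → Proc) :
    (anyFin n P).inst θ σ = anyFin n fun i => (P i).inst θ σ := by
  induction n, P using anyFin.induct with
  | case1 => rfl
  | case2 => rfl
  | case3 n P ih => simp only [anyFin, inst, ih]; rfl

theorem sumFin_guarded {n : ℕ} {P : Fin n → Proc} (h : ∀ i, (P i).Guarded) :
    (sumFin n P).Guarded := by
  induction n, P using sumFin.induct with
  | case1 => trivial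
  | case2 => exact h 0
  | case3 n P ih => exact ⟨ih fun i => h _, h _⟩

theorem anyFin_guarded {n : ℕ} {P : Fin n → Proc} (h : ∀ i, (P i).Guarded) :
    (anyFin n P).Guarded := by
  induction n, P using anyFin.induct with
  | case1 => trivial
  | case2 => exact h 0
  | case3 n P ih => exact ⟨ih fun i => h _, h _⟩

theorem sumFin_not_unguarded {n : ℕ} {P : Fin n → Proc} {X : ℕ} (h : ∀ i, ¬ (P i).Unguarded X) :
    ¬ (sumFin n P).Unguarded X := by
  match n with
  | 0 => exact id
  | 1 => exact h 0
  | n + 2 => exact id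

theorem anyFin_not_unguarded {n : ℕ} {P : Fin n → Proc} {X : ℕ} (h : ∀ i, ¬ (P i).Unguarded X) :
    ¬ (anyFin n P).Unguarded X := by
  match n with
  | 0 => exact id
  | 1 => exact h 0
  | n + 2 => exact id

theorem sumFin_inSum {q : Participant} {n : ℕ} (hn : 0 < n) (ℓ : Fin n → Label)
    (P : Fin n → Proc) :
    InSum q (sumFin n fun i => .inp q (ℓ i) (P i)) (List.ofFn fun i => (ℓ i, P i)) := by
  induction n with
  | zero => omega
  | succ n ih =>
    cases n with
    | zero => exact .inp _ _
    | succ n =>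
      rw [List.ofFn_succ_last]
      exact .sum (ih (Nat.succ_pos n) _ _) (.inp _ _)

end Proc

theorem Fin.append_snoc {α : Type*} {n : ℕ} (f : Fin (n + 1) → α) :
    Fin.append (fun i : Fin n => f i.castSucc) (fun _ : Fin 1 => f (Fin.last n)) = f := by
  funext i
  refine Fin.addCases (m := n) (n := 1) (fun i => ?_) (fun i => ?_) i
  · rw [Fin.append_left]; rfl
  · rw [Fin.append_right, Subsingleton.elim i 0]; rfl

namespace Proc

theorem anyFin_hasType {Γ : List Srt} {Δ : List SType} {q : Participant} {n : ℕ} (hn : 0 < n)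
    {ℓ : Fin n → Label} (hℓ : Function.Injective ℓ) {S : Fin n → Srt} {T : Fin n → SType}
    {e : Fin n → Expr} {P : Fin n → Proc} (he : ∀ i, Expr.HasSort Γ (e i) (S i))
    (hP : ∀ i, HasType Γ Δ (P i) (T i)) :
    HasType Γ Δ (anyFin n fun i => .out q (ℓ i) (e i) (P i)) (.out q n ℓ S T) := by
  induction n with
  | zero => omega
  | succ n ih =>
    cases n with
    | zero =>
      have key : ∀ {α : Type} (f : Fin 1 → α), f = fun _ => f 0 := fun f => by
        funext i; rw [Subsingleton.elim i 0]
      rw [key ℓ, key S, key T]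
      exact .out (he 0) (hP 0)
    | succ n =>
      have h := ih (Nat.succ_pos n) (ℓ := fun i => ℓ i.castSucc)
        (hℓ.comp (Fin.castSucc_injective _)) (fun i => he i.castSucc)
        (fun i => hP i.castSucc)
      have := HasType.cond (Expr.coin_hasSort) h (.out (q := q)
        (ℓ := ℓ (Fin.last (n + 1))) (he (Fin.last (n + 1))) (hP (Fin.last (n + 1))))
        (.union SType.unfolds_out SType.unfolds_out fun i j hij =>
          (Fin.castSucc_lt_last i).ne (hℓ hij))
      rw [Fin.append_snoc ℓ, Fin.append_snoc S, Fin.append_snoc T] at this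
      exact this

end Proc

namespace SType

/-- The characteristic process of a session type. It offers all inputs and checks the sorts of
the received values; it may perform any of the outputs. -/
def char : SType → Proc
  | .inp p n ℓ S T =>
    Proc.sumFin n fun i => .inp p (ℓ i) (.ite (S i).check (T i).char (T i).char)
  | .out p n ℓ S T => Proc.anyFin n fun i => .out p (ℓ i) (.val (S i).value) (T i).char
  | .mu T => .mu T.char
  | .var t => .var t
  | .done => .nil

theorem char_ren (T : SType) (ζ : ℕ → ℕ) : (T.ren ζ).char = T.char.ren id ζ := by
  induction T generalizing ζ with
  | inp p n ℓ S T ih =>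
    simp only [ren, char, Proc.sumFin_ren, Proc.ren, ih]
    congr 1; funext i
    rw [Srt.check_ren, liftRen_id]
  | out p n ℓ S T ih => simp only [ren, char, Proc.anyFin_ren, Proc.ren, ih, Expr.ren]
  | mu T ih => simp only [ren, char, Proc.ren, ih]
  | var t => rfl
  | done => rfl

theorem char_inst_var (T : SType) (θ : ℕ → Expr) : T.char.inst θ Proc.var = T.char := by
  induction T generalizing θ with
  | inp p n ℓ S T ih =>
    simp only [char, Proc.sumFin_inst, Proc.inst, Srt.check_inst, Proc.shiftExpr, ih]
  | out p n ℓ S T ih => simp only [char, Proc.anyFin_inst, Proc.inst, ih, Expr.inst]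
  | mu T ih => simp only [char, Proc.inst, Proc.up_var, ih]
  | var t => rfl
  | done => rfl

theorem char_shiftExpr (T : SType) : T.char.shiftExpr 0 = T.char := by
  rw [Proc.shiftExpr_zero, Proc.ren_eq_inst]; exact T.char_inst_var _

theorem char_substVal (T : SType) (v : Value) : T.char.substVal 0 v = T.char := by
  rw [Proc.substVal_zero]; exact T.char_inst_var _

theorem char_inst (T : SType) (θ : ℕ → Expr) (σ : ℕ → SType) :
    T.char.inst θ (fun t => (σ t).char) = (T.inst σ).char := by
  induction T generalizing θ σ with
  | inp p n ℓ S T ih =>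
    simp only [inst, char, Proc.sumFin_inst, Proc.inst, Srt.check_inst, char_shiftExpr, ih]
  | out p n ℓ S T ih => simp only [inst, char, Proc.anyFin_inst, Proc.inst, ih, Expr.inst]
  | mu T ih =>
    simp only [inst, char, Proc.inst, ← ih θ]
    congr 2; funext t
    cases t with
    | zero => rfl
    | succ t => simp only [Proc.up, up, Proc.shiftProc_zero, shift_zero, char_ren]
  | var t => rfl
  | done => rfl

theorem char_unfold (T : SType) :
    T.char.substProc 0 (.mu T.char) = (T.subst 0 (.mu T)).char := by
  rw [Proc.substProc_zero, subst_zero, ← char_inst _ Expr.var]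
  congr 1; funext t; cases t <;> rfl

theorem Unfolds.char_cls {T U : SType} (h : T.Unfolds U) : T.char.cls = U.char.cls := by
  induction h with
  | root => rfl
  | mu _ ih => rw [char, Proc.cls_mu, char_unfold, ih]

theorem char_unguarded {T : SType} {t : ℕ} (h : T.char.Unguarded t) : T.Unguarded t := by
  induction T generalizing t with
  | inp p n ℓ S T ih => exact Proc.sumFin_not_unguarded (fun _ => id) h
  | out p n ℓ S T ih => exact Proc.anyFin_not_unguarded (fun _ => id) h
  | mu T ih => exact ih (t := t + 1) h
  | var s => exact h
  | done => exact h

theorem WellFormed.char_guarded {T : SType} (h : T.WellFormed) : T.char.Guarded := by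
  induction T with
  | inp p n ℓ S T ih => exact Proc.sumFin_guarded fun i => ⟨ih i (h.2.2 i), ih i (h.2.2 i)⟩
  | out p n ℓ S T ih => exact Proc.anyFin_guarded fun i => ih i (h.2.2 i)
  | mu T ih => exact ⟨fun h' => h.1 (char_unguarded h'), ih h.2⟩
  | var t => trivial
  | done => trivial

theorem char_hasType_inst {T : SType} {Γ : List Srt} {Δ : List SType} (hT : T.WellFormed)
    (hc : T.ClosedAt Δ.length) (hΔ : ∀ U ∈ Δ, U.IsSessionType) {σ : ℕ → SType}
    (hσ : ∀ t < Δ.length, Δ[t]? = some (σ t)) (hσ' : ∀ t, (σ t).IsSessionType) :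
    Proc.HasType Γ Δ T.char (T.inst σ) := by
  induction T generalizing Γ Δ σ with
  | inp p n ℓ S T ih =>
    refine .in_choice (Proc.sumFin_inSum hT.1 _ _) hT.2.1 fun i => ?_
    have h := fun Γ => ih i (Γ := Γ) (hT.2.2 i) (hc i) hΔ hσ hσ'
    exact .cond (S i).check_hasSort (h _) (h _)
      (.same (wellFormed_inst (hT.2.2 i) fun t => (hσ' t).2).treeEq_refl)
  | out p n ℓ S T ih =>
    exact Proc.anyFin_hasType hT.1 hT.2.1 (fun i => (S i).value_is.hasSort)
      fun i => ih i (hT.2.2 i) (hc i) hΔ hσ hσ'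
  | mu T ih =>
    have hs : ((SType.mu T).inst σ).IsSessionType :=
      ⟨inst_closedAt fun t => (hσ' t).1, wellFormed_inst hT fun t => (hσ' t).2⟩
    refine .recur hs (.sub (ih (σ := scons ((SType.mu T).inst σ) σ) hT.2 hc
      (by simpa using ⟨hs, hΔ⟩) (fun t ht => ?_) fun t => ?_) hs ?_)
    · cases t with
      | zero => rfl
      | succ t => exact hσ t (Nat.lt_of_succ_lt_succ ht)
    · cases t with
      | zero => exact hs
      | succ t => exact hσ' t
    · rw [← inst_up_subst]
      exact hs.unfold_subtype_mu
  | var t => exact .var (hσ t hc)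
  | done => exact .nil

theorem IsSessionType.char_hasType {T : SType} (h : T.IsSessionType) :
    Proc.HasType [] [] T.char T := by
  have := char_hasType_inst (Γ := []) (Δ := []) (σ := fun _ => .done) h.2 h.1 (by simp) (by simp)
    fun _ => isSessionType_done
  rwa [inst_closed h.1] at this

end SType
/-! ### Configurations indexed by participants -/

namespace Config

/-- The configuration in which each participant `r ≤ N` runs `f r`. -/
noncomputable def conf (N : ℕ) (f : Participant → Proc) : Config :=
  ∑ r ∈ Finset.range (N + 1), atom r (f r)

theorem conf_congr {N : ℕ} {f g : Participant → Proc} (h : ∀ r ≤ N, (f r).cls = (g r).cls) :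
    conf N f = conf N g :=
  Finset.sum_congr rfl fun r hr => atom_congr (h r (Nat.lt_succ_iff.1 (Finset.mem_range.1 hr)))

theorem conf_update {N : ℕ} {p : Participant} (hp : p ≤ N) (f : Participant → Proc) (P : Proc) :
    conf N (Function.update f p P) =
      atom p P + ∑ r ∈ (Finset.range (N + 1)).erase p, atom r (f r) := by
  rw [conf, ← Finset.add_sum_erase _ _ (Finset.mem_range.2 (Nat.lt_succ_iff.2 hp)),
    Function.update_self]
  congr 1
  refine Finset.sum_congr rfl fun r hr => ?_
  rw [Function.update_of_ne (Finset.ne_of_mem_erase hr)]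

theorem conf_update₂ {N : ℕ} {p q : Participant} (hp : p ≤ N) (hq : q ≤ N) (hpq : p ≠ q)
    (f : Participant → Proc) (P Q : Proc) :
    conf N (Function.update (Function.update f p P) q Q) =
      atom p P + atom q Q +
        ∑ r ∈ ((Finset.range (N + 1)).erase p).erase q, atom r (f r) := by
  rw [Function.update_comm hpq, conf_update hp, add_assoc]
  congr 1
  rw [← Finset.add_sum_erase _ _ (Finset.mem_erase.2
    ⟨hpq.symm, Finset.mem_range.2 (Nat.lt_succ_iff.2 hq)⟩), Function.update_self]
  congr 1
  refine Finset.sum_congr rfl fun r hr => ?_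
  rw [Function.update_of_ne (Finset.ne_of_mem_erase hr)]

theorem mem_conf {N : ℕ} {f : Participant → Proc} {c : Participant × Proc.Class} :
    c ∈ conf N f ↔ ∃ r ≤ N, (f r).cls ≠ Proc.cls .nil ∧ c = (r, (f r).cls) := by
  simp only [conf, Multiset.mem_sum, mem_atom, Finset.mem_range, Nat.lt_succ_iff]

theorem conf_step_ite {N : ℕ} {f : Participant → Proc} {p : Participant} (hp : p ≤ N) {e : Expr}
    {P Q : Proc} {b : Bool} (h : (f p).cls = Proc.cls (.ite e P Q)) (he : Expr.Eval e (.bool b)) :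
    Step (conf N f) (conf N (Function.update f p (if b then P else Q))) := by
  rw [conf_update hp]
  have : conf N f = conf N (Function.update f p (.ite e P Q)) := by
    refine conf_congr fun r _ => ?_
    rcases eq_or_ne r p with rfl | hr
    · rw [Function.update_self, h]
    · rw [Function.update_of_ne hr]
  rw [this, conf_update hp, atom_of_ne Proc.cls_ite_ne_nil, Multiset.singleton_add]
  exact .ite P Q _ he

theorem conf_step_comm {N : ℕ} {f : Participant → Proc} {p q : Participant} (hp : p ≤ N)
    (hq : q ≤ N) (hpq : p ≠ q) {P Pj Q : Proc} {bs : List (Label × Proc)} {ℓ : Label} {e : Expr}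
    {v : Value} (hP : (f p).cls = P.cls) (hQ : (f q).cls = Proc.cls (.out p ℓ e Q))
    (hbs : Proc.InSum q P bs) (hj : (ℓ, Pj) ∈ bs) (he : Expr.Eval e v) :
    Step (conf N f) (conf N (Function.update (Function.update f p (Pj.substVal 0 v)) q Q)) := by
  have : conf N f = conf N (Function.update (Function.update f p P) q (.out p ℓ e Q)) := by
    refine conf_congr fun r _ => ?_
    rcases eq_or_ne r q with rfl | hr
    · rw [Function.update_self, hQ]
    · rw [Function.update_of_ne hr]
      rcases eq_or_ne r p with rfl | hr
      · rw [Function.update_self, hP]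
      · rw [Function.update_of_ne hr]
  rw [this, conf_update₂ hp hq hpq, conf_update₂ hp hq hpq, atom_of_ne hbs.cls_ne_nil,
    atom_of_ne Proc.cls_out_ne_nil, add_assoc, Multiset.singleton_add, Multiset.singleton_add]
  exact .comm _ hbs hj he

theorem GetsStuck.of_steps {m m' : Config} (h : m'.GetsStuck)
    (hm : Relation.ReflTransGen Step m m') : m.GetsStuck := by
  obtain ⟨k, hk, hs⟩ := h
  exact ⟨k, hm.trans hk, hs⟩

end Config

namespace Proc

/-- `P.Picks Q`: resolving the conditionals at the root of `P` may yield `Q`. -/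
inductive Picks : Proc → Proc → Prop where
  | done {P Q : Proc} : P.cls = Q.cls → Picks P Q
  | ite {P A B Q : Proc} {e : Expr} (b : Bool) : P.cls = cls (.ite e A B) →
      Expr.Eval e (.bool b) → Picks (if b then A else B) Q → Picks P Q

theorem Picks.refl (P : Proc) : Picks P P := .done rfl

theorem Picks.of_cls {P P' Q : Proc} (h : P'.cls = P.cls) (hP : Picks P Q) : Picks P' Q := by
  cases hP with
  | done h' => exact .done (h.trans h')
  | ite b h' h₁ h₂ => exact .ite b (h.trans h') h₁ h₂

theorem picks_anyFin {n : ℕ} (P : Fin n → Proc) (i : Fin n) : Picks (anyFin n P) (P i) := by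
  induction n, P using anyFin.induct with
  | case1 => exact i.elim0
  | case2 P => rw [Subsingleton.elim i 0]; exact .refl _
  | case3 n P ih =>
    induction i using Fin.lastCases with
    | last => exact .ite false rfl (Expr.coin_eval _) (.refl _)
    | cast i => exact .ite true rfl (Expr.coin_eval _) (ih i)

end Proc

namespace Config

/-- Conditionals are resolved inside a configuration. -/
theorem conf_picks_update {N : ℕ} {p : Participant} (hp : p ≤ N) {P Q : Proc} (h : P.Picks Q)
    {f : Participant → Proc} (hf : (f p).cls = P.cls) :
    Relation.ReflTransGen Step (conf N f) (conf N (Function.update f p Q)) := by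
  induction h generalizing f with
  | done h =>
    rw [conf_congr (g := Function.update f p _)]
    intro r _
    rcases eq_or_ne r p with rfl | hr
    · rw [Function.update_self, hf, h]
    · rw [Function.update_of_ne hr]
  | @ite P A B Q e b h he _ ih =>
    have := ih (f := Function.update f p (if b then A else B)) (by rw [Function.update_self])
    rw [Function.update_idem] at this
    exact .head (conf_step_ite hp (hf.trans h) he) this

theorem conf_picks {N : ℕ} {f g : Participant → Proc} (h : ∀ r ≤ N, (f r).Picks (g r)) :
    Relation.ReflTransGen Step (conf N f) (conf N g) := by
  -- the participants below `k` have been treated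
  have key : ∀ k ≤ N + 1, Relation.ReflTransGen Step (conf N f)
      (conf N fun r => if r < k then g r else f r) := by
    intro k hk
    induction k with
    | zero => simp only [Nat.not_lt_zero, if_false]; exact .refl
    | succ k ih =>
      have hk' : k ≤ N := Nat.le_of_succ_le_succ hk
      refine (ih (by omega)).trans ?_
      have := conf_picks_update (N := N) (p := k) hk' (h k hk')
        (f := fun r => if r < k then g r else f r) (by simp)
      convert this using 2
      funext r
      rcases eq_or_ne r k with rfl | hr
      · simp
      · rw [Function.update_of_ne hr]
        simp only [show r < k + 1 ↔ r < k from
          ⟨fun h => lt_of_le_of_ne (Nat.le_of_lt_succ h) hr, Nat.lt_succ_of_lt⟩]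
  refine (key _ le_rfl).trans ?_
  rw [conf_congr (g := g)]
  intro r hr
  simp [Nat.lt_succ_iff.2 hr]

end Config

/-! ### Stuck configurations -/

namespace Proc

/-- The process cannot act on its own, its outputs are admitted by `snd`, and its inputs by
`rcv`. -/
structure Rest (snd rcv : Participant → Label → Prop) (P : Proc) : Prop where
  ite : ∀ {e A B}, P.cls = cls (.ite e A B) → ∀ b, ¬ Expr.Eval e (.bool b)
  out : ∀ {q ℓ e Q}, P.cls = cls (.out q ℓ e Q) → snd q ℓ
  inp : ∀ {q Q bs ℓ Q'}, P.cls = Q.cls → InSum q Q bs → (ℓ, Q') ∈ bs → rcv q ℓ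

theorem cls_eq_out {P Q : Proc} {p q : Participant} {ℓ ℓ' : Label} {e e' : Expr}
    (h : cls (.out p ℓ e P) = cls (.out q ℓ' e' Q)) : p = q ∧ ℓ = ℓ' ∧ e = e' ∧ P.cls = Q.cls := by
  obtain ⟨H, hH, hh⟩ := cls_eq_of_head h .out
  cases Multiset.singleton_inj.1 (hH.det .out)
  cases hh with
  | out _ _ _ h => exact ⟨rfl, rfl, rfl, cls_eq_iff.2 h⟩

theorem cls_eq_ite {e e' : Expr} {P Q P' Q' : Proc}
    (h : cls (.ite e P Q) = cls (.ite e' P' Q')) : e = e' := by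
  obtain ⟨H, hH, hh⟩ := cls_eq_of_head h .ite
  cases Multiset.singleton_inj.1 (hH.det .ite)
  cases hh
  rfl

theorem cls_out_ne_ite {p : Participant} {ℓ : Label} {e e' : Expr} {P A B : Proc} :
    cls (.out p ℓ e P) ≠ cls (.ite e' A B) := by
  intro h
  obtain ⟨H, hH, hh⟩ := cls_eq_of_head h .out
  cases Multiset.singleton_inj.1 (hH.det .ite)
  cases hh

/-- Congruent sums of inputs have the same partner and the same labels. -/
theorem InSum.rel {q q' : Participant} {P Q : Proc} {bs cs : List (Label × Proc)}
    (hP : InSum q P bs) (hQ : InSum q' Q cs) (h : P.cls = Q.cls) {b : Label × Proc}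
    (hb : b ∈ cs) : q' = q ∧ ∃ c ∈ bs, c.1 = b.1 := by
  obtain ⟨a, ha, hh⟩ := (cls_eq_iff.1 h.symm).head hQ.head
  cases ha.det hP.head
  obtain ⟨H, hH, hh'⟩ := Multiset.exists_mem_of_rel_of_mem hh
    (Multiset.mem_coe.2 (List.mem_map.2 ⟨b, hb, rfl⟩))
  obtain ⟨c, hc, rfl⟩ := List.mem_map.1 (Multiset.mem_coe.1 hH)
  generalize hℓ : c.1 = ℓ at hh'
  cases hh' with
  | inp _ _ _ => exact ⟨rfl, c, hc, hℓ⟩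

theorem InSum.cls_ne_of_head {q : Participant} {P H : Proc} {bs : List (Label × Proc)}
    (hP : InSum q P bs) (hH : Head H {H}) (hne : ∀ ℓ P', H ≠ .inp q ℓ P') : H.cls ≠ P.cls := by
  intro h
  obtain ⟨a, ha, hh⟩ := (cls_eq_iff.1 h.symm).head hP.head
  cases ha.det hH
  obtain ⟨b, hb⟩ := List.exists_mem_of_ne_nil bs hP.ne_nil
  obtain ⟨H', hH', hh'⟩ := Multiset.exists_mem_of_rel_of_mem hh
    (Multiset.mem_coe.2 (List.mem_map.2 ⟨b, hb, rfl⟩))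
  cases Multiset.mem_singleton.1 hH'
  cases hh' with
  | inp _ _ _ => exact hne _ _ rfl

theorem InSum.cls_ne_out {q : Participant} {P : Proc} {bs : List (Label × Proc)}
    (hP : InSum q P bs) {p ℓ e Q} : cls (.out p ℓ e Q) ≠ P.cls :=
  hP.cls_ne_of_head .out fun _ _ => nofun

theorem rest_nil {snd rcv} {P : Proc} (h : P.cls = cls .nil) : Rest snd rcv P where
  ite h' := absurd (h'.symm.trans h) cls_ite_ne_nil
  out h' := absurd (h'.symm.trans h) cls_out_ne_nil
  inp h' hs := absurd (h'.symm.trans h) hs.cls_ne_nil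

theorem rest_out {snd rcv : Participant → Label → Prop} {P Q : Proc} {q ℓ e}
    (h : P.cls = cls (.out q ℓ e Q)) (hs : snd q ℓ) : Rest snd rcv P where
  ite h' := absurd (h.symm.trans h') cls_out_ne_ite
  out h' := by
    obtain ⟨rfl, rfl, -, -⟩ := cls_eq_out (h.symm.trans h')
    exact hs
  inp h' hb := absurd (h.symm.trans h') hb.cls_ne_out

theorem rest_ite {snd rcv} {P A B : Proc} {e} (h : P.cls = cls (.ite e A B))
    (he : ∀ b, ¬ Expr.Eval e (.bool b)) : Rest snd rcv P where
  ite h' := by rw [← cls_eq_ite (h.symm.trans h')]; exact he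
  out h' := absurd (h'.symm.trans h) cls_out_ne_ite
  inp h' hb := absurd (h.symm.trans h') (hb.cls_ne_of_head .ite fun _ _ => nofun)

theorem rest_inSum {snd rcv : Participant → Label → Prop} {P Q : Proc} {q bs}
    (h : P.cls = Q.cls) (hQ : InSum q Q bs) (hr : ∀ b ∈ bs, rcv q b.1) : Rest snd rcv P where
  ite h' := absurd (h'.symm.trans h) (hQ.cls_ne_of_head .ite fun _ _ => nofun)
  out h' := absurd (h'.symm.trans h) hQ.cls_ne_out
  inp h' hb hm := by
    obtain ⟨rfl, c, hc, hl⟩ := hQ.rel hb (h.symm.trans h') hm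
    have := hr c hc
    rwa [hl] at this

end Proc

namespace Config

/-- A configuration gets stuck if its processes can be brought to rest so that no output meets a
matching input and not all processes have terminated. -/
theorem getsStuck_of_rest {N : ℕ} {f g : Participant → Proc}
    {snd rcv : Participant → Participant → Label → Prop}
    (hp : ∀ r ≤ N, (f r).Picks (g r)) (hr : ∀ r ≤ N, (g r).Rest (snd r) (rcv r))
    (hn : ∀ p ≤ N, ∀ q ≤ N, ∀ ℓ, snd q p ℓ → rcv p q ℓ → p = q)
    (hl : ∃ r ≤ N, (g r).cls ≠ Proc.cls .nil) : (conf N f).GetsStuck := by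
  refine GetsStuck.of_steps ⟨_, .refl, fun h0 => ?_, fun m' hm => ?_⟩ (conf_picks hp)
  · obtain ⟨r, hrN, hrd⟩ := hl
    have := mem_conf (N := N) (f := g) (c := (r, (g r).cls))|>.2
      ⟨r, hrN, hrd, rfl⟩
    rw [h0] at this
    exact Multiset.notMem_zero _ this
  · generalize hc : conf N g = c at hm
    cases hm with
    | @comm p q P Pj Q bs ℓ e v s h₁ h₂ h₃ =>
      obtain ⟨p', hpN, -, hp'⟩ := mem_conf.1 (show (p, P.cls) ∈ conf N g by simp [hc])
      obtain ⟨q', hqN, -, hq'⟩ := mem_conf.1 (show (q, Proc.cls (.out p ℓ e Q)) ∈ conf N g by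
        simp [hc])
      obtain ⟨rfl, hP⟩ := Prod.mk.inj hp'
      obtain ⟨rfl, hQ⟩ := Prod.mk.inj hq'
      obtain rfl := hn p hpN q hqN ℓ ((hr q hqN).out hQ.symm) ((hr p hpN).inp hP.symm h₁ h₂)
      -- one process is not both an input and an output
      exact h₁.cls_ne_out (hQ.trans hP.symm)
    | @ite p e b P Q s h =>
      obtain ⟨p', hpN, -, hp'⟩ := mem_conf.1 (show (p, Proc.cls (.ite e P Q)) ∈ conf N g by
        simp [hc])
      obtain ⟨rfl, hP⟩ := Prod.mk.inj hp'
      exact (hr p hpN).ite hP.symm b h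

end Config

/-! ### Reductions of characteristic processes -/

namespace SType

/-- The type may begin with the output of `ℓ` to `q`. -/
def Sends (T : SType) (q : Participant) (ℓ : Label) : Prop :=
  ∃ n ℓ' S T' i, T.Unfolds (.out q n ℓ' S T') ∧ ℓ' i = ℓ

/-- The type may begin with the input of `ℓ` from `q`. -/
def Recvs (T : SType) (q : Participant) (ℓ : Label) : Prop :=
  ∃ n ℓ' S T' i, T.Unfolds (.inp q n ℓ' S T') ∧ ℓ' i = ℓ

theorem Unfolds.picks_out {T : SType} {q : Participant} {n : ℕ} {ℓ : Fin n → Label}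
    {S : Fin n → Srt} {T' : Fin n → SType} (h : T.Unfolds (.out q n ℓ S T')) (i : Fin n) :
    T.char.Picks (.out q (ℓ i) (.val (S i).value) (T' i).char) :=
  .of_cls h.char_cls (Proc.picks_anyFin _ i)

/-- The characteristic process of a session type can be brought to rest. -/
theorem IsSessionType.settle {T : SType} (h : T.IsSessionType) :
    ∃ P, T.char.Picks P ∧ P.Rest T.Sends T.Recvs := by
  obtain ⟨U, hU⟩ := h.2.exists_unfolds
  cases U with
  | inp q n ℓ S T' =>
    have hi := Proc.sumFin_inSum (q := q) (hU.isSessionType h).2.1 ℓ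
      (fun i => .ite (S i).check (T' i).char (T' i).char)
    refine ⟨_, .refl _, Proc.rest_inSum hU.char_cls hi fun b hb => ?_⟩
    obtain ⟨i, rfl⟩ := List.mem_ofFn.1 hb
    exact ⟨n, ℓ, S, T', i, hU, rfl⟩
  | out q n ℓ S T' =>
    exact ⟨_, hU.picks_out ⟨0, (hU.isSessionType h).2.1⟩,
      Proc.rest_out rfl ⟨n, ℓ, S, T', _, hU, rfl⟩⟩
  | mu T' => exact absurd rfl (hU.not_mu T')
  | var t => exact absurd (hU.isSessionType h).1 (Nat.not_lt_zero t)
  | done => exact ⟨_, .refl _, Proc.rest_nil hU.char_cls⟩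

end SType

namespace Config

open SType in
/-- Communication of characteristic processes; the receiver then checks the sort of the value. -/
theorem char_comm_check {N : ℕ} {f : Participant → Proc} {a b : Participant} (ha : a ≤ N)
    (hb : b ≤ N) (hab : a ≠ b) {T U : SType} (hfa : f a = T.char) (hfb : f b = U.char) {n m : ℕ}
    {ℓ : Fin n → Label} {S : Fin n → Srt} {T' : Fin n → SType} {ℓ' : Fin m → Label}
    {S' : Fin m → Srt} {U' : Fin m → SType} (hT : T.Unfolds (.out b n ℓ S T'))
    (hU : U.Unfolds (.inp a m ℓ' S' U')) {i : Fin n} {j : Fin m} (hij : ℓ i = ℓ' j) :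
    Relation.ReflTransGen Step (conf N f)
      (conf N (Function.update (Function.update f a (T' i).char) b
        (.ite ((S' j).check.subst 0 (S i).value) (U' j).char (U' j).char))) := by
  refine (conf_picks_update ha (hT.picks_out i) (f := f) (by rw [hfa])).trans (.single ?_)
  have hs := conf_step_comm (N := N)
    (f := Function.update f a (.out b (ℓ i) (.val (S i).value) (T' i).char)) hb ha hab.symm
    (P := (SType.inp a m ℓ' S' U').char) (Q := (T' i).char)
    (by rw [Function.update_of_ne hab.symm, hfb, hU.char_cls]) (by rw [Function.update_self])
    (Proc.sumFin_inSum (Fin.pos_iff_nonempty.2 ⟨j⟩) _ _)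
    ((List.mem_ofFn).2 ⟨j, Prod.ext hij.symm rfl⟩) (.val (S i).value)
  rw [Function.update_comm hab, Function.update_idem, Function.update_comm hab.symm] at hs
  simpa only [Proc.substVal, char_substVal] using hs

/-- Communication of characteristic processes that agree on the sort. -/
theorem char_comm {N : ℕ} {f : Participant → Proc} {a b : Participant} (ha : a ≤ N)
    (hb : b ≤ N) (hab : a ≠ b) {T U : SType} (hfa : f a = T.char) (hfb : f b = U.char) {n m : ℕ}
    {ℓ : Fin n → Label} {S : Fin n → Srt} {T' : Fin n → SType} {ℓ' : Fin m → Label}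
    {S' : Fin m → Srt} {U' : Fin m → SType} (hT : T.Unfolds (.out b n ℓ S T'))
    (hU : U.Unfolds (.inp a m ℓ' S' U')) {i : Fin n} {j : Fin m} (hij : ℓ i = ℓ' j)
    (hS : Srt.Sub (S i) (S' j)) :
    Relation.ReflTransGen Step (conf N f)
      (conf N (Function.update (Function.update f a (T' i).char) b (U' j).char)) := by
  obtain ⟨c, hc⟩ := Srt.check_eval hS
  refine (char_comm_check ha hb hab hfa hfb hT hU hij).trans (.single ?_)
  have := conf_step_ite (N := N) hb (f := Function.update (Function.update f a (T' i).char) b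
        (.ite ((S' j).check.subst 0 (S i).value) (U' j).char (U' j).char))
        (by rw [Function.update_self]) hc
  simpa only [Function.update_idem, ite_self] using this

end Config
/-! ### The peers of a session type -/

namespace SType

/-- All participants named in the type are less than `N`. -/
def NamesBelow (N : ℕ) : SType → Prop
  | .inp p _ _ _ T => p < N ∧ ∀ i, (T i).NamesBelow N
  | .out p _ _ _ T => p < N ∧ ∀ i, (T i).NamesBelow N
  | .mu T => T.NamesBelow N
  | .var _ => True
  | .done => True

theorem NamesBelow.mono {T : SType} {N M : ℕ} (h : T.NamesBelow N) (hNM : N ≤ M) :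
    T.NamesBelow M := by
  induction T with
  | inp p n ℓ S T ih => exact ⟨h.1.trans_le hNM, fun i => ih i (h.2 i)⟩
  | out p n ℓ S T ih => exact ⟨h.1.trans_le hNM, fun i => ih i (h.2 i)⟩
  | mu T ih => exact ih h
  | var t => trivial
  | done => trivial

theorem exists_namesBelow (T : SType) : ∃ N, T.NamesBelow N := by
  have key : ∀ {n : ℕ} (p : ℕ) {T : Fin n → SType}, (∀ i, ∃ N, (T i).NamesBelow N) →
      ∃ N, p < N ∧ ∀ i, (T i).NamesBelow N := by
    intro n p T h
    choose f hf using h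
    exact ⟨(p + 1) + ∑ i, f i, by omega, fun i => (hf i).mono
      ((Finset.single_le_sum (fun _ _ => Nat.zero_le _) (Finset.mem_univ i)).trans
        (Nat.le_add_left _ _))⟩
  induction T with
  | inp p n ℓ S T ih => exact key p ih
  | out p n ℓ S T ih => exact key p ih
  | mu T ih => exact ih
  | var t => exact ⟨0, trivial⟩
  | done => exact ⟨0, trivial⟩

theorem NamesBelow.ren {T : SType} {N : ℕ} (h : T.NamesBelow N) (ξ : ℕ → ℕ) :
    (T.ren ξ).NamesBelow N := by
  induction T generalizing ξ with
  | inp p n ℓ S T ih => exact ⟨h.1, fun i => ih i (h.2 i) ξ⟩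
  | out p n ℓ S T ih => exact ⟨h.1, fun i => ih i (h.2 i) ξ⟩
  | mu T ih => exact ih h _
  | var t => trivial
  | done => trivial

theorem NamesBelow.inst {T : SType} {N : ℕ} (h : T.NamesBelow N) {σ : ℕ → SType}
    (hσ : ∀ t, (σ t).NamesBelow N) : (T.inst σ).NamesBelow N := by
  induction T generalizing σ with
  | inp p n ℓ S T ih => exact ⟨h.1, fun i => ih i (h.2 i) hσ⟩
  | out p n ℓ S T ih => exact ⟨h.1, fun i => ih i (h.2 i) hσ⟩
  | mu T ih =>
    refine ih (σ := up σ) h fun t => ?_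
    cases t with
    | zero => trivial
    | succ t => rw [up, shift_zero]; exact (hσ t).ren _
  | var t => exact hσ t
  | done => trivial

theorem Unfolds.namesBelow {T U : SType} (h : T.Unfolds U) {N : ℕ} (hT : T.NamesBelow N) :
    U.NamesBelow N := by
  induction h with
  | root => exact hT
  | @mu T U _ ih =>
    rw [subst_zero] at ih
    refine ih (NamesBelow.inst (T := T) hT fun t => ?_)
    cases t with
    | zero => exact hT
    | succ t => trivial

/-- Send the label `ℓ` to the participants of the list, then continue as `X`. -/
def notify (ℓ : Label) (X : SType) : List Participant → SType
  | [] => X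
  | r :: l => .out r 1 (fun _ => ℓ) (fun _ => .bool) (fun _ => notify ℓ X l)

/-- The participants less than `N` other than `q`. -/
def others (N : ℕ) (q : Participant) : List Participant :=
  (List.range N).filter fun r => r ≠ q

theorem mem_others {N : ℕ} {q r : Participant} : r ∈ others N q ↔ r < N ∧ r ≠ q := by
  simp [others]

theorem nodup_others (N : ℕ) (q : Participant) : (others N q).Nodup :=
  List.nodup_range.filter _

/-- The behaviour of the participant `r` in the network that tests a process of the given type,
which is run by the participant `N`. Whenever `N` has communicated with `q`, the participant `q`
tells all others which label has been used. -/
def peer (N : ℕ) (r : Participant) : SType → SType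
  | .inp q n ℓ S T =>
    if r = q then .out N n ℓ S fun i => notify (ℓ i) ((T i).peer N r) (others N q)
    else .inp q n ℓ (fun _ => .bool) fun i => (T i).peer N r
  | .out q n ℓ S T =>
    if r = q then .inp N n ℓ S fun i => notify (ℓ i) ((T i).peer N r) (others N q)
    else .inp q n ℓ (fun _ => .bool) fun i => (T i).peer N r
  | .mu T => .mu (T.peer N r)
  | .var t => .var t
  | .done => .done

theorem notify_ren (ℓ : Label) (X : SType) (l : List Participant) (ξ : ℕ → ℕ) :
    (notify ℓ X l).ren ξ = notify ℓ (X.ren ξ) l := by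
  induction l with
  | nil => rfl
  | cons r l ih => simp only [notify, ren, ih]

theorem notify_inst (ℓ : Label) (X : SType) (l : List Participant) (σ : ℕ → SType) :
    (notify ℓ X l).inst σ = notify ℓ (X.inst σ) l := by
  induction l with
  | nil => rfl
  | cons r l ih => simp only [notify, inst, ih]

theorem notify_closedAt {ℓ : Label} {X : SType} {k : ℕ} (h : X.ClosedAt k)
    (l : List Participant) : (notify ℓ X l).ClosedAt k := by
  induction l with
  | nil => exact h
  | cons r l ih => exact fun _ => ih

theorem notify_wellFormed {ℓ : Label} {X : SType} (h : X.WellFormed)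
    (l : List Participant) : (notify ℓ X l).WellFormed := by
  induction l with
  | nil => exact h
  | cons r l ih => exact ⟨one_pos, Function.injective_of_subsingleton _, fun _ => ih⟩

theorem peer_ren (N : ℕ) (r : Participant) (T : SType) (ξ : ℕ → ℕ) :
    (T.ren ξ).peer N r = (T.peer N r).ren ξ := by
  induction T generalizing ξ with
  | inp p n ℓ S T ih => simp only [ren, peer, ih]; split <;> simp only [ren, notify_ren]
  | out p n ℓ S T ih => simp only [ren, peer, ih]; split <;> simp only [ren, notify_ren]
  | mu T ih => simp only [ren, peer, ih]
  | var t => rfl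
  | done => rfl

theorem peer_inst (N : ℕ) (r : Participant) (T : SType) (σ : ℕ → SType) :
    (T.inst σ).peer N r = (T.peer N r).inst fun t => (σ t).peer N r := by
  induction T generalizing σ with
  | inp p n ℓ S T ih => simp only [inst, peer, ih]; split <;> simp only [inst, notify_inst]
  | out p n ℓ S T ih => simp only [inst, peer, ih]; split <;> simp only [inst, notify_inst]
  | mu T ih =>
    simp only [inst, peer, ih]
    congr 2; funext t
    cases t with
    | zero => rfl
    | succ t => simp only [up, shift_zero, peer_ren]
  | var t => rfl
  | done => rfl

theorem Unfolds.peer {T U : SType} (h : T.Unfolds U) (N : ℕ) (r : Participant) :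
    (T.peer N r).Unfolds (U.peer N r) := by
  induction h with
  | @root T h =>
    refine .root ?_
    cases T with
    | inp => rw [SType.peer]; split <;> simp
    | out => rw [SType.peer]; split <;> simp
    | mu T => exact absurd rfl (h T)
    | var => simp [SType.peer]
    | done => simp [SType.peer]
  | @mu T U _ ih =>
    refine .mu ?_
    rw [subst_zero, peer_inst] at ih
    rw [subst_zero]
    convert ih using 2
    funext t
    cases t <;> rfl

theorem peer_closedAt {T : SType} {k : ℕ} (h : T.ClosedAt k) (N : ℕ) (r : Participant) :
    (T.peer N r).ClosedAt k := by
  induction T generalizing k with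
  | inp p n ℓ S T ih =>
    rw [peer]
    split
    · exact fun i => notify_closedAt (ih i (h i)) _
    · exact fun i => ih i (h i)
  | out p n ℓ S T ih =>
    rw [peer]
    split
    · exact fun i => notify_closedAt (ih i (h i)) _
    · exact fun i => ih i (h i)
  | mu T ih => exact ih (k := k + 1) h
  | var t => exact h
  | done => trivial

theorem peer_unguarded {T : SType} {N : ℕ} {r : Participant} {t : ℕ}
    (h : (T.peer N r).Unguarded t) : T.Unguarded t := by
  induction T generalizing t with
  | inp p n ℓ S T ih => rw [peer] at h; split at h <;> exact h
  | out p n ℓ S T ih => rw [peer] at h; split at h <;> exact h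
  | mu T ih => exact ih (t := t + 1) h
  | var s => exact h
  | done => exact h

theorem peer_wellFormed {T : SType} (h : T.WellFormed) (N : ℕ) (r : Participant) :
    (T.peer N r).WellFormed := by
  induction T with
  | inp p n ℓ S T ih =>
    rw [peer]
    split
    · exact ⟨h.1, h.2.1, fun i => notify_wellFormed (ih i (h.2.2 i)) _⟩
    · exact ⟨h.1, h.2.1, fun i => ih i (h.2.2 i)⟩
  | out p n ℓ S T ih =>
    rw [peer]
    split
    · exact ⟨h.1, h.2.1, fun i => notify_wellFormed (ih i (h.2.2 i)) _⟩
    · exact ⟨h.1, h.2.1, fun i => ih i (h.2.2 i)⟩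
  | mu T ih => exact ⟨fun h' => h.1 (peer_unguarded h'), ih h.2⟩
  | var t => trivial
  | done => trivial

theorem IsSessionType.peer {T : SType} (h : T.IsSessionType) (N : ℕ) (r : Participant) :
    (T.peer N r).IsSessionType := ⟨peer_closedAt h.1 N r, peer_wellFormed h.2 N r⟩

theorem Unfolds.peer_inp_self {U : SType} {q : Participant} {m : ℕ} {ℓ : Fin m → Label}
    {S : Fin m → Srt} {U' : Fin m → SType} (h : U.Unfolds (.inp q m ℓ S U')) (N : ℕ) :
    (U.peer N q).Unfolds
      (.out N m ℓ S fun i => notify (ℓ i) ((U' i).peer N q) (others N q)) := by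
  have := h.peer N q
  rwa [SType.peer, if_pos rfl] at this

theorem Unfolds.peer_out_self {U : SType} {q : Participant} {m : ℕ} {ℓ : Fin m → Label}
    {S : Fin m → Srt} {U' : Fin m → SType} (h : U.Unfolds (.out q m ℓ S U')) (N : ℕ) :
    (U.peer N q).Unfolds
      (.inp N m ℓ S fun i => notify (ℓ i) ((U' i).peer N q) (others N q)) := by
  have := h.peer N q
  rwa [SType.peer, if_pos rfl] at this

theorem Unfolds.peer_inp_ne {U : SType} {q : Participant} {m : ℕ} {ℓ : Fin m → Label}
    {S : Fin m → Srt} {U' : Fin m → SType} (h : U.Unfolds (.inp q m ℓ S U')) (N : ℕ)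
    {r : Participant} (hr : r ≠ q) :
    (U.peer N r).Unfolds (.inp q m ℓ (fun _ => .bool) fun i => (U' i).peer N r) := by
  have := h.peer N r
  rwa [SType.peer, if_neg hr] at this

theorem Unfolds.peer_out_ne {U : SType} {q : Participant} {m : ℕ} {ℓ : Fin m → Label}
    {S : Fin m → Srt} {U' : Fin m → SType} (h : U.Unfolds (.out q m ℓ S U')) (N : ℕ)
    {r : Participant} (hr : r ≠ q) :
    (U.peer N r).Unfolds (.inp q m ℓ (fun _ => .bool) fun i => (U' i).peer N r) := by
  have := h.peer N r
  rwa [SType.peer, if_neg hr] at this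

end SType

namespace Config
open SType

/-- The processes of the network that tests `P` for the type `U`. -/
def net (N : ℕ) (P : Proc) (U : SType) (r : Participant) : Proc :=
  if r = N then P else (U.peer N r).char

/-- The notification of the participants of a list runs to its end when all of them wait for it. -/
theorem conf_notify {N : ℕ} {q : Participant} (hq : q ≤ N) {ℓ : Label} {X : SType}
    {l : List Participant} (hl : l.Nodup) (hlq : ∀ r ∈ l, r ≤ N ∧ r ≠ q)
    {f : Participant → Proc} (hf : f q = (notify ℓ X l).char) {Z : Participant → SType}
    (hZ : ∀ r ∈ l, ∃ Y : SType, f r = Y.char ∧ ∃ (n : ℕ) (ℓ' : Fin n → Label)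
      (T' : Fin n → SType) (j : Fin n), Y.Unfolds (.inp q n ℓ' (fun _ => .bool) T') ∧
        ℓ = ℓ' j ∧ T' j = Z r) :
    Relation.ReflTransGen Step (conf N f)
      (conf N fun r => if r = q then X.char else if r ∈ l then (Z r).char else f r) := by
  induction l generalizing f with
  | nil =>
    refine (conf_congr (N := N) fun r _ => ?_) ▸ .refl
    rcases eq_or_ne r q with rfl | hr
    · simp [hf, notify]
    · simp [hr]
  | cons a l ih =>
    obtain ⟨Y, hY, n, ℓ', T', j, hu, hj, hZj⟩ := hZ a (by simp)
    obtain ⟨haN, haq⟩ := hlq a (by simp)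
    obtain ⟨hal, hl⟩ := List.nodup_cons.1 hl
    refine (char_comm hq haN haq.symm hf hY unfolds_out hu (i := 0) hj (.refl _)).trans ?_
    have := ih hl (fun r hr => hlq r (by simp [hr]))
      (f := Function.update (Function.update f q (notify ℓ X l).char) a (T' j).char)
      (by rw [Function.update_of_ne haq.symm, Function.update_self]) (fun r hr => by
        have hra : r ≠ a := fun h => hal (h ▸ hr)
        have hrq := (hlq r (by simp [hr])).2
        rw [Function.update_of_ne hra, Function.update_of_ne hrq]
        exact hZ r (by simp [hr]))
    convert this using 2
    funext r
    by_cases hrq : r = q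
    · simp [hrq]
    · by_cases hra : r = a
      · subst hra; simp [hrq, hal, hZj]
      · simp [hrq, hra]

/-- After `q` has notified the others, all peers follow the branch that `N` and `q` have taken. -/
theorem conf_broadcast {N : ℕ} {q : Participant} (hq : q < N) {U : SType} {m : ℕ}
    {ℓ : Fin m → Label} {U' : Fin m → SType}
    (hU : ∀ r, r ≠ q →
      (U.peer N r).Unfolds (.inp q m ℓ (fun _ => .bool) fun i => (U' i).peer N r))
    (j : Fin m) (P : Proc) {f : Participant → Proc} (hN : f N = P)
    (hf : f q = (notify (ℓ j) ((U' j).peer N q) (others N q)).char)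
    (hr : ∀ r < N, r ≠ q → f r = (U.peer N r).char) :
    Relation.ReflTransGen Step (conf N f) (conf N (net N P (U' j))) := by
  have := conf_notify (N := N) hq.le (nodup_others N q)
    (fun r hr => ⟨(mem_others.1 hr).1.le, (mem_others.1 hr).2⟩) hf
    (Z := fun r => (U' j).peer N r) fun r hro =>
      ⟨_, hr r (mem_others.1 hro).1 (mem_others.1 hro).2, m, ℓ, _, j,
        hU r (mem_others.1 hro).2, rfl, rfl⟩
  refine this.trans ?_
  rw [conf_congr (N := N) (g := net N P (U' j))]
  · intro r hrN
    simp only [net, mem_others]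
    by_cases h1 : r = q
    · subst h1; simp [hq.ne]
    · by_cases h2 : r = N
      · subst h2; simp [h1, hN]
      · simp [h1, h2, lt_of_le_of_ne hrN h2]

/-- The network sends and the tested process receives. The peers move on to the next round of
the test even before the tested process has checked the value. -/
theorem net_recv_check {N : ℕ} {q : Participant} (hq : q < N) {T U : SType} {n m : ℕ}
    {ℓ : Fin n → Label} {S : Fin n → Srt} {T' : Fin n → SType} {ℓ' : Fin m → Label}
    {S' : Fin m → Srt} {U' : Fin m → SType} (hT : T.Unfolds (.inp q n ℓ S T'))
    (hU : U.Unfolds (.inp q m ℓ' S' U')) {i : Fin n} {j : Fin m} (hij : ℓ i = ℓ' j) :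
    Relation.ReflTransGen Step (conf N (net N T.char U))
      (conf N (net N (.ite ((S i).check.subst 0 (S' j).value) (T' i).char (T' i).char)
        (U' j))) := by
  refine (char_comm_check hq.le le_rfl hq.ne (by rw [net, if_neg hq.ne]) (by rw [net, if_pos rfl])
    (hU.peer_inp_self N) hT hij.symm).trans
    (conf_broadcast hq (fun r hr => hU.peer_inp_ne N hr) j _ (by rw [Function.update_self])
      (by rw [Function.update_of_ne hq.ne, Function.update_self]) fun r hr hrq => ?_)
  rw [Function.update_of_ne hr.ne, Function.update_of_ne hrq, net, if_neg hr.ne]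

/-- A successful round of the test in which the tested process receives. -/
theorem net_recv {N : ℕ} {q : Participant} (hq : q < N) {T U : SType} {n m : ℕ}
    {ℓ : Fin n → Label} {S : Fin n → Srt} {T' : Fin n → SType} {ℓ' : Fin m → Label}
    {S' : Fin m → Srt} {U' : Fin m → SType} (hT : T.Unfolds (.inp q n ℓ S T'))
    (hU : U.Unfolds (.inp q m ℓ' S' U')) {i : Fin n} {j : Fin m} (hij : ℓ i = ℓ' j)
    (hS : Srt.Sub (S' j) (S i)) :
    Relation.ReflTransGen Step (conf N (net N T.char U)) (conf N (net N (T' i).char (U' j))) := by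
  refine (char_comm hq.le le_rfl hq.ne (by rw [net, if_neg hq.ne]) (by rw [net, if_pos rfl])
    (hU.peer_inp_self N) hT hij.symm hS).trans
    (conf_broadcast hq (fun r hr => hU.peer_inp_ne N hr) j _ (by rw [Function.update_self])
      (by rw [Function.update_of_ne hq.ne, Function.update_self]) fun r hr hrq => ?_)
  rw [Function.update_of_ne hr.ne, Function.update_of_ne hrq, net, if_neg hr.ne]

/-- A successful round of the test in which the tested process sends. -/
theorem net_send {N : ℕ} {q : Participant} (hq : q < N) {T U : SType} {n m : ℕ}
    {ℓ : Fin n → Label} {S : Fin n → Srt} {T' : Fin n → SType} {ℓ' : Fin m → Label}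
    {S' : Fin m → Srt} {U' : Fin m → SType} (hT : T.Unfolds (.out q n ℓ S T'))
    (hU : U.Unfolds (.out q m ℓ' S' U')) {i : Fin n} {j : Fin m} (hij : ℓ i = ℓ' j)
    (hS : Srt.Sub (S i) (S' j)) :
    Relation.ReflTransGen Step (conf N (net N T.char U)) (conf N (net N (T' i).char (U' j))) := by
  refine (char_comm le_rfl hq.le hq.ne' (by rw [net, if_pos rfl]) (by rw [net, if_neg hq.ne])
    hT (hU.peer_out_self N) hij hS).trans
    (conf_broadcast hq (fun r hr => hU.peer_out_ne N hr) j _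
      (by rw [Function.update_of_ne hq.ne', Function.update_self])
      (by rw [Function.update_self]) fun r hr hrq => ?_)
  rw [Function.update_of_ne hrq, Function.update_of_ne hr.ne, net, if_neg hr.ne]

theorem rest_of_inp {U : SType} {q : Participant} {m : ℕ} {ℓ : Fin m → Label} {S : Fin m → Srt}
    {U' : Fin m → SType} (hm : 0 < m) (h : U.Unfolds (.inp q m ℓ S U'))
    {snd rcv : Participant → Label → Prop} (hr : ∀ i, rcv q (ℓ i)) : U.char.Rest snd rcv := by
  refine Proc.rest_inSum h.char_cls (Proc.sumFin_inSum hm ℓ _) fun b hb => ?_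
  obtain ⟨i, rfl⟩ := List.mem_ofFn.1 hb
  exact hr i

/-- The network gets stuck when the tested process comes to rest in a state whose outputs are not
expected by the network, in which it does not accept every output of the network, and in which it
has not terminated if the network has. -/
theorem net_getsStuck {N : ℕ} {U : SType} (hU : U.IsSessionType) (hUN : U.NamesBelow N) {P Q : Proc}
    {snd rcv : Participant → Label → Prop} (hPQ : P.Picks Q) (hQ : Q.Rest snd rcv)
    (ho : ∀ q m ℓ S U', U.Unfolds (.out q m ℓ S U') → ∀ j, ¬ snd q (ℓ j))
    (hi : ∀ q m ℓ S U', U.Unfolds (.inp q m ℓ S U') → ∃ j, ¬ rcv q (ℓ j))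
    (hd : U.Unfolds .done → Q.cls ≠ Proc.cls .nil) : (conf N (net N P U)).GetsStuck := by
  rcases hU.cases with h | ⟨q, m, ℓ, S, U', h⟩ | ⟨q, m, ℓ, S, U', h⟩
  · refine getsStuck_of_rest (g := net N Q U)
      (snd := fun r => if r = N then snd else fun _ _ => False)
      (rcv := fun r => if r = N then rcv else fun _ _ => False)
      (fun r hr => ?_) (fun r hr => ?_) (fun p hp r hr l => ?_) ⟨N, le_rfl, ?_⟩
    · unfold net; split
      · exact hPQ
      · exact .refl _
    · unfold net; split
      · exact hQ
      · exact Proc.rest_nil (h.peer N r).char_cls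
    · split_ifs <;> simp_all
    · rw [net, if_pos rfl]; exact hd h
  · have hm := (h.isSessionType hU).2.1
    have hq : q < N := (h.namesBelow hUN).1
    obtain ⟨j, hj⟩ := hi _ _ _ _ _ h
    -- the peer `q` chooses to send a label that is not accepted
    refine getsStuck_of_rest (g := fun r => if r = q then
        .out N (ℓ j) (.val (S j).value)
          (notify (ℓ j) ((U' j).peer N q) (others N q)).char else net N Q U r)
      (snd := fun r => if r = N then snd else if r = q then fun a l => a = N ∧ l = ℓ j
        else fun _ _ => False)
      (rcv := fun r => if r = N then rcv else if r = q then fun _ _ => False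
        else fun a _ => a = q)
      (fun r hr => ?_) (fun r hr => ?_) (fun p hp r hr l => ?_) ⟨q, hq.le, ?_⟩
    · by_cases h1 : r = q
      · rw [if_pos h1, h1, net, if_neg hq.ne]
        exact (h.peer_inp_self N).picks_out j
      · rw [if_neg h1]
        unfold net; split
        · exact hPQ
        · exact .refl _
    · by_cases h1 : r = q
      · simp only [h1, hq.ne, if_false, if_true]
        exact Proc.rest_out rfl ⟨rfl, rfl⟩
      · by_cases h2 : r = N
        · simp only [if_neg h1, net, if_pos h2]
          exact hQ
        · simp only [if_neg h1, net, if_neg h2]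
          exact rest_of_inp hm (h.peer_inp_ne N h1) fun _ => rfl
    · intro h' h''
      by_cases hpN : p = N
      · by_cases hrN : r = N
        · exact hpN.trans hrN.symm
        · by_cases hrq : r = q
          · simp only [hpN, hrq, hq.ne, if_true, if_false, true_and] at h' h''
            exact absurd (h' ▸ h'') hj
          · simp only [hrN, hrq, if_false] at h'
      · by_cases hpq : p = q
        · simp only [hpq, hq.ne, if_true, if_false] at h''
        · simp only [hpN, hpq, if_false] at h''
          simp only [h'', hq.ne, if_true, if_false, hpN, false_and] at h'
    · simp only [if_true]; exact Proc.cls_out_ne_nil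
  · have hm := (h.isSessionType hU).2.1
    have hq : q < N := (h.namesBelow hUN).1
    refine getsStuck_of_rest (g := net N Q U)
      (snd := fun r => if r = N then snd else fun _ _ => False)
      (rcv := fun r => if r = N then rcv else if r = q then fun a l => a = N ∧ ∃ j, l = ℓ j
        else fun a _ => a = q)
      (fun r hr => ?_) (fun r hr => ?_) (fun p hp r hr l => ?_) ⟨q, hq.le, ?_⟩
    · unfold net; split
      · exact hPQ
      · exact .refl _
    · dsimp only [net]; split_ifs with h1 h2
      · exact hQ
      · subst h2
        exact rest_of_inp hm (h.peer_out_self N) fun i => ⟨rfl, i, rfl⟩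
      · exact rest_of_inp hm (h.peer_out_ne N h2) fun _ => rfl
    · intro h' h''
      by_cases hrN : r = N
      · by_cases hpN : p = N
        · exact hpN.trans hrN.symm
        · by_cases hpq : p = q
          · simp only [hpq, hrN, hq.ne, if_true, if_false, true_and] at h' h''
            obtain ⟨j, rfl⟩ := h''
            exact absurd h' (ho _ _ _ _ _ h j)
          · simp only [hpN, hpq, if_false] at h''
            exact absurd (h''.symm.trans hrN) hq.ne
      · simp only [hrN, if_false] at h'
    · rw [net, if_neg hq.ne, (h.peer_out_self N).char_cls]
      exact (Proc.sumFin_inSum hm ℓ _).cls_ne_nil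

/-- A value of the wrong sort blocks the peer that checks it, and all other peers wait for that
one. -/
theorem net_send_getsStuck {N : ℕ} {q : Participant} (hq : q < N) {T U : SType} {n m : ℕ}
    {ℓ : Fin n → Label} {S : Fin n → Srt} {T' : Fin n → SType} {ℓ' : Fin m → Label}
    {S' : Fin m → Srt} {U' : Fin m → SType} (hT' : T.IsSessionType)
    (hT : T.Unfolds (.out q n ℓ S T'))
    (hU : U.Unfolds (.out q m ℓ' S' U')) {i : Fin n} {j : Fin m} (hij : ℓ i = ℓ' j)
    (hS : ¬ Srt.Sub (S i) (S' j)) : (conf N (net N T.char U)).GetsStuck := by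
  refine GetsStuck.of_steps ?_ (char_comm_check le_rfl hq.le hq.ne' (by rw [net, if_pos rfl])
    (by rw [net, if_neg hq.ne]) hT (hU.peer_out_self N) hij)
  obtain ⟨P, hP, hrest⟩ := ((hT.isSessionType hT').out i).settle
  have hm : 0 < m := Fin.pos_iff_nonempty.2 ⟨j⟩
  refine getsStuck_of_rest (g := fun r => if r = q then
      .ite ((S' j).check.subst 0 (S i).value)
        (notify (ℓ' j) ((U' j).peer N q) (others N q)).char
        (notify (ℓ' j) ((U' j).peer N q) (others N q)).char
      else net N P U r)
    (snd := fun r => if r = N then (T' i).Sends else fun _ _ => False)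
    (rcv := fun r => if r = N then (T' i).Recvs else if r = q then fun _ _ => False
      else fun a _ => a = q)
    (fun r hr => ?_) (fun r hr => ?_) (fun p hp r hr l => ?_) ⟨q, hq.le, ?_⟩
  · rcases eq_or_ne r q with rfl | h1
    · rw [Function.update_self, if_pos rfl]; exact .refl _
    · rw [Function.update_of_ne h1, if_neg h1, net]
      split_ifs with h2
      · subst h2; rw [Function.update_self]; exact hP
      · rw [Function.update_of_ne h2, net, if_neg h2]; exact .refl _
  · by_cases h1 : r = q
    · simp only [if_pos h1]
      exact Proc.rest_ite rfl fun b => Srt.check_not_eval hS _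
    · by_cases h2 : r = N
      · simp only [if_neg h1, net, if_pos h2]
        exact hrest
      · simp only [if_neg h1, net, if_neg h2]
        exact rest_of_inp hm (hU.peer_out_ne N h1) fun _ => rfl
  · intro h' h''
    by_cases hrN : r = N
    · by_cases hpN : p = N
      · exact hpN.trans hrN.symm
      · by_cases hpq : p = q
        · simp only [hpq, hq.ne, if_true, if_false] at h''
        · simp only [hpN, hpq, if_false] at h''
          exact absurd (h''.symm.trans hrN) hq.ne
    · simp only [hrN, if_false] at h'
  · simp only [if_true]; exact Proc.cls_ite_ne_nil

/-- If the network for `U` does not get stuck with the characteristic process of `T`, then the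
roots of the types are related as in subtyping, and the same holds for the continuations. -/
theorem subRule_of_not_getsStuck {N : ℕ} {T U : SType} (hT : T.IsSessionType)
    (hU : U.IsSessionType) (hUN : U.NamesBelow N) (h : ¬ (conf N (net N T.char U)).GetsStuck) :
    SubRule (fun T' U' => T'.IsSessionType ∧ U'.IsSessionType ∧ U'.NamesBelow N ∧
      ¬ (conf N (net N T'.char U')).GetsStuck) T U := by
  rcases hT.cases with h₁ | ⟨q, n, ℓ, S, T', h₁⟩ | ⟨q, n, ℓ, S, T', h₁⟩
  · by_cases hd : U.Unfolds .done
    · exact .done h₁ hd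
    · refine absurd (net_getsStuck hU hUN (.refl _)
        (Proc.rest_nil (snd := fun _ _ => False) (rcv := fun _ _ => False) h₁.char_cls)
        (fun _ _ _ _ _ _ _ => id) (fun q m ℓ S U' h' => ?_) fun h' => absurd h' hd) h
      exact ⟨⟨0, (h'.isSessionType hU).2.1⟩, id⟩
  · have hn : 0 < n := (h₁.isSessionType hT).2.1
    have hi := Proc.sumFin_inSum (q := q) hn ℓ
      (fun i => .ite (S i).check (T' i).char (T' i).char)
    have key : ∃ m ℓ' S' U', U.Unfolds (.inp q m ℓ' S' U') ∧ ∀ j, ∃ i, ℓ i = ℓ' j := by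
      by_contra hc
      refine h (net_getsStuck hU hUN (.refl _) (rest_of_inp hn h₁ (snd := fun _ _ => False)
        (rcv := fun a l => a = q ∧ ∃ i, ℓ i = l) fun i => ⟨rfl, i, rfl⟩)
        (fun _ _ _ _ _ _ _ => id) (fun q' m ℓ' S' U' h' => ?_) fun _ => ?_)
      · by_contra hc'
        push Not at hc'
        obtain rfl := (hc' ⟨0, (h'.isSessionType hU).2.1⟩).1
        exact hc ⟨m, ℓ', S', U', h', fun j => (hc' j).2⟩
      · rw [h₁.char_cls]; exact hi.cls_ne_nil
    obtain ⟨m, ℓ', S', U', h₂, hℓ⟩ := key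
    have hqN : q < N := (h₂.namesBelow hUN).1
    refine .inp q n m ℓ ℓ' S S' T' U' h₁ h₂ fun j => ?_
    obtain ⟨i, hij⟩ := hℓ j
    have hUj := (h₂.isSessionType hU).inp j
    have hS : Srt.Sub (S' j) (S i) := by
      by_contra hS
      refine h (.of_steps (net_getsStuck hUj ((h₂.namesBelow hUN).2 j) (.refl _)
        (Proc.rest_ite (snd := fun _ _ => False) (rcv := fun _ _ => False) rfl
          fun b => Srt.check_not_eval hS _)
        (fun _ _ _ _ _ _ _ => id) (fun q m ℓ S U' h' => ?_) fun _ => Proc.cls_ite_ne_nil)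
        (net_recv_check hqN h₁ h₂ hij))
      exact ⟨⟨0, (h'.isSessionType hUj).2.1⟩, id⟩
    exact ⟨i, hij, hS, (h₁.isSessionType hT).inp i, hUj, (h₂.namesBelow hUN).2 j,
      fun h' => h (h'.of_steps (net_recv hqN h₁ h₂ hij hS))⟩
  · have hn : 0 < n := (h₁.isSessionType hT).2.1
    have key : ∀ i, ∃ m ℓ' S' U', U.Unfolds (.out q m ℓ' S' U') ∧ ∃ j, ℓ i = ℓ' j := by
      intro i
      by_contra hc
      refine h (net_getsStuck hU hUN (h₁.picks_out i) (Proc.rest_out rfl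
        (snd := fun a l => a = q ∧ l = ℓ i) (rcv := fun _ _ => False) ⟨rfl, rfl⟩)
        (fun q' m ℓ' S' U' h' j hj => ?_) (fun q' m ℓ' S' U' h' => ?_)
        fun _ => Proc.cls_out_ne_nil)
      · obtain ⟨rfl, hj⟩ := hj
        exact hc ⟨m, ℓ', S', U', h', j, hj.symm⟩
      · exact ⟨⟨0, (h'.isSessionType hU).2.1⟩, id⟩
    obtain ⟨m, ℓ', S', U', h₂, -⟩ := key ⟨0, hn⟩
    have hqN : q < N := (h₂.namesBelow hUN).1
    refine .out q n m ℓ ℓ' S S' T' U' h₁ h₂ fun i => ?_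
    obtain ⟨m₁, ℓ₁, S₁, U₁, h₃, j, hij⟩ := key i
    cases h₂.det h₃
    have hS : Srt.Sub (S i) (S' j) := by
      by_contra hS
      exact h (net_send_getsStuck hqN hT h₁ h₂ hij hS)
    exact ⟨j, hij, hS, (h₁.isSessionType hT).out i, (h₂.isSessionType hU).out j,
      (h₂.namesBelow hUN).2 j, fun h' => h (h'.of_steps (net_send hqN h₁ h₂ hij hS))⟩

/-- A type whose characteristic process passes the test for `U` is a subtype of `U`. -/
theorem subtype_of_not_getsStuck {N : ℕ} {T U : SType} (hT : T.IsSessionType)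
    (hU : U.IsSessionType) (hUN : U.NamesBelow N) (h : ¬ (conf N (net N T.char U)).GetsStuck) :
    SType.Subtype T U :=
  ⟨_, fun _ _ h => subRule_of_not_getsStuck h.1 h.2.1 h.2.2.1 h.2.2.2, hT, hU, hUN, h⟩

end Config
/-! ### Removing trivial recursions -/

namespace SType

/-- The type contains a communication. -/
def HasComm : SType → Prop
  | .inp _ _ _ _ _ => True
  | .out _ _ _ _ _ => True
  | .mu T => T.HasComm
  | .var _ => False
  | .done => False

open Classical in
/-- Replace the closed recursions without communications by `end`. The projection of a global type
does the same. -/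
noncomputable def norm : SType → SType
  | .inp p n ℓ S T => .inp p n ℓ S fun i => (T i).norm
  | .out p n ℓ S T => .out p n ℓ S fun i => (T i).norm
  | .mu T => if T.HasComm ∨ ¬ T.ClosedAt 1 then .mu T.norm else .done
  | .var t => .var t
  | .done => .done

/-- All closed recursions contain communications. Closedness of `μt.T` is stated for its body. -/
def Tight : SType → Prop
  | .inp _ _ _ _ T => ∀ i, (T i).Tight
  | .out _ _ _ _ T => ∀ i, (T i).Tight
  | .mu T => (T.HasComm ∨ ¬ T.ClosedAt 1) ∧ T.Tight
  | .var _ => True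
  | .done => True

theorem HasComm.norm {T : SType} (h : T.HasComm) : T.norm.HasComm := by
  induction T with
  | inp => trivial
  | out => trivial
  | mu T ih => rw [SType.norm, if_pos (.inl h)]; exact ih h
  | var t => exact h
  | done => exact h

theorem norm_closedAt_iff {T : SType} {k : ℕ} : T.norm.ClosedAt k ↔ T.ClosedAt k := by
  induction T generalizing k with
  | inp p n ℓ S T ih => exact forall_congr' fun i => ih i
  | out p n ℓ S T ih => exact forall_congr' fun i => ih i
  | mu T ih =>
    rw [norm]
    split_ifs with h
    · exact ih
    · push Not at h
      exact iff_of_true trivial (closedAt_mono (T := .mu T) (k := 0) h.2 (Nat.zero_le k))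
  | var t => rfl
  | done => rfl

theorem norm_tight (T : SType) : T.norm.Tight := by
  induction T with
  | inp p n ℓ S T ih => exact ih
  | out p n ℓ S T ih => exact ih
  | mu T ih =>
    rw [norm]
    split_ifs with h
    · exact ⟨h.imp HasComm.norm fun h' => by rwa [norm_closedAt_iff], ih⟩
    · trivial
  | var t => trivial
  | done => trivial

theorem norm_unguarded {T : SType} {t : ℕ} (h : T.norm.Unguarded t) : T.Unguarded t := by
  induction T generalizing t with
  | inp p n ℓ S T ih => exact h
  | out p n ℓ S T ih => exact h
  | mu T ih =>
    rw [norm] at h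
    split_ifs at h
    · exact ih (t := t + 1) h
    · exact h.elim
  | var s => exact h
  | done => exact h

theorem WellFormed.norm {T : SType} (h : T.WellFormed) : T.norm.WellFormed := by
  induction T with
  | inp p n ℓ S T ih => exact ⟨h.1, h.2.1, fun i => ih i (h.2.2 i)⟩
  | out p n ℓ S T ih => exact ⟨h.1, h.2.1, fun i => ih i (h.2.2 i)⟩
  | mu T ih =>
    rw [SType.norm]
    split_ifs
    · exact ⟨fun h' => h.1 (norm_unguarded h'), ih h.2⟩
    · trivial
  | var t => trivial
  | done => trivial

theorem IsSessionType.norm {T : SType} (h : T.IsSessionType) : T.norm.IsSessionType :=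
  ⟨norm_closedAt_iff.2 h.1, h.2.norm⟩

theorem NamesBelow.norm {T : SType} {N : ℕ} (h : T.NamesBelow N) : T.norm.NamesBelow N := by
  induction T with
  | inp p n ℓ S T ih => exact ⟨h.1, fun i => ih i (h.2 i)⟩
  | out p n ℓ S T ih => exact ⟨h.1, fun i => ih i (h.2 i)⟩
  | mu T ih =>
    rw [SType.norm]
    split_ifs
    · exact ih h
    · trivial
  | var t => trivial
  | done => trivial

theorem hasComm_ren {T : SType} {ξ : ℕ → ℕ} (h : (T.ren ξ).HasComm) : T.HasComm := by
  induction T generalizing ξ with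
  | inp => trivial
  | out => trivial
  | mu T ih => exact ih (ξ := liftRen ξ) h
  | var t => exact h
  | done => exact h

theorem not_hasComm_inst {T : SType} {σ : ℕ → SType} (h : ¬ T.HasComm)
    (hσ : ∀ t, ¬ (σ t).HasComm) : ¬ (T.inst σ).HasComm := by
  induction T generalizing σ with
  | inp => exact absurd trivial h
  | out => exact absurd trivial h
  | mu T ih =>
    refine ih (σ := up σ) h fun t => ?_
    cases t with
    | zero => exact id
    | succ t => rw [up, shift_zero]; exact fun h' => hσ t (hasComm_ren h')
  | var t => exact hσ t
  | done => exact id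

theorem Unfolds.not_hasComm {T U : SType} (h : T.Unfolds U) (hT : ¬ T.HasComm) :
    ¬ U.HasComm := by
  induction h with
  | root => exact hT
  | @mu T U _ ih =>
    rw [subst_zero] at ih
    refine ih (not_hasComm_inst (T := T) hT fun t => ?_)
    cases t with
    | zero => exact hT
    | succ t => exact id

/-- Without communications there is nothing but `end`, as recursion is guarded. -/
theorem IsSessionType.unfolds_done {T : SType} (h : T.IsSessionType) (hT : ¬ T.HasComm) :
    T.Unfolds .done := by
  rcases h.cases with h' | ⟨p, n, ℓ, S, T', h'⟩ | ⟨p, n, ℓ, S, T', h'⟩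
  · exact h'
  · exact absurd trivial (h'.not_hasComm hT)
  · exact absurd trivial (h'.not_hasComm hT)

/-- The second type arises from the first one when some closed subterms that unfold to `end` are
replaced by `end`. -/
inductive Ended : SType → SType → Prop where
  | cut {T : SType} : T.ClosedAt 0 → T.Unfolds .done → Ended T .done
  | inp {p n ℓ S} {T U : Fin n → SType} : (∀ i, Ended (T i) (U i)) →
      Ended (.inp p n ℓ S T) (.inp p n ℓ S U)
  | out {p n ℓ S} {T U : Fin n → SType} : (∀ i, Ended (T i) (U i)) →
      Ended (.out p n ℓ S T) (.out p n ℓ S U)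
  | mu {T U : SType} : Ended T U → Ended (.mu T) (.mu U)
  | var (t : ℕ) : Ended (.var t) (.var t)

theorem WellFormed.ended_norm {T : SType} (h : T.WellFormed) : Ended T T.norm := by
  induction T with
  | inp p n ℓ S T ih => exact .inp fun i => ih i (h.2.2 i)
  | out p n ℓ S T ih => exact .out fun i => ih i (h.2.2 i)
  | mu T ih =>
    rw [SType.norm]
    split_ifs with h'
    · exact .mu (ih h.2)
    · push Not at h'
      exact .cut h'.2 (IsSessionType.unfolds_done ⟨h'.2, h⟩ h'.1)
  | var t => exact .var t
  | done => exact .cut trivial unfolds_done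

theorem Ended.ren {T U : SType} (h : Ended T U) (ξ : ℕ → ℕ) : Ended (T.ren ξ) (U.ren ξ) := by
  induction h generalizing ξ with
  | @cut T hc hd =>
    rw [← inst_var (T.ren ξ), inst_ren, inst_closed hc]
    exact .cut hc hd
  | inp _ ih => exact .inp fun i => ih i ξ
  | out _ ih => exact .out fun i => ih i ξ
  | mu _ ih => exact .mu (ih _)
  | var t => exact .var _

theorem Ended.inst {T U : SType} (h : Ended T U) {σ τ : ℕ → SType}
    (hσ : ∀ t, Ended (σ t) (τ t)) : Ended (T.inst σ) (U.inst τ) := by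
  induction h generalizing σ τ with
  | @cut T hc hd =>
    rw [inst_closed hc]
    exact .cut hc hd
  | inp _ ih => exact .inp fun i => ih i hσ
  | out _ ih => exact .out fun i => ih i hσ
  | mu _ ih =>
    refine .mu (ih fun t => ?_)
    cases t with
    | zero => exact .var 0
    | succ t => simp only [up, shift_zero]; exact (hσ t).ren _
  | var t => exact hσ t

theorem Ended.unfolds {T U V : SType} (h : Ended T U) (hV : T.Unfolds V) :
    ∃ W, U.Unfolds W ∧ Ended V W := by
  induction hV generalizing U with
  | root hT =>
    refine ⟨U, .root fun U' hU => ?_, h⟩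
    subst hU
    cases h with
    | mu h => exact hT _ rfl
  | mu hV ih =>
    cases h with
    | cut hc hd =>
      cases (Unfolds.mu hV).det hd
      exact ⟨_, unfolds_done, .cut trivial unfolds_done⟩
    | @mu T U h =>
      obtain ⟨W, hW, hVW⟩ := ih (U := U.subst 0 (.mu U)) (by
        rw [subst_zero, subst_zero]
        refine h.inst fun t => ?_
        cases t with
        | zero => exact .mu h
        | succ t => exact .var t)
      exact ⟨W, .mu hW, hVW⟩

theorem Ended.treeEq {T U : SType} (h : Ended T U) (hT : T.WellFormed) : TreeEq T U := by
  refine ⟨fun T U => Ended T U ∧ T.WellFormed, fun T U h => ?_, h, hT⟩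
  obtain ⟨h, hT⟩ := h
  obtain ⟨V, hV⟩ := hT.exists_unfolds
  obtain ⟨W, hW, hVW⟩ := h.unfolds hV
  have hwf := hV.wellFormed hT
  cases hVW with
  | cut hc hd =>
    rcases id hd with _ | _
    · exact .done hV hW
    · exact absurd rfl (hV.not_mu _)
  | inp h' =>
    exact .inp _ _ _ _ _ _ _ _ _ hV hW (fun i => ⟨i, rfl, rfl, h' i, hwf.2.2 i⟩)
      fun i => ⟨i, rfl, rfl, h' i, hwf.2.2 i⟩
  | out h' =>
    exact .out _ _ _ _ _ _ _ _ _ hV hW (fun i => ⟨i, rfl, rfl, h' i, hwf.2.2 i⟩)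
      fun i => ⟨i, rfl, rfl, h' i, hwf.2.2 i⟩
  | mu => exact absurd rfl (hV.not_mu _)
  | var t => exact .var t hV hW

theorem IsSessionType.subtype_norm {T : SType} (h : T.IsSessionType) : SType.Subtype T T.norm :=
  (h.2.ended_norm.treeEq h.2).subtype h.1

theorem IsSessionType.norm_subtype {T : SType} (h : T.IsSessionType) : SType.Subtype T.norm T :=
  (h.2.ended_norm.treeEq h.2).symm.subtype h.norm.1

end SType

/-! ### The global type of the network -/

namespace GType

/-- The participant `q` sends the label `ℓ` to the participants of the list, then `G` follows. -/
def spread (ℓ : Label) (q : Participant) (G : GType) : List Participant → GType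
  | [] => G
  | r :: l => .comm q r 1 (fun _ => ℓ) (fun _ => .bool) fun _ => spread ℓ q G l

theorem spread_closedAt_iff {ℓ : Label} {q : Participant} {G : GType} {l : List Participant}
    {k : ℕ} : (spread ℓ q G l).ClosedAt k ↔ G.ClosedAt k := by
  induction l with
  | nil => rfl
  | cons r l ih => exact ⟨fun h => ih.1 (h 0), fun h _ => ih.2 h⟩

theorem spread_wellFormed {ℓ : Label} {q : Participant} {G : GType} {l : List Participant}
    (h : G.WellFormed) (hl : ∀ r ∈ l, r ≠ q) : (spread ℓ q G l).WellFormed := by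
  induction l with
  | nil => exact h
  | cons r l ih =>
    exact ⟨(hl r (by simp)).symm, one_pos, Function.injective_of_subsingleton _,
      fun _ => ih fun r hr => hl r (by simp [hr])⟩

theorem mem_participants_spread {ℓ : Label} {q r : Participant} {G : GType}
    {l : List Participant} (h : r ∈ (spread ℓ q G l).participants) :
    r = q ∨ r ∈ l ∨ r ∈ G.participants := by
  induction l with
  | nil => exact .inr (.inr h)
  | cons a l ih =>
    simp only [spread, participants, Set.mem_union, Set.mem_insert_iff, Set.mem_singleton_iff,
      Set.mem_iUnion] at h
    rcases h with (rfl | rfl) | ⟨-, h⟩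
    · exact .inl rfl
    · exact .inr (.inl (by simp))
    · exact (ih h).imp id (Or.imp (fun h => by simp [h]) id)

theorem mem_participants_spread_of_mem {ℓ : Label} {q r : Participant} {G : GType}
    {l : List Participant} (h : r ∈ l) : r ∈ (spread ℓ q G l).participants := by
  induction l with
  | nil => simp at h
  | cons a l ih =>
    simp only [spread, participants, Set.mem_union, Set.mem_insert_iff, Set.mem_singleton_iff,
      Set.mem_iUnion]
    rcases List.mem_cons.1 h with rfl | h
    · exact .inl (.inr rfl)
    · exact .inr ⟨0, ih h⟩

theorem Proj.spread_self {ℓ : Label} {q : Participant} {G : GType} {X : SType}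
    (h : Proj q G X) (l : List Participant) : Proj q (spread ℓ q G l) (SType.notify ℓ X l) := by
  induction l with
  | nil => exact h
  | cons r l ih => exact .send fun _ => ih

theorem Proj.spread_of_not_mem {ℓ : Label} {q r : Participant} {G : GType} {X : SType}
    (h : Proj r G X) (hr : r ≠ q) {l : List Participant} (hl : r ∉ l) :
    Proj r (spread ℓ q G l) X := by
  induction l with
  | nil => exact h
  | cons a l ih =>
    have hl' := not_or.1 (mt List.mem_cons.2 hl)
    exact .other (T := fun _ => X) hr hl'.1 (fun _ => ih hl'.2) (.single X)

theorem Proj.spread_of_mem {ℓ : Label} {q r : Participant} {G : GType} {X : SType}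
    (h : Proj r G X) (hr : r ≠ q) {l : List Participant} (hl : r ∈ l) (hn : l.Nodup) :
    Proj r (spread ℓ q G l) (.inp q 1 (fun _ => ℓ) (fun _ => .bool) fun _ => X) := by
  induction l with
  | nil => simp at hl
  | cons a l ih =>
    obtain ⟨ha, hn⟩ := List.nodup_cons.1 hn
    rcases eq_or_ne r a with rfl | hra
    · exact .recv hr.symm fun _ => h.spread_of_not_mem hr ha
    · exact .other (T := fun _ => _) hr hra
        (fun _ => ih ((List.mem_cons.1 hl).resolve_left hra) hn) (.single _)

end GType

namespace SType

/-- Inputs with different labels from the same participant merge into one intersection. -/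
theorem mergeAll_inp {q : Participant} {n : ℕ} (hn : 0 < n) {ℓ : Fin n → Label}
    (hℓ : Function.Injective ℓ) (S : Srt) (X : Fin n → SType) :
    MergeAll (Finset.univ.val.map fun i =>
        SType.inp q 1 (fun _ => ℓ i) (fun _ => S) fun _ => X i)
      (.inp q n ℓ (fun _ => S) X) := by
  induction n with
  | zero => omega
  | succ n ih =>
    cases n with
    | zero =>
      have key : ∀ {α : Type} (f : Fin 1 → α), f = fun _ => f 0 := fun f => by
        funext i; rw [Subsingleton.elim i 0]
      rw [key ℓ, key X]
      exact .single _
    | succ n =>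
      have h := ih (Nat.succ_pos n) (ℓ := fun i => ℓ i.castSucc)
        (hℓ.comp (Fin.castSucc_injective _)) fun i => X i.castSucc
      have := MergeAll.add h (.single (.inp q 1 (fun _ => ℓ (Fin.last (n + 1))) (fun _ => S)
        fun _ => X (Fin.last (n + 1))))
        (.inter unfolds_inp unfolds_inp fun i j hij => (Fin.castSucc_lt_last i).ne (hℓ hij))
      rw [Fin.append_snoc ℓ, Fin.append_snoc X, Fin.append_snoc fun _ => S] at this
      convert this using 1
      rw [Fin.univ_castSuccEmb, Finset.cons_val, Multiset.map_cons, Finset.map_val,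
        Multiset.map_map, ← Multiset.singleton_add]
      exact add_comm _ _

/-- The global type in which the participant `N` has the given session type. -/
def globalize (N : ℕ) : SType → GType
  | .inp q n ℓ S T =>
    .comm q N n ℓ S fun i => GType.spread (ℓ i) q ((T i).globalize N) (others N q)
  | .out q n ℓ S T =>
    .comm N q n ℓ S fun i => GType.spread (ℓ i) q ((T i).globalize N) (others N q)
  | .mu T => .mu (T.globalize N)
  | .var t => .var t
  | .done => .done

theorem globalize_closedAt_iff {N : ℕ} {T : SType} {k : ℕ} :
    (T.globalize N).ClosedAt k ↔ T.ClosedAt k := by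
  induction T generalizing k with
  | inp q n ℓ S T ih => exact forall_congr' fun i => GType.spread_closedAt_iff.trans (ih i)
  | out q n ℓ S T ih => exact forall_congr' fun i => GType.spread_closedAt_iff.trans (ih i)
  | mu T ih => exact ih
  | var t => rfl
  | done => rfl

theorem globalize_unguarded {N : ℕ} {T : SType} {t : ℕ} (h : (T.globalize N).Unguarded t) :
    T.Unguarded t := by
  induction T generalizing t with
  | inp => exact h
  | out => exact h
  | mu T ih => exact ih (t := t + 1) h
  | var s => exact h
  | done => exact h

theorem globalize_wellFormed {N : ℕ} {T : SType} (h : T.WellFormed) (hN : T.NamesBelow N) :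
    (T.globalize N).WellFormed := by
  induction T with
  | inp q n ℓ S T ih =>
    exact ⟨hN.1.ne, h.1, h.2.1, fun i => GType.spread_wellFormed (ih i (h.2.2 i) (hN.2 i))
      fun r hr => (mem_others.1 hr).2⟩
  | out q n ℓ S T ih =>
    exact ⟨hN.1.ne', h.1, h.2.1, fun i => GType.spread_wellFormed (ih i (h.2.2 i) (hN.2 i))
      fun r hr => (mem_others.1 hr).2⟩
  | mu T ih => exact ⟨fun h' => h.1 (globalize_unguarded h'), ih h.2 hN⟩
  | var t => trivial
  | done => trivial

theorem le_of_mem_participants_globalize {N : ℕ} {T : SType} (hN : T.NamesBelow N)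
    {r : Participant} (h : r ∈ (T.globalize N).participants) : r ≤ N := by
  induction T with
  | inp q n ℓ S T ih =>
    simp only [globalize, GType.participants, Set.mem_union, Set.mem_insert_iff,
      Set.mem_singleton_iff, Set.mem_iUnion] at h
    rcases h with (rfl | rfl) | ⟨i, h⟩
    · exact hN.1.le
    · exact le_rfl
    · rcases GType.mem_participants_spread h with rfl | h | h
      · exact hN.1.le
      · exact (mem_others.1 h).1.le
      · exact ih i (hN.2 i) h
  | out q n ℓ S T ih =>
    simp only [globalize, GType.participants, Set.mem_union, Set.mem_insert_iff,
      Set.mem_singleton_iff, Set.mem_iUnion] at h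
    rcases h with (rfl | rfl) | ⟨i, h⟩
    · exact le_rfl
    · exact hN.1.le
    · rcases GType.mem_participants_spread h with rfl | h | h
      · exact hN.1.le
      · exact (mem_others.1 h).1.le
      · exact ih i (hN.2 i) h
  | mu T ih => exact ih hN h
  | var t => exact h.elim
  | done => exact h.elim

/-- Every communication involves the whole network, as all others are notified. -/
theorem HasComm.mem_participants {T : SType} (h : T.HasComm) (hT : T.WellFormed) {N : ℕ}
    {r : Participant} (hr : r ≤ N) : r ∈ (T.globalize N).participants := by
  have key : ∀ (q : Participant) {n : ℕ} (ℓ : Fin n → Label) (T : Fin n → SType), 0 < n →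
      r = q ∨ r = N ∨
        ∃ i, r ∈ (GType.spread (ℓ i) q ((T i).globalize N) (others N q)).participants := by
    intro q n ℓ T hn
    by_cases h1 : r = q
    · exact .inl h1
    · by_cases h2 : r = N
      · exact .inr (.inl h2)
      · exact .inr (.inr ⟨⟨0, hn⟩, GType.mem_participants_spread_of_mem
          (mem_others.2 ⟨lt_of_le_of_ne hr h2, h1⟩)⟩)
  induction T with
  | inp q n ℓ S T ih =>
    simp only [globalize, GType.participants, Set.mem_union, Set.mem_insert_iff,
      Set.mem_singleton_iff, Set.mem_iUnion]
    exact or_assoc.2 (key q ℓ T hT.1)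
  | out q n ℓ S T ih =>
    simp only [globalize, GType.participants, Set.mem_union, Set.mem_insert_iff,
      Set.mem_singleton_iff, Set.mem_iUnion]
    rw [or_comm (a := r = N)]
    exact or_assoc.2 (key q ℓ T hT.1)
  | mu T ih => exact ih h hT.2
  | var t => exact h.elim
  | done => exact h.elim

/-- The tested process has the given type. Tightness ensures that no recursion is projected to
`end`. -/
theorem proj_globalize {N : ℕ} {T : SType} (hT : T.WellFormed) (ht : T.Tight)
    (hN : T.NamesBelow N) : GType.Proj N (T.globalize N) T := by
  have mem : ∀ q, N ∉ others N q := fun q h => (mem_others.1 h).1.false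
  induction T with
  | inp q n ℓ S T ih =>
    exact .recv hN.1.ne fun i =>
      (ih i (hT.2.2 i) (ht i) (hN.2 i)).spread_of_not_mem hN.1.ne' (mem q)
  | out q n ℓ S T ih =>
    exact .send fun i =>
      (ih i (hT.2.2 i) (ht i) (hN.2 i)).spread_of_not_mem hN.1.ne' (mem q)
  | mu T ih =>
    refine .mu (ht.1.imp (fun h => h.mem_participants hT.2 le_rfl) fun h h' => h ?_)
      (ih hT.2 ht.2 hN)
    exact globalize_closedAt_iff.1 h'
  | var t => exact .var t
  | done => exact .done

theorem proj_globalize_peer {N : ℕ} {T : SType} (hT : T.WellFormed) (ht : T.Tight)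
    (hN : T.NamesBelow N) {r : Participant} (hr : r < N) :
    GType.Proj r (T.globalize N) (T.peer N r) := by
  induction T with
  | inp q n ℓ S T ih =>
    have ih := fun i => ih i (hT.2.2 i) (ht i) (hN.2 i)
    rw [peer]
    split_ifs with h
    · subst h
      exact .send fun i => (ih i).spread_self _
    · exact .other h hr.ne (fun i => (ih i).spread_of_mem h (mem_others.2 ⟨hr, h⟩)
        (nodup_others N q)) (mergeAll_inp hT.1 hT.2.1 _ _)
  | out q n ℓ S T ih =>
    have ih := fun i => ih i (hT.2.2 i) (ht i) (hN.2 i)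
    rw [peer]
    split_ifs with h
    · subst h
      exact .recv hr.ne' fun i => (ih i).spread_self _
    · exact .other hr.ne h (fun i => (ih i).spread_of_mem h (mem_others.2 ⟨hr, h⟩)
        (nodup_others N q)) (mergeAll_inp hT.1 hT.2.1 _ _)
  | mu T ih =>
    refine .mu (ht.1.imp (fun h => h.mem_participants hT.2 hr.le) fun h h' => h ?_)
      (ih hT.2 ht.2 hN)
    exact globalize_closedAt_iff.1 h'
  | var t => exact .var t
  | done => exact .done

end SType

/-! ### The session of the network -/

namespace Session

/-- The session in which each participant `r ≤ n` runs `f r`. -/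
def upTo (f : Participant → Proc) : ℕ → Session
  | 0 => .pa 0 (f 0)
  | n + 1 => .par (upTo f n) (.pa (n + 1) (f (n + 1)))

theorem upTo_components (f : Participant → Proc) (n : ℕ) :
    (upTo f n).components = (List.range (n + 1)).map fun r => (r, f r) := by
  induction n with
  | zero => rfl
  | succ n ih => rw [upTo, components, ih, List.range_succ (n := n + 1), List.map_append]; rfl

theorem upTo_guarded {f : Participant → Proc} (hf : ∀ r, (f r).Guarded) (n : ℕ) :
    (upTo f n).Guarded := by
  induction n with
  | zero => exact hf 0
  | succ n ih => exact ⟨ih, hf _⟩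

theorem upTo_config (f : Participant → Proc) (n : ℕ) : (upTo f n).config = Config.conf n f := by
  induction n with
  | zero => simp [upTo, config, Config.conf]
  | succ n ih =>
    rw [upTo, config, ih, Config.conf, Config.conf, Finset.sum_range_succ _ (n + 1)]
    rfl

theorem net_config (P : Proc) (U : SType) (n : ℕ) :
    (Session.par (.pa (n + 1) P) (upTo (fun r => (U.peer (n + 1) r).char) n)).config =
      Config.conf (n + 1) (Config.net (n + 1) P U) := by
  rw [config, upTo_config, config, Config.conf, Config.conf, Finset.sum_range_succ _ (n + 1),
    add_comm]
  congr 1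
  · refine Finset.sum_congr rfl fun r hr => ?_
    rw [Config.net, if_neg (Finset.mem_range.1 hr).ne]
  · rw [Config.net, if_pos rfl]

/-- The network for a type is well typed with any process of this type. -/
theorem net_typable {U : SType} (hU : U.IsSessionType) (ht : U.Tight) {n : ℕ}
    (hN : U.NamesBelow (n + 1)) {Q : Proc} (hQ : Proc.HasType [] [] Q U) :
    (Session.par (.pa (n + 1) Q) (upTo (fun r => (U.peer (n + 1) r).char) n)).Typable := by
  refine ⟨U.globalize (n + 1), ⟨SType.globalize_closedAt_iff.2 hU.1,
    SType.globalize_wellFormed hU.2 hN⟩, ?_, fun c hc => ?_, fun r hr => ?_⟩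
  · simp only [components, upTo_components, List.map_map, List.map_cons, List.singleton_append]
    refine List.nodup_cons.2 ⟨?_, ?_⟩
    · simp
    · exact List.Nodup.map (fun _ _ h => h) List.nodup_range
  · simp only [components, upTo_components, List.singleton_append, List.mem_cons, List.mem_map,
      List.mem_range] at hc
    rcases hc with rfl | ⟨r, hr, rfl⟩
    · exact ⟨U, SType.proj_globalize hU.2 ht hN, hQ⟩
    · exact ⟨_, SType.proj_globalize_peer hU.2 ht hN hr, (hU.peer _ _).char_hasType⟩
  · have := SType.le_of_mem_participants_globalize hN hr
    simp only [components, upTo_components, List.map_map, List.map_cons, List.singleton_append,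
      List.mem_cons, List.mem_map, List.mem_range, Function.comp_apply, exists_eq_right]
    exact (Nat.eq_or_lt_of_le this).imp id id

end Session
end MPST

/-- Synchronous multiparty session subtyping is operationally precise. -/
theorem mainTheorem1 : MPST.OperationallyPrecise MPST.SType.Subtype := by
  intro T T' hT hT'
  constructor
  · rintro h ⟨P, p, M, hP, hM, hPT, hQ, hs⟩
    exact (hQ P hP (.sub hPT hT' h)).not_getsStuck ⟨hP, hM⟩ hs
  · intro h
    by_contra hsub
    obtain ⟨n, hn⟩ := T'.exists_namesBelow
    have hb := (hn.mono (Nat.le_succ n)).norm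
    refine h ⟨T.char, n + 1, .upTo (fun r => (T'.norm.peer (n + 1) r).char) n,
      hT.2.char_guarded, MPST.Session.upTo_guarded
        (fun r => (hT'.norm.peer _ r).2.char_guarded) n, hT.char_hasType,
      fun Q _ hQ => MPST.Session.net_typable hT'.norm T'.norm_tight hb
        (.sub hQ hT'.norm hT'.subtype_norm), ?_⟩
    rw [MPST.Session.getsStuck_iff, MPST.Session.net_config]
    by_contra hs
    exact hsub ((MPST.Config.subtype_of_not_getsStuck hT hT'.norm hb hs).trans hT'.norm_subtype)
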